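/- **Theorem (Generic hyperbolic structure equations).** All objects are smooth ($C^\infty$). Let $F(x,y,z,p,q,r,s,t)=0$, with $F$ smooth on an open subset of $J^2(\mathbb R^2,\mathbb R)=\mathbb R^8$, have a nondegenerate parametrization $i_F:\Sigma_7\to J^2(\mathbb R^2,\mathbb R)$: $\Sigma_7\subset\mathbb R^7$ is open, $i_F$ is smooth with image the locus $\{F=0\}$, $i_F$ has rank $7$ everywhere, and $\operatorname{im}(i_{F*})+\ker(\pi^2_{1*})=TJ^2$ along $i_F$, where $\pi^2_1:J^2\to J^1$ is the projection. Let $I_F$ be the Pfaffian system generated by the pullbacks $\theta^1_F,\theta^2_F,\theta^3_F$ by $i_F$ of $dz-p\,dx-q\,dy$, $dp-r\,dx-s\,dy$, $dq-s\,dx-t\,dy$, and let $\langle\varphi,\psi\rangle_7\,\mathrm{Vol}=d\varphi\wedge d\psi\wedge\theta^1_F\wedge\theta^2_F\wedge\theta^3_F$ for $\varphi,\psi\in I_F$, where $\mathrm{Vol}$ is any volume form. Let $W\subset\Sigma_7$ be an open set on which the equation is hyperbolic, i.e. $F_rF_t-\tfrac14F_s^2<0$ at $i_F(p)$ for all $p\in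 W$, and let $M_1,M_2$ be a labelling on $W$ of the two isotropic systems of $I_F$: smooth rank $2$ subsystems of $I_F$, isotropic for $\langle\cdot,\cdot\rangle_7$ and different from each other at every point of $W$. Suppose that the equation is generic on $W$: at every point of $W$, $M_1$ and $M_2$ have class $7$. Here the class of $M$ at $p$ is the dimension of the annihilator of $\{v\in T_p\Sigma_7: v\in M^\perp,\ v\lrcorner dM\subset M\}$. For a Pfaffian system $I$ let $I^{(1)}=\{\varphi\in I: d\varphi\equiv0 \bmod I\}$ be its first derived system and $I^{(2)}=(I^{(1)})^{(1)}$; let $C(I_F,dM_i)$ be the annihilator of $\mathrm{Char}(I_F,dM_i)=\{X\in I_F^\perp: X\lrcorner dM_i\subset I_F\}$. Braces $\{\dots\}$ around $1$-forms denote the Pfaffian system they generate, and congruences are modulo the algebraic ideal it generates in the exterior algebra. Then every point of $W$ has an open neighbourhood $U\subset W$ with a smooth coframe $\omega^1,\dots,\omega^7$ on $U$ and a constant $\epsilon\in\{1,-1\}$ such that on $U$: 1) $I_F=\{\omega^1,\omega^2,\omega^3\}$, $I_F^{(1)}=\{\omega^1\}$, $M_1=\{\omega^1,\omega^2\}$,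 $M_2=\{\omega^1,\omega^3\}$; 2) $$\begin{aligned} d\omega^1&\equiv\omega^3\wedge\omega^6+\omega^2\wedge\omega^4 &&\bmod I_F^{(1)},\\ d\omega^2&\equiv\omega^4\wedge\omega^5+\omega^3\wedge\omega^7 &&\bmod M_1,\\ d\omega^3&\equiv\omega^6\wedge\omega^7+\epsilon\,\omega^2\wedge\omega^5 &&\bmod M_2;\end{aligned}$$ 3) $$\begin{aligned} C(I_F,dM_1)&=\{\omega^1,\omega^2,\omega^3,\omega^4,\omega^5\}, & C(I_F,dM_2)&=\{\omega^1,\omega^2,\omega^3,\omega^6,\omega^7\},\\ C(I_F,dM_1)^{(1)}&=\{\omega^1,\omega^2,\omega^4,\omega^5\}, & C(I_F,dM_2)^{(1)}&=\{\omega^1,\omega^3,\omega^6,\omega^7\},\\ C(I_F,dM_1)^{(2)}&=\{\omega^4,\omega^5\}, & C(I_F,dM_2)^{(2)}&=\{\omega^6,\omega^7\}.\end{aligned}$$ -/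

import Mathlib

open scoped ContDiff Topology

noncomputable section

namespace HypPDE

/-- The space of which the parameter domain is an open subset. -/
abbrev V : Type := Fin 7 → ℝ

/-- The jet space `J²(ℝ², ℝ)`, with coordinates `(x, y, z, p, q, r, s, t)` numbered `0, …, 7`. -/
abbrev J2 : Type := Fin 8 → ℝ

/-- Covectors. -/
abbrev CoV : Type := V →L[ℝ] ℝ

/-- The exterior algebra of the cotangent space; multiplication is the wedge product. -/
abbrev Ext : Type := ExteriorAlgebra ℝ CoV

/-- A covector as an element of degree one of the exterior algebra. -/
abbrev one (α : CoV) : Ext := ExteriorAlgebra.ι ℝ α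

/-- The coordinate covector `dxⁱ`. -/
def dx (i : Fin 7) : CoV := ContinuousLinearMap.proj i

/-- The exterior derivative at `p` of a 1-form, as an alternating bilinear map. -/
def dAlt (φ : V → CoV) (p : V) : V [⋀^Fin 2]→L[ℝ] ℝ :=
  extDeriv (fun q => ContinuousAlternatingMap.ofSubsingleton ℝ V ℝ (0 : Fin 1) (φ q)) p

/-- An alternating bilinear map `Ω` as the element `∑_{i<j} Ω(eᵢ, eⱼ) dxⁱ ∧ dxʲ` of the
exterior algebra. -/
def toExt (Ω : V [⋀^Fin 2]→L[ℝ] ℝ) : Ext :=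
  ∑ i : Fin 7, ∑ j ∈ Finset.Ioi i,
    Ω ![Pi.single i 1, Pi.single j 1] • (one (dx i) * one (dx j))

/-- The exterior derivative at `p` of a 1-form, as an element of the exterior algebra. -/
def d (φ : V → CoV) (p : V) : Ext := toExt (dAlt φ p)

/-- The interior product `v ⌟ Ω` of a vector with a 2-form. -/
def interiorProd (v : V) (Ω : V [⋀^Fin 2]→L[ℝ] ℝ) : CoV :=
  (ContinuousAlternatingMap.ofSubsingleton ℝ V ℝ (0 : Fin 1)).symm (Ω.curryLeft v)

/-- A Pfaffian system, given by its fibres in the cotangent spaces. -/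
abbrev PSystem : Type := V → Submodule ℝ CoV

/-- `φ` is a smooth 1-form near `p` that belongs to the Pfaffian system `I`. -/
def IsSectionNear (I : PSystem) (p : V) (φ : V → CoV) : Prop :=
  ∀ᶠ q in 𝓝 p, ContDiffAt ℝ ∞ φ q ∧ φ q ∈ I q

/-- On `W`, the system `I` is smooth of constant rank `k`: locally it has a smooth frame. -/
def IsSmoothOfRank (k : ℕ) (W : Set V) (I : PSystem) : Prop :=
  ∀ p ∈ W, ∃ φ : Fin k → V → CoV, ∀ᶠ q in 𝓝 p,
    (∀ j, ContDiffAt ℝ ∞ (φ j) q) ∧ LinearIndependent ℝ (fun j => φ j q) ∧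
      I q = Submodule.span ℝ (Set.range fun j => φ j q)

/-- The ideal of the exterior algebra generated by a space of covectors. (Left multiples suffice,
since the generators have degree one.) -/
def algIdeal (A : Submodule ℝ CoV) : Ideal Ext := Ideal.span (one '' (A : Set CoV))

/-- Congruence of elements of the exterior algebra modulo a space of covectors. -/
def CongrMod (A : Submodule ℝ CoV) (Ω Ω' : Ext) : Prop := Ω - Ω' ∈ algIdeal A

theorem toExt_add (Ω Ω' : V [⋀^Fin 2]→L[ℝ] ℝ) : toExt (Ω + Ω') = toExt Ω + toExt Ω' := by
  simp [toExt, add_smul, Finset.sum_add_distrib]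

theorem toExt_smul (c : ℝ) (Ω : V [⋀^Fin 2]→L[ℝ] ℝ) : toExt (c • Ω) = c • toExt Ω := by
  simp [toExt, mul_smul, Finset.smul_sum]

theorem differentiableAt_ofSubsingleton {φ : V → CoV} {p : V} (h : DifferentiableAt ℝ φ p) :
    DifferentiableAt ℝ
      (fun q => ContinuousAlternatingMap.ofSubsingleton ℝ V ℝ (0 : Fin 1) (φ q)) p :=
  (ContinuousAlternatingMap.ofSubsingletonLIE (𝕜 := ℝ) (E := V) (F := ℝ)
    (0 : Fin 1)).differentiableAt.comp p h

theorem d_add {φ ψ : V → CoV} {p : V} (hφ : DifferentiableAt ℝ φ p)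
    (hψ : DifferentiableAt ℝ ψ p) : d (φ + ψ) p = d φ p + d ψ p := by
  have h := extDeriv_add (differentiableAt_ofSubsingleton hφ) (differentiableAt_ofSubsingleton hψ)
  rw [d, d, d, ← toExt_add]
  exact congrArg toExt h

theorem d_smul (c : ℝ) (φ : V → CoV) (p : V) : d (c • φ) p = c • d φ p := by
  have h := extDeriv_smul (x := p) c
    (fun q => ContinuousAlternatingMap.ofSubsingleton ℝ V ℝ (0 : Fin 1) (φ q))
  rw [d, d, ← toExt_smul]
  exact congrArg toExt h

/-- The first derived system: its local sections are the local sections `φ` of `I` with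
`dφ ≡ 0 mod I`. -/
def derived (I : PSystem) : PSystem := fun p =>
  { carrier := {α | ∃ φ : V → CoV, IsSectionNear I p φ ∧
      (∀ᶠ q in 𝓝 p, CongrMod (I q) (d φ q) 0) ∧ φ p = α}
    zero_mem' := by
      refine ⟨0, Filter.Eventually.of_forall fun q => ⟨contDiffAt_const, zero_mem _⟩,
        Filter.Eventually.of_forall fun q => ?_, rfl⟩
      have h : d (0 : V → CoV) q = 0 := by
        have h' := d_smul 0 (0 : V → CoV) q
        rwa [zero_smul, zero_smul] at h'
      simp [CongrMod, h]
    add_mem' := by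
      rintro α β ⟨φ, hφ, hφ', rfl⟩ ⟨ψ, hψ, hψ', rfl⟩
      refine ⟨φ + ψ, ?_, ?_, rfl⟩
      · filter_upwards [hφ, hψ] with q h1 h2
        exact ⟨h1.1.add h2.1, add_mem h1.2 h2.2⟩
      · filter_upwards [hφ, hψ, hφ', hψ'] with q h1 h2 h3 h4
        have := d_add (h1.1.differentiableAt (by simp)) (h2.1.differentiableAt (by simp))
        simp only [CongrMod, sub_zero] at h3 h4 ⊢
        rw [this]
        exact add_mem h3 h4
    smul_mem' := by
      rintro c α ⟨φ, hφ, hφ', rfl⟩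
      refine ⟨c • φ, ?_, ?_, rfl⟩
      · filter_upwards [hφ] with q h1
        exact ⟨contDiffAt_const.smul h1.1, (I q).smul_mem c h1.2⟩
      · filter_upwards [hφ'] with q h3
        simp only [CongrMod, sub_zero] at h3 ⊢
        rw [d_smul, ← one_mul (d φ q), ← smul_mul_assoc]
        exact Ideal.mul_mem_left _ _ h3 }

/-- The fibre at `p` of `Char(I, dM)`: the vectors `v` with `v ∈ I^⊥` and `v ⌟ dM ⊆ I`. -/
def charSpace (I M : PSystem) (p : V) : Submodule ℝ V where
  carrier := {v | (∀ α ∈ I p, α v = 0) ∧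
    ∀ φ : V → CoV, IsSectionNear M p φ → interiorProd v (dAlt φ p) ∈ I p}
  zero_mem' := by
    refine ⟨fun α _ => map_zero α, fun φ _ => ?_⟩
    have : interiorProd 0 (dAlt φ p) = 0 := by ext w; simp [interiorProd]
    rw [this]; exact zero_mem _
  add_mem' := by
    rintro v w ⟨hv, hv'⟩ ⟨hw, hw'⟩
    refine ⟨fun α h => by rw [map_add, hv α h, hw α h, add_zero], fun φ h => ?_⟩
    have : interiorProd (v + w) (dAlt φ p) = interiorProd v (dAlt φ p) + interiorProd w (dAlt φ p) := by
      ext u; simp [interiorProd]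
    rw [this]; exact add_mem (hv' φ h) (hw' φ h)
  smul_mem' := by
    rintro c v ⟨hv, hv'⟩
    refine ⟨fun α h => by rw [map_smul, hv α h, smul_zero], fun φ h => ?_⟩
    have : interiorProd (c • v) (dAlt φ p) = c • interiorProd v (dAlt φ p) := by
      ext u; simp [interiorProd]
    rw [this]; exact (I p).smul_mem c (hv' φ h)

/-- The covectors that annihilate a space of vectors. -/
def annihilator (K : Submodule ℝ V) : Submodule ℝ CoV where
  carrier := {α | ∀ v ∈ K, α v = 0}
  zero_mem' := fun _ _ => rfl
  add_mem' := fun {α β} hα hβ v hv => by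
    rw [add_apply, hα v hv, hβ v hv, add_zero]
  smul_mem' := fun c α hα v hv => by
    rw [smul_apply, hα v hv, smul_zero]

/-- The system `C(I, dM) = Char(I, dM)^⊥`. -/
def charSystem (I M : PSystem) : PSystem := fun p => annihilator (charSpace I M p)

/-- The class of the Pfaffian system `M` at `p`: the rank of its Cartan system, the annihilator
of the Cauchy characteristic space `{v ∈ M^⊥ | v ⌟ dM ⊆ M}`. -/
def classAt (M : PSystem) (p : V) : ℕ := Module.finrank ℝ (charSystem M M p)

/-- The contact forms `dz - p dx - q dy`, `dp - r dx - s dy`, `dq - s dx - t dy` at a 2-jet `j`. -/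
def contact (j : J2) : Fin 3 → (J2 →L[ℝ] ℝ) :=
  let e : Fin 8 → (J2 →L[ℝ] ℝ) := fun k => ContinuousLinearMap.proj k
  ![e 2 - j 3 • e 0 - j 4 • e 1,
    e 3 - j 5 • e 0 - j 6 • e 1,
    e 4 - j 6 • e 0 - j 7 • e 1]

/-- The pullbacks of the contact forms by a parametrization `i`. -/
def pullContact (i : V → J2) (a : Fin 3) (p : V) : CoV := (contact (i p) a).comp (fderiv ℝ i p)

/-- The Pfaffian system `I_F` generated by the pullbacks of the contact forms. -/
def contactSystem (i : V → J2) : PSystem := fun p =>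
  Submodule.span ℝ (Set.range fun a => pullContact i a p)

/-- The locus of `F = 0`, for `F` defined on `D`. -/
def locus (D : Set J2) (F : J2 → ℝ) : Set J2 := {j ∈ D | F j = 0}

/-- `i : S → J²` is a nondegenerate parametrization of the equation `F = 0`, where `F` is a smooth
function on the open set `D` of 2-jets. -/
structure IsNondegenerateParametrization (D : Set J2) (F : J2 → ℝ) (S : Set V) (i : V → J2) :
    Prop where
  isOpen_domain : IsOpen D
  smooth_eqn : ContDiffOn ℝ ∞ F D
  isOpen_param : IsOpen S
  smooth_param : ContDiffOn ℝ ∞ i S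
  image_eq : i '' S = locus D F
  maximal_rank : ∀ p ∈ S, Function.Injective (fderiv ℝ i p)
  /-- The image of the differential and the vertical space of `J² → J¹` span the tangent space. -/
  transverse : ∀ p ∈ S, ∀ w : J2, ∃ (v : V) (u : J2),
    u 0 = 0 ∧ u 1 = 0 ∧ u 2 = 0 ∧ u 3 = 0 ∧ u 4 = 0 ∧ w = fderiv ℝ i p v + u

/-- The discriminant `F_r F_t - F_s² / 4`. -/
def disc (F : J2 → ℝ) (j : J2) : ℝ :=
  let D : Fin 8 → ℝ := fun k => fderiv ℝ F j (Pi.single k 1)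
  D 5 * D 7 - D 6 ^ 2 / 4

/-- The equation is hyperbolic at all points of `W`. -/
def IsHyperbolicOn (F : J2 → ℝ) (i : V → J2) (W : Set V) : Prop := ∀ p ∈ W, disc F (i p) < 0

/-- The form `⟨φ, ψ⟩₇ Vol = dφ ∧ dψ ∧ ω¹ ∧ ω² ∧ ω³` of degree seven, at `p`, where
`ω¹, ω², ω³` are the pullbacks of the contact forms. -/
def pairing (i : V → J2) (φ ψ : V → CoV) (p : V) : Ext :=
  d φ p * d ψ p * one (pullContact i 0 p) * one (pullContact i 1 p) * one (pullContact i 2 p)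

/-- `M` is, on `W`, a smooth rank two subsystem of `I_F` that is isotropic for `⟨·, ·⟩₇`. -/
structure IsIsotropicSystem (i : V → J2) (W : Set V) (M : PSystem) : Prop where
  smooth : IsSmoothOfRank 2 W M
  le : ∀ p ∈ W, M p ≤ contactSystem i p
  isotropic : ∀ p ∈ W, ∀ φ ψ : V → CoV, IsSectionNear M p φ → IsSectionNear M p ψ →
    pairing i φ ψ p = 0

/-- `M₁, M₂` is a labelling, over `W`, of the two isotropic subsystems of rank two of `I_F`. -/
structure IsCharacteristicPair (i : V → J2) (W : Set V) (M₁ M₂ : PSystem) : Prop where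
  first : IsIsotropicSystem i W M₁
  second : IsIsotropicSystem i W M₂
  ne : ∀ p ∈ W, M₁ p ≠ M₂ p

/-- The generic case: `M₁` and `M₂` both have class 7 at all points of `W`. -/
def IsGenericOn (W : Set V) (M₁ M₂ : PSystem) : Prop :=
  ∀ p ∈ W, classAt M₁ p = 7 ∧ classAt M₂ p = 7

/-- `η` is a smooth coframe on `U`. -/
def IsCoframeOn (U : Set V) (η : Fin 7 → V → CoV) : Prop :=
  (∀ k, ContDiffOn ℝ ∞ (η k) U) ∧ ∀ p ∈ U, LinearIndependent ℝ (fun k => η k p)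

end HypPDE

end

noncomputable section

namespace HypPDE

/-! ### Bilinear forms and the exterior algebra -/

/-! A 2-form lies in the ideal of a space of covectors exactly when it vanishes on pairs of vectors
of their common kernel (`congrMod_d_iff`). Every congruence thus becomes an identity between
bilinear forms on a subspace, and the proof is a moving-frame reduction of a coframe `η 0, …, η 6`,
which stands for ω¹, …, ω⁷.

Shape of the isotropic systems. The contact form θ¹ is orthogonal to all of I_F, and on I_F/{θ¹} the
pairing is, up to a nonzero factor, the polarized symbol of F
(`IsIsotropicSystem.symbolForm_eq_zero`). Hyperbolicity makes it nondegenerate. Hence an isotropic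
plane contains θ¹ and projects onto a null line: Mᵢ = {θ¹, gᵢθ² + hᵢθ³} with (gᵢ, hᵢ) null
(`IsIsotropicSystem.exists_isNullSystem`).

First structure equations. Along I_F^⊥, the equation dF = 0 expresses the mixed form g₁g₂ dr + (g₁h₂
+ g₂h₁) ds + h₁h₂ dt through dx and dy. This makes dω² ≡ ω⁴∧ω⁵ and dω³ ≡ ω⁶∧ω⁷ decomposable modulo
I_F (`IsNullPair.exists_frame`, `WeakStr`).

Use of genericity. Modulo M₁ alone, dω² acquires terms ω³∧(…). Class 7 forces the coefficient of
ω³∧ω⁷ to be nonzero, since otherwise the vector dual to ω⁷ would be a Cauchy characteristic;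
likewise for ω²∧ω⁵ in dω³. The identity d² = 0 yields one relation between the remaining
coefficients (`WeakStr.str_eq`), exactly what is needed to absorb them without disturbing dω¹
(`WeakStr.exists_strEq`). Two nonvanishing functions A, B are left; scaling the coframe by powers of
a fourth root of |A/B| removes all but the sign ε of A/B (`StrEq.exists_normalized`).

Derived flags. Once the coefficients are constant, d² = 0 also removes ω⁶∧ω⁷ from dω⁴ and dω⁵ on the
common kernel of ω¹, ω², ω⁴, ω⁵. There dω⁴ and dω⁵ are combinations of dω¹ and dω², so subtracting
multiples of ω¹ and ω² puts them in the second derived system (`StrEq.exists_flagAdapted`). The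
statements for M₂ follow from the symmetry `swp`. -/

/-- The wedge product of two covectors, evaluated on two vectors. -/
def wed (α β : CoV) (u v : V) : ℝ := α u * β v - α v * β u

/-- The exterior derivative of a 1-form, evaluated on two vectors. -/
def dEval (φ : V → CoV) (p : V) (u v : V) : ℝ := dAlt φ p ![u, v]

theorem vector_eq_sum (w : V) : w = ∑ i, w i • Pi.single i 1 := by
  ext k
  simp [Pi.single_apply]

theorem covector_eq_sum (f : CoV) : f = ∑ i, f (Pi.single i 1) • dx i := by
  ext v
  conv_lhs => rw [vector_eq_sum v]
  simp [dx, mul_comm]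

theorem sum_univ_eq_sum_Ioi {M : Type*} [AddCommMonoid M] {n : ℕ} (f : Fin n → Fin n → M)
    (h : ∀ i, f i i = 0) :
    ∑ i, ∑ j, f i j = ∑ i, ∑ j ∈ Finset.Ioi i, (f i j + f j i) := by
  have h1 : ∀ i, ∑ j, f i j = ∑ j ∈ Finset.Ioi i, f i j + ∑ j ∈ Finset.Iio i, f i j := by
    intro i
    have hu : (Finset.univ : Finset (Fin n)) = insert i (Finset.Ioi i ∪ Finset.Iio i) := by
      ext j
      simp only [Finset.mem_univ, Finset.mem_insert, Finset.mem_union, Finset.mem_Ioi,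
        Finset.mem_Iio, true_iff]
      rcases lt_trichotomy j i with h | h | h <;> tauto
    rw [hu, Finset.sum_insert (by simp), h, zero_add, Finset.sum_union]
    rw [Finset.disjoint_left]
    intro j hj hj'
    simp only [Finset.mem_Ioi, Finset.mem_Iio] at hj hj'
    exact lt_asymm hj hj'
  simp_rw [h1, Finset.sum_add_distrib]
  congr 1
  apply Finset.sum_comm'
  simp

/-- A bilinear form as an element of the exterior algebra. -/
def bilExt (B : V →ₗ[ℝ] V →ₗ[ℝ] ℝ) : Ext :=
  -- The sum runs over ordered pairs, so each `dxⁱ ∧ dxʲ` occurs twice.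
  (1 / 2 : ℝ) • ∑ i : Fin 7, ∑ j : Fin 7,
    B (Pi.single i 1) (Pi.single j 1) • (one (dx i) * one (dx j))

theorem bilExt_add (B C : V →ₗ[ℝ] V →ₗ[ℝ] ℝ) : bilExt (B + C) = bilExt B + bilExt C := by
  simp [bilExt, add_smul, Finset.sum_add_distrib]

theorem bilExt_smul (c : ℝ) (B : V →ₗ[ℝ] V →ₗ[ℝ] ℝ) : bilExt (c • B) = c • bilExt B := by
  simp only [bilExt, LinearMap.smul_apply, smul_eq_mul, mul_smul, Finset.smul_sum]
  refine Finset.sum_congr rfl fun i _ => Finset.sum_congr rfl fun j _ => ?_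
  rw [smul_comm c (1 / 2 : ℝ), smul_comm c]

theorem bilExt_sub (B C : V →ₗ[ℝ] V →ₗ[ℝ] ℝ) : bilExt (B - C) = bilExt B - bilExt C := by
  simp [bilExt, sub_smul, Finset.sum_sub_distrib, smul_sub]

/-- The bilinear form of an alternating map. -/
def altBil (Ω : V [⋀^Fin 2]→L[ℝ] ℝ) : V →ₗ[ℝ] V →ₗ[ℝ] ℝ :=
  LinearMap.mk₂ ℝ (fun u v => interiorProd u Ω v) (by intros; simp [interiorProd])
    (by intros; simp [interiorProd]) (by intros; simp) (by intros; simp)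

theorem interiorProd_apply (u v : V) (Ω : V [⋀^Fin 2]→L[ℝ] ℝ) :
    interiorProd u Ω v = Ω ![u, v] := by
  simp only [interiorProd]
  change Ω.curryLeft u (fun _ => v) = _
  rw [ContinuousAlternatingMap.curryLeft_apply_apply]
  congr 1
  ext i
  fin_cases i <;> rfl

@[simp] theorem altBil_apply (Ω : V [⋀^Fin 2]→L[ℝ] ℝ) (u v : V) : altBil Ω u v = Ω ![u, v] :=
  interiorProd_apply u v Ω

theorem alt_swap (Ω : V [⋀^Fin 2]→L[ℝ] ℝ) (u v : V) : Ω ![v, u] = -Ω ![u, v] := by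
  have h := Ω.map_swap ![u, v] (i := 0) (j := 1) (by decide)
  refine Eq.trans ?_ h
  change Ω _ = Ω _
  congr 1
  ext i
  fin_cases i <;> rfl

theorem alt_self (Ω : V [⋀^Fin 2]→L[ℝ] ℝ) (u : V) : Ω ![u, u] = 0 :=
  Ω.map_eq_zero_of_eq ![u, u] (i := 0) (j := 1) rfl (by decide)

theorem one_mul_swap (α β : CoV) : one α * one β = -(one β * one α) :=
  eq_neg_of_add_eq_zero_left (ExteriorAlgebra.ι_add_mul_swap α β)

theorem one_mul_self (α : CoV) : one α * one α = 0 := ExteriorAlgebra.ι_sq_zero α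

theorem toExt_eq_bilExt (Ω : V [⋀^Fin 2]→L[ℝ] ℝ) : toExt Ω = bilExt (altBil Ω) := by
  rw [bilExt, sum_univ_eq_sum_Ioi, toExt, Finset.smul_sum]
  · refine Finset.sum_congr rfl fun i _ => ?_
    rw [Finset.smul_sum]
    refine Finset.sum_congr rfl fun j _ => ?_
    rw [altBil_apply, altBil_apply, alt_swap Ω (Pi.single i 1), one_mul_swap (dx j), neg_smul_neg,
      ← two_smul ℝ, smul_smul]
    norm_num
  · intro i
    rw [one_mul_self, smul_zero]

/-- The wedge product of two covectors as a bilinear form. -/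
def wedBil (α β : CoV) : V →ₗ[ℝ] V →ₗ[ℝ] ℝ :=
  LinearMap.mk₂ ℝ (wed α β) (by intros; simp [wed]; ring) (by intros; simp [wed]; ring)
    (by intros; simp [wed]; ring) (by intros; simp [wed]; ring)

@[simp] theorem wedBil_apply (α β : CoV) (u v : V) : wedBil α β u v = wed α β u v := rfl

theorem one_eq_sum (α : CoV) : one α = ∑ i, α (Pi.single i 1) • one (dx i) := by
  conv_lhs => rw [covector_eq_sum α]
  simp [one]

theorem one_mul_one (α β : CoV) : one α * one β =
    ∑ i, ∑ j, (α (Pi.single i 1) * β (Pi.single j 1)) • (one (dx i) * one (dx j)) := by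
  rw [one_eq_sum α, one_eq_sum β, Finset.sum_mul_sum]
  refine Finset.sum_congr rfl fun i _ => Finset.sum_congr rfl fun j _ => ?_
  rw [smul_mul_smul_comm]

theorem bilExt_wedBil (α β : CoV) : bilExt (wedBil α β) = one α * one β := by
  have h : bilExt (wedBil α β) = (1 / 2 : ℝ) • (one α * one β - one β * one α) := by
    rw [bilExt, one_mul_one α, one_mul_one β, ← Finset.sum_sub_distrib]
    congr 1
    refine Finset.sum_congr rfl fun i _ => ?_
    rw [← Finset.sum_sub_distrib]
    refine Finset.sum_congr rfl fun j _ => ?_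
    rw [← sub_smul, wedBil_apply, wed]
    congr 1
    ring
  rw [h, one_mul_swap β, sub_neg_eq_add, ← two_smul ℝ, smul_smul]
  norm_num

/-- The value on two vectors of the degree two part of an element of the exterior algebra. -/
def evalTwo (u v : V) : Ext →ₗ[ℝ] ℝ :=
  ExteriorAlgebra.liftAlternating (R := ℝ) (M := Fin 2 → ℝ)
      (Function.update 0 2 (Matrix.detRowAlternating (n := Fin 2) (R := ℝ))) ∘ₗ
    (ExteriorAlgebra.map (LinearMap.pi fun k : Fin 2 =>
      ((ContinuousLinearMap.apply ℝ ℝ (![u, v] k)).toLinearMap : CoV →ₗ[ℝ] ℝ))).toLinearMap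

theorem evalTwo_one_mul_one (u v : V) (α β : CoV) :
    evalTwo u v (one α * one β) = wed α β u v := by
  have h : ∀ a b : Fin 2 → ℝ, ExteriorAlgebra.liftAlternating (R := ℝ) (M := Fin 2 → ℝ)
      (Function.update 0 2 (Matrix.detRowAlternating (n := Fin 2) (R := ℝ)))
      (ExteriorAlgebra.ι ℝ a * ExteriorAlgebra.ι ℝ b) = a 0 * b 1 - a 1 * b 0 := by
    intro a b
    have h' : ExteriorAlgebra.ι ℝ a * ExteriorAlgebra.ι ℝ b
        = ExteriorAlgebra.ιMulti ℝ 2 ![a, b] := by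
      simp [ExteriorAlgebra.ιMulti_apply]
    rw [h', ExteriorAlgebra.liftAlternating_apply_ιMulti, Function.update_self]
    exact Matrix.det_fin_two (Matrix.of ![a, b])
  rw [evalTwo, LinearMap.comp_apply, AlgHom.toLinearMap_apply, map_mul,
    ExteriorAlgebra.map_apply_ι, ExteriorAlgebra.map_apply_ι, h]
  simp [wed]

/-- `evalTwo u v` factors through the algebra morphism of exterior algebras induced by evaluating
covectors at `u` and `v`. That morphism kills the generators of the ideal, hence the ideal. -/
theorem evalTwo_eq_zero {A : Submodule ℝ CoV} {u v : V} (hu : ∀ α ∈ A, α u = 0)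
    (hv : ∀ α ∈ A, α v = 0) {x : Ext} (hx : x ∈ algIdeal A) : evalTwo u v x = 0 := by
  rw [evalTwo, LinearMap.comp_apply, AlgHom.toLinearMap_apply]
  suffices h : ∀ x ∈ algIdeal A, ExteriorAlgebra.map (LinearMap.pi fun k : Fin 2 =>
      ((ContinuousLinearMap.apply ℝ ℝ (![u, v] k)).toLinearMap : CoV →ₗ[ℝ] ℝ)) x = 0 by
    rw [h x hx, map_zero]
  intro x hx
  induction hx using Submodule.span_induction with
  | mem x hx =>
    obtain ⟨α, hα, rfl⟩ := hx
    rw [ExteriorAlgebra.map_apply_ι, ExteriorAlgebra.ι_eq_zero_iff]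
    ext k
    fin_cases k
    · simpa using hu α hα
    · simpa using hv α hα
  | zero => exact map_zero _
  | add x y _ _ hx hy => rw [map_add, hx, hy, add_zero]
  | smul a x _ hx => rw [smul_eq_mul, map_mul, hx, mul_zero]

theorem bil_eq_sum (B : V →ₗ[ℝ] V →ₗ[ℝ] ℝ) (u v : V) :
    B u v = ∑ i, ∑ j, B (Pi.single i 1) (Pi.single j 1) * (u i * v j) := by
  conv_lhs => rw [vector_eq_sum u, vector_eq_sum v]
  simp only [map_sum, LinearMap.sum_apply, map_smul, LinearMap.smul_apply, smul_eq_mul,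
    Finset.mul_sum]
  rw [Finset.sum_comm]
  refine Finset.sum_congr rfl fun i _ => Finset.sum_congr rfl fun j _ => ?_
  ring

/-- `bilExt` retains only the antisymmetric part of a form, whence the hypothesis `hB`. -/
theorem evalTwo_bilExt (B : V →ₗ[ℝ] V →ₗ[ℝ] ℝ) (hB : ∀ u v, B v u = -B u v) (u v : V) :
    evalTwo u v (bilExt B) = B u v := by
  simp only [bilExt, map_smul, map_sum, evalTwo_one_mul_one, smul_eq_mul]
  have h1 := bil_eq_sum B u v
  have h2 := bil_eq_sum B v u
  have h3 : ∑ i, ∑ j, B (Pi.single i 1) (Pi.single j 1) * wed (dx i) (dx j) u v =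
      B u v - B v u := by
    rw [h1, h2, ← Finset.sum_sub_distrib]
    refine Finset.sum_congr rfl fun i _ => ?_
    rw [← Finset.sum_sub_distrib]
    refine Finset.sum_congr rfl fun j _ => ?_
    simp [wed, dx]
    ring
  rw [h3, hB u v]
  ring

/-! ### Ideals generated by covectors -/

theorem mem_of_forall_apply_eq_zero {A : Submodule ℝ CoV} {f : CoV}
    (h : ∀ v : V, (∀ α ∈ A, α v = 0) → f v = 0) : f ∈ A := by
  by_contra hf
  obtain ⟨ψ, hψ, hA⟩ := Submodule.exists_dual_map_eq_bot_of_notMem hf inferInstance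
  -- By reflexivity, the functional separating `f` from `A` is evaluation at a vector; that vector
  -- then contradicts `h`.
  have hev : ∀ g : CoV, ψ g = g (fun i => ψ (dx i)) := by
    intro g
    conv_lhs => rw [covector_eq_sum g]
    conv_rhs => rw [vector_eq_sum (fun i => ψ (dx i))]
    simp [mul_comm]
  refine hψ ?_
  rw [hev]
  refine h _ fun α hα => ?_
  rw [← hev]
  have : ψ α ∈ A.map ψ := ⟨α, hα, rfl⟩
  rwa [hA] at this

theorem one_mem_algIdeal {A : Submodule ℝ CoV} {α : CoV} (h : α ∈ A) : one α ∈ algIdeal A :=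
  Ideal.subset_span ⟨α, h, rfl⟩

theorem mul_one_mem_algIdeal {A : Submodule ℝ CoV} {α : CoV} (h : α ∈ A) (x : Ext) :
    x * one α ∈ algIdeal A :=
  Ideal.mul_mem_left _ _ (one_mem_algIdeal h)

theorem one_mul_one_mem_algIdeal {A : Submodule ℝ CoV} {α : CoV} (h : α ∈ A) (β : CoV) :
    one α * one β ∈ algIdeal A := by
  rw [one_mul_swap]
  exact neg_mem (mul_one_mem_algIdeal h _)

theorem smul_mem_algIdeal {A : Submodule ℝ CoV} (c : ℝ) {x : Ext} (h : x ∈ algIdeal A) :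
    c • x ∈ algIdeal A := by
  rw [Algebra.smul_def]
  exact Ideal.mul_mem_left _ _ h

/-- Let π be a projection onto the common kernel of `A` and split B(u, v) = B(u − πu, v) + B(πu, v).
As a covector in `u`, the first summand vanishes on the kernel; so does the second as a covector in
`v`. Each term therefore has a factor in `A`. -/
theorem bilExt_mem_algIdeal {A : Submodule ℝ CoV} {B : V →ₗ[ℝ] V →ₗ[ℝ] ℝ}
    (h : ∀ u v : V, (∀ α ∈ A, α u = 0) → (∀ α ∈ A, α v = 0) → B u v = 0) :
    bilExt B ∈ algIdeal A := by
  let K : Submodule ℝ V := ⨅ α ∈ A, LinearMap.ker (α : V →ₗ[ℝ] ℝ)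
  have hK : ∀ v, v ∈ K ↔ ∀ α ∈ A, α v = 0 := by
    intro v
    simp [K, Submodule.mem_iInf]
  obtain ⟨π, hπ⟩ := LinearMap.exists_leftInverse_of_injective K.subtype (by simp)
  have hπK : ∀ v, ∀ α ∈ A, α (π v : V) = 0 := fun v => (hK _).1 (π v).2
  have hπ' : ∀ v : V, (∀ α ∈ A, α v = 0) → (π v : V) = v := by
    intro v hv
    have := LinearMap.congr_fun hπ ⟨v, (hK v).2 hv⟩
    exact congrArg Subtype.val this
  let π' : V →ₗ[ℝ] V := K.subtype ∘ₗ π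
  have h1 : ∀ j : Fin 7, (∑ i : Fin 7, (B (Pi.single i 1) (Pi.single j 1)
      - B (π' (Pi.single i 1)) (Pi.single j 1)) • dx i) ∈ A := by
    intro j
    let f : CoV := LinearMap.toContinuousLinearMap
      ((B.flip (Pi.single j 1)) ∘ₗ (LinearMap.id - π'))
    have hf : f = ∑ i : Fin 7, (B (Pi.single i 1) (Pi.single j 1)
        - B (π' (Pi.single i 1)) (Pi.single j 1)) • dx i := by
      rw [covector_eq_sum f]
      simp [f]
    rw [← hf]
    refine mem_of_forall_apply_eq_zero fun v hv => ?_
    have : π' v = v := hπ' v hv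
    simp [f, this]
  have h2 : ∀ i : Fin 7, (∑ j : Fin 7, (B (π' (Pi.single i 1)) (Pi.single j 1)) • dx j) ∈ A := by
    intro i
    let f : CoV := LinearMap.toContinuousLinearMap (B (π' (Pi.single i 1)))
    have hf : f = ∑ j : Fin 7, (B (π' (Pi.single i 1)) (Pi.single j 1)) • dx j := by
      rw [covector_eq_sum f]
      simp [f]
    rw [← hf]
    refine mem_of_forall_apply_eq_zero fun v hv => ?_
    exact h _ _ (hπK _) hv
  have key : bilExt B = (1 / 2 : ℝ) •
      (∑ j : Fin 7, one (∑ i : Fin 7, (B (Pi.single i 1) (Pi.single j 1)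
        - B (π' (Pi.single i 1)) (Pi.single j 1)) • dx i) * one (dx j)
      + ∑ i : Fin 7, one (dx i) *
        one (∑ j : Fin 7, (B (π' (Pi.single i 1)) (Pi.single j 1)) • dx j)) := by
    rw [bilExt]
    congr 1
    simp only [one, map_sum, map_smul, Finset.sum_mul, Finset.mul_sum, smul_mul_assoc,
      mul_smul_comm]
    conv_rhs => rw [Finset.sum_comm, ← Finset.sum_add_distrib]
    refine Finset.sum_congr rfl fun i _ => ?_
    rw [← Finset.sum_add_distrib]
    refine Finset.sum_congr rfl fun j _ => ?_
    rw [← add_smul, sub_add_cancel]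
  rw [key]
  refine smul_mem_algIdeal _ (add_mem (sum_mem fun j _ => one_mul_one_mem_algIdeal (h1 j) _)
    (sum_mem fun i _ => mul_one_mem_algIdeal (h2 i) _))

/-- The dictionary between algebra and pointwise evaluation on which everything else rests. Two
decomposable terms suffice for all the structure equations, and zero coefficients give the condition
that defines derived systems. -/
theorem congrMod_toExt_iff {A : Submodule ℝ CoV} {Ω : V [⋀^Fin 2]→L[ℝ] ℝ}
    {α β γ δ : CoV} {c e : ℝ} :
    CongrMod A (toExt Ω) (c • (one α * one β) + e • (one γ * one δ)) ↔
      ∀ u v : V, (∀ α ∈ A, α u = 0) → (∀ α ∈ A, α v = 0) →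
        Ω ![u, v] = c * wed α β u v + e * wed γ δ u v := by
  have h : toExt Ω - (c • (one α * one β) + e • (one γ * one δ)) =
      bilExt (altBil Ω - (c • wedBil α β + e • wedBil γ δ)) := by
    rw [bilExt_sub, bilExt_add, bilExt_smul, bilExt_smul, bilExt_wedBil, bilExt_wedBil,
      toExt_eq_bilExt]
  rw [CongrMod, h]
  constructor
  · intro hm u v hu hv
    have := evalTwo_eq_zero hu hv hm
    rw [evalTwo_bilExt] at this
    · simp only [LinearMap.sub_apply, LinearMap.add_apply, LinearMap.smul_apply, altBil_apply,
        wedBil_apply, smul_eq_mul] at this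
      linarith
    · intro u v
      simp only [LinearMap.sub_apply, LinearMap.add_apply, LinearMap.smul_apply, altBil_apply,
        wedBil_apply, smul_eq_mul, alt_swap Ω u v, wed]
      ring
  · intro hm
    refine bilExt_mem_algIdeal fun u v hu hv => ?_
    simp only [LinearMap.sub_apply, LinearMap.add_apply, LinearMap.smul_apply, altBil_apply,
        wedBil_apply, smul_eq_mul]
    linarith [hm u v hu hv]

theorem congrMod_d_iff {A : Submodule ℝ CoV} {φ : V → CoV} {p : V} {α β γ δ : CoV} {c e : ℝ} :
    CongrMod A (d φ p) (c • (one α * one β) + e • (one γ * one δ)) ↔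
      ∀ u v : V, (∀ α ∈ A, α u = 0) → (∀ α ∈ A, α v = 0) →
        dEval φ p u v = c * wed α β u v + e * wed γ δ u v :=
  congrMod_toExt_iff

theorem congrMod_d_zero_iff {A : Submodule ℝ CoV} {φ : V → CoV} {p : V} :
    CongrMod A (d φ p) 0 ↔
      ∀ u v : V, (∀ α ∈ A, α u = 0) → (∀ α ∈ A, α v = 0) → dEval φ p u v = 0 := by
  have h := congrMod_d_iff (A := A) (φ := φ) (p := p) (α := 0) (β := 0) (γ := 0) (δ := 0)
    (c := 0) (e := 0)
  simpa using h

end HypPDE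
end

noncomputable section

namespace HypPDE

/-! ### Exterior derivatives of 1-forms evaluated on vectors -/

theorem dEval_eq {φ : V → CoV} {p : V} (h : DifferentiableAt ℝ φ p) (u v : V) :
    dEval φ p u v = fderiv ℝ φ p u v - fderiv ℝ φ p v u := by
  have hw : ∀ w : V, fderiv ℝ (fun q => φ q w) p = (fderiv ℝ φ p).flip w := by
    intro w
    rw [fderiv_clm_apply h (differentiableAt_const w)]
    simp
  rw [dEval, dAlt, extDeriv_apply (differentiableAt_ofSubsingleton h), Fin.sum_univ_two]
  change (-1 : ℤ) ^ 0 • fderiv ℝ (fun q => φ q v) p u +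
    (-1 : ℤ) ^ 1 • fderiv ℝ (fun q => φ q u) p v = _
  rw [hw, hw]
  simp
  ring

theorem dEval_bil (φ : V → CoV) (p u v : V) : dEval φ p u v = altBil (dAlt φ p) u v :=
  (altBil_apply _ _ _).symm

theorem dEval_swap (φ : V → CoV) (p u v : V) : dEval φ p v u = -dEval φ p u v := alt_swap _ _ _

@[simp] theorem dEval_self (φ : V → CoV) (p u : V) : dEval φ p u u = 0 := alt_self _ _

theorem dEval_congr {φ ψ : V → CoV} {p : V} (h : φ =ᶠ[𝓝 p] ψ) (u v : V) :
    dEval φ p u v = dEval ψ p u v := by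
  have h' : (fun q => ContinuousAlternatingMap.ofSubsingleton ℝ V ℝ (0 : Fin 1) (φ q)) =ᶠ[𝓝 p]
      (fun q => ContinuousAlternatingMap.ofSubsingleton ℝ V ℝ (0 : Fin 1) (ψ q)) :=
    h.mono fun q hq => by simp only [hq]
  rw [dEval, dEval, dAlt, dAlt, h'.extDeriv_eq]

theorem dEval_add {φ ψ : V → CoV} {p : V} (hφ : DifferentiableAt ℝ φ p)
    (hψ : DifferentiableAt ℝ ψ p) (u v : V) :
    dEval (fun q => φ q + ψ q) p u v = dEval φ p u v + dEval ψ p u v := by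
  rw [dEval_eq (hφ.fun_add hψ), dEval_eq hφ, dEval_eq hψ, fderiv_fun_add hφ hψ]
  simp
  ring

theorem dEval_sum {ι : Type*} (s : Finset ι) {φ : ι → V → CoV} {p : V}
    (hφ : ∀ j ∈ s, DifferentiableAt ℝ (φ j) p) (u v : V) :
    dEval (fun q => ∑ j ∈ s, φ j q) p u v = ∑ j ∈ s, dEval (φ j) p u v := by
  rw [dEval_eq (DifferentiableAt.fun_sum hφ), fderiv_fun_sum hφ]
  simp only [sum_apply]
  rw [← Finset.sum_sub_distrib]
  exact Finset.sum_congr rfl fun j hj => (dEval_eq (hφ j hj) u v).symm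

theorem dEval_smul {f : V → ℝ} {φ : V → CoV} {p : V} (hf : DifferentiableAt ℝ f p)
    (hφ : DifferentiableAt ℝ φ p) (u v : V) :
    dEval (fun q => f q • φ q) p u v =
      fderiv ℝ f p u * φ p v - fderiv ℝ f p v * φ p u + f p * dEval φ p u v := by
  rw [dEval_eq (hf.fun_smul hφ), dEval_eq hφ, fderiv_fun_smul hf hφ]
  simp
  ring

theorem dEval_sum_smul {ι : Type*} (s : Finset ι) {f : ι → V → ℝ} {η : ι → V → CoV} {p : V}
    (hf : ∀ j ∈ s, DifferentiableAt ℝ (f j) p) (hη : ∀ j ∈ s, DifferentiableAt ℝ (η j) p)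
    (u v : V) :
    dEval (fun q => ∑ j ∈ s, f j q • η j q) p u v =
      ∑ j ∈ s, (fderiv ℝ (f j) p u * η j p v - fderiv ℝ (f j) p v * η j p u
        + f j p * dEval (η j) p u v) := by
  rw [dEval_sum s fun j hj => (hf j hj).fun_smul (hη j hj)]
  exact Finset.sum_congr rfl fun j hj => dEval_smul (hf j hj) (hη j hj) u v

theorem contDiffOn_dEval {U : Set V} (hU : IsOpen U) {φ : V → CoV} {X Y : V → V}
    (hφ : ContDiffOn ℝ ∞ φ U) (hX : ContDiffOn ℝ ∞ X U) (hY : ContDiffOn ℝ ∞ Y U) :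
    ContDiffOn ℝ ∞ (fun q => dEval φ q (X q) (Y q)) U := by
  have h1 : ContDiffOn ℝ ∞ (fderiv ℝ φ) U := hφ.fderiv_of_isOpen hU (by simp)
  refine ContDiffOn.congr (f := fun q => fderiv ℝ φ q (X q) (Y q) - fderiv ℝ φ q (Y q) (X q)) ?_
    fun q hq => dEval_eq ((hφ.contDiffAt (hU.mem_nhds hq)).differentiableAt (by simp)) _ _
  exact ((h1.clm_apply hX).clm_apply hY).sub ((h1.clm_apply hY).clm_apply hX)

/-- The invariant formula for d(dφ) = 0 on three vector fields. Its three derivative terms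
differentiate constants, so only the bracket terms remain. -/
theorem dEval_lieBracket_cyclic {U : Set V} (hU : IsOpen U) {φ : V → CoV} {X Y Z : V → V}
    (hφ : ContDiffOn ℝ ∞ φ U) (hX : ContDiffOn ℝ ∞ X U) (hY : ContDiffOn ℝ ∞ Y U)
    (hZ : ContDiffOn ℝ ∞ Z U) {c₁ c₂ c₃ : ℝ}
    (h₁ : ∀ q ∈ U, dEval φ q (X q) (Y q) = c₁) (h₂ : ∀ q ∈ U, dEval φ q (Y q) (Z q) = c₂)
    (h₃ : ∀ q ∈ U, dEval φ q (Z q) (X q) = c₃) {q : V} (hq : q ∈ U) :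
    dEval φ q (VectorField.lieBracket ℝ X Y q) (Z q)
      + dEval φ q (VectorField.lieBracket ℝ Y Z q) (X q)
      + dEval φ q (VectorField.lieBracket ℝ Z X q) (Y q) = 0 := by
  have hφ' := hφ.contDiffAt (hU.mem_nhds hq)
  have hω : ContDiffAt ℝ ∞
      (fun q => ContinuousAlternatingMap.ofSubsingleton ℝ V ℝ (0 : Fin 1) (φ q)) q :=
    (ContinuousAlternatingMap.ofSubsingletonLIE (𝕜 := ℝ) (E := V) (F := ℝ)
      (0 : Fin 1)).contDiff.contDiffAt.comp q hφ'
  have hdd : extDeriv (dAlt φ) q = 0 := extDeriv_extDeriv_apply hω (by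
    simpa using (WithTop.coe_le_coe.2 (le_top : (2 : ℕ∞) ≤ ⊤) : (2 : WithTop ℕ∞) ≤ ∞))
  have hdiff : DifferentiableAt ℝ (dAlt φ) q := by
    have h1 : ContDiffAt ℝ 1 (fderiv ℝ
        (fun q => ContinuousAlternatingMap.ofSubsingleton ℝ V ℝ (0 : Fin 1) (φ q))) q :=
      hω.fderiv_right (m := 1) (by norm_cast)
    have h2 : DifferentiableAt ℝ ((ContinuousAlternatingMap.alternatizeUncurryFinCLM ℝ V ℝ) ∘
        fderiv ℝ (fun q => ContinuousAlternatingMap.ofSubsingleton ℝ V ℝ (0 : Fin 1) (φ q))) q :=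
      (ContinuousLinearMap.differentiableAt _).comp q (h1.differentiableAt (by simp))
    exact h2
  have hd : ∀ W : V → V, ContDiffOn ℝ ∞ W U → DifferentiableAt ℝ W q := fun W hW =>
    (hW.contDiffAt (hU.mem_nhds hq)).differentiableAt (by simp)
  have key := extDeriv_apply_vectorField (V := ![X, Y, Z]) hdiff (by
    intro i
    fin_cases i
    · exact hd X hX
    · exact hd Y hY
    · exact hd Z hZ)
  have hc : ∀ (g : V → ℝ) (c : ℝ), (∀ q ∈ U, g q = c) → fderiv ℝ g q = 0 := by
    intro g c hg
    have : g =ᶠ[𝓝 q] fun _ => c := Filter.eventually_of_mem (hU.mem_nhds hq) hg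
    rw [this.fderiv_eq]
    simp
  have e0 : ∀ x, Fin.removeNth (0 : Fin 3) (fun i => (![X, Y, Z] : Fin 3 → V → V) i x)
      = ![Y x, Z x] := by
    intro x; ext j : 1; fin_cases j <;> rfl
  have e1 : ∀ x, Fin.removeNth (1 : Fin 3) (fun i => (![X, Y, Z] : Fin 3 → V → V) i x)
      = ![X x, Z x] := by
    intro x; ext j : 1; fin_cases j <;> rfl
  have e2 : ∀ x, Fin.removeNth (2 : Fin 3) (fun i => (![X, Y, Z] : Fin 3 → V → V) i x)
      = ![X x, Y x] := by
    intro x; ext j : 1; fin_cases j <;> rfl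
  have f0 : fderiv ℝ (fun x => dAlt φ x ![Y x, Z x]) q = 0 := hc _ _ h₂
  have f1 : fderiv ℝ (fun x => dAlt φ x ![X x, Z x]) q = 0 := hc _ (-c₃) fun x hx => by
    rw [← h₃ x hx, ← dEval_swap]; rfl
  have f2 : fderiv ℝ (fun x => dAlt φ x ![X x, Y x]) q = 0 := hc _ _ h₁
  have i0 : Finset.Ici (0 : Fin 2) = {0, 1} := by decide
  have i1 : Finset.Ici (1 : Fin 2) = {1} := by decide
  rw [hdd, Fin.sum_univ_three, Fin.sum_univ_two] at key
  simp only [e0, e1, e2, f0, f1, f2] at key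
  have g1 : ∀ x, Fin.removeNth (1 : Fin 2) (Fin.removeNth (1 : Fin 3)
      (fun i => (![X, Y, Z] : Fin 3 → V → V) i x)) = ![X x] := by
    intro x; ext j : 1; fin_cases j; rfl
  have g2 : ∀ x, Fin.removeNth (1 : Fin 2) (Fin.removeNth (0 : Fin 3)
      (fun i => (![X, Y, Z] : Fin 3 → V → V) i x)) = ![Y x] := by
    intro x; ext j : 1; fin_cases j; rfl
  have g3 : ∀ x, Fin.removeNth (0 : Fin 2) (Fin.removeNth (0 : Fin 3)
      (fun i => (![X, Y, Z] : Fin 3 → V → V) i x)) = ![Z x] := by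
    intro x; ext j : 1; fin_cases j; rfl
  have key' : (0 : ℝ) = -(dAlt φ q ![VectorField.lieBracket ℝ Y Z q, X q])
      + (dAlt φ q ![VectorField.lieBracket ℝ X Z q, Y q]
      - dAlt φ q ![VectorField.lieBracket ℝ X Y q, Z q]) := by
    simp only [← g1, ← g2, ← g3]
    simp [i0, i1, -Nat.succ_eq_add_one] at key ⊢
    linarith
  -- The invariant formula produces [X, Z], the cyclic form [Z, X].
  have hsw : dEval φ q (VectorField.lieBracket ℝ Z X q) (Y q)
      = - dEval φ q (VectorField.lieBracket ℝ X Z q) (Y q) := by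
    rw [VectorField.lieBracket_swap, dEval_bil, dEval_bil, map_neg, LinearMap.neg_apply]
  rw [hsw]
  simp only [dEval]
  linarith

/-! ### Coframes -/

/-- A family of seven smooth covector fields on `U` without common kernel. -/
structure Frame (U : Set V) (η : Fin 7 → V → CoV) : Prop where
  smooth : ∀ k, ContDiffOn ℝ ∞ (η k) U
  ker : ∀ q ∈ U, ∀ v, (∀ k, η k q v = 0) → v = 0

/-- Smooth vector fields dual to a coframe. -/
structure DualFrame (U : Set V) (η : Fin 7 → V → CoV) (E : Fin 7 → V → V) : Prop where
  smooth : ∀ k, ContDiffOn ℝ ∞ (E k) U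
  dual : ∀ q ∈ U, ∀ i j, η i q (E j q) = if i = j then 1 else 0

variable {U : Set V} {η : Fin 7 → V → CoV} {E : Fin 7 → V → V}

theorem contDiffOn_clm_pi (h : ∀ k, ContDiffOn ℝ ∞ (η k) U) :
    ContDiffOn ℝ ∞ (fun q => (ContinuousLinearMap.pi fun k => η k q : V →L[ℝ] V)) U := by
  have : (fun q => (ContinuousLinearMap.pi fun k => η k q : V →L[ℝ] V)) =
      fun q => ∑ k, (ContinuousLinearMap.smulRightL ℝ V V (η k q)) (Pi.single k 1) := by
    ext q v j
    simp [Pi.single_apply]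
  rw [this]
  refine ContDiffOn.sum fun k _ => ?_
  exact ((ContinuousLinearMap.smulRightL ℝ V V).contDiff.comp_contDiffOn (h k)).clm_apply
    contDiffOn_const

theorem exists_equiv_of_ker {q : V} (h : ∀ v, (∀ k, η k q v = 0) → v = 0) :
    ∃ e : V ≃L[ℝ] V, (e : V →L[ℝ] V) = ContinuousLinearMap.pi fun k => η k q := by
  have hinj : Function.Injective (ContinuousLinearMap.pi fun k => η k q : V →L[ℝ] V) := by
    rw [injective_iff_map_eq_zero]
    exact fun v hv => h v fun k => congrFun hv k
  refine ⟨(LinearEquiv.ofInjectiveEndo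
    ((ContinuousLinearMap.pi fun k => η k q : V →L[ℝ] V) : V →ₗ[ℝ] V)
    hinj).toContinuousLinearEquiv, ?_⟩
  ext v
  rfl

/-- Invertible operators form an open set, so independence at `p₀` persists nearby. -/
theorem exists_frame_of_ker (hU : IsOpen U) (h : ∀ k, ContDiffOn ℝ ∞ (η k) U) {p₀ : V}
    (hp₀ : p₀ ∈ U) (h0 : ∀ v, (∀ k, η k p₀ v = 0) → v = 0) :
    ∃ U' ⊆ U, IsOpen U' ∧ p₀ ∈ U' ∧ Frame U' η := by
  obtain ⟨e, he⟩ := exists_equiv_of_ker h0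
  have hc := (contDiffOn_clm_pi h).continuousOn.continuousAt (hU.mem_nhds hp₀)
  have hev := hc (he ▸ e.nhds)
  obtain ⟨U', hsub, hU', hp⟩ := mem_nhds_iff.1 (Filter.inter_mem hev (hU.mem_nhds hp₀))
  refine ⟨U', fun q hq => (hsub hq).2, hU', hp, fun k => (h k).mono fun q hq => (hsub hq).2,
    fun q hq v hv => ?_⟩
  obtain ⟨e', he'⟩ := (hsub hq).1
  have h1 : e' v = 0 := by
    have h2 := congrArg (fun l : V →L[ℝ] V => l v) he'
    exact h2.trans (funext hv)
  exact (map_eq_zero_iff e' e'.injective).1 h1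

/-- The dual fields are the columns of the inverse matrix, and operator inversion is smooth. -/
theorem Frame.exists_dual (h : Frame U η) : ∃ E, DualFrame U η E := by
  let L : V → (V →L[ℝ] V) := fun q => ContinuousLinearMap.pi fun k => η k q
  have hL : ContDiffOn ℝ ∞ L U := contDiffOn_clm_pi h.smooth
  have hinv : ∀ q ∈ U, ∃ e : V ≃L[ℝ] V, (e : V →L[ℝ] V) = L q := fun q hq =>
    exists_equiv_of_ker (h.ker q hq)
  refine ⟨fun j q => (L q).inverse (Pi.single j 1), fun j q hq => ?_, fun q hq i j => ?_⟩
  · obtain ⟨e, he⟩ := hinv q hq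
    have h1 : ContDiffAt ℝ ∞ ContinuousLinearMap.inverse (L q) := he ▸ contDiffAt_map_inverse e
    exact (h1.comp_contDiffWithinAt q (hL q hq)).clm_apply contDiffWithinAt_const
  · obtain ⟨e, he⟩ := hinv q hq
    have h1 : L q ((L q).inverse (Pi.single j 1)) = Pi.single j 1 := by
      rw [← he]
      simp
    have h2 := congrFun h1 i
    simp only [Pi.single_apply] at h2
    exact h2

theorem DualFrame.eq_sum (hE : DualFrame U η E) (h : Frame U η) {q : V} (hq : q ∈ U) (v : V) :
    v = ∑ j, η j q v • E j q := by
  rw [← sub_eq_zero]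
  refine h.ker q hq _ fun k => ?_
  simp [hE.dual q hq]

/-- The structure functions of a coframe. -/
def str (η : Fin 7 → V → CoV) (E : Fin 7 → V → V) (k a b : Fin 7) (q : V) : ℝ :=
  dEval (η k) q (E a q) (E b q)

theorem str_swap (k a b : Fin 7) (q : V) : str η E k b a q = -str η E k a b q := dEval_swap _ _ _ _

theorem DualFrame.contDiffOn_str (hE : DualFrame U η E) (hU : IsOpen U) (h : Frame U η)
    (k a b : Fin 7) : ContDiffOn ℝ ∞ (str η E k a b) U :=
  contDiffOn_dEval hU (h.smooth k) (hE.smooth a) (hE.smooth b)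

theorem DualFrame.dEval_eq_sum (hE : DualFrame U η E) (h : Frame U η) {q : V} (hq : q ∈ U)
    (k : Fin 7) (u v : V) :
    dEval (η k) q u v = ∑ a, ∑ b, η a q u * η b q v * str η E k a b q := by
  conv_lhs => rw [hE.eq_sum h hq u, hE.eq_sum h hq v, dEval_bil]
  simp only [map_sum, LinearMap.sum_apply, map_smul, LinearMap.smul_apply, smul_eq_mul,
    ← dEval_bil, str, Finset.mul_sum]
  rw [Finset.sum_comm]
  refine Finset.sum_congr rfl fun a _ => Finset.sum_congr rfl fun b _ => ?_
  ring

/-- Differentiating the constant pairings `η k (E j)` trades derivatives of the forms for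
derivatives of the fields, which turns the formula for dη into minus the bracket component. -/
theorem DualFrame.apply_lieBracket (hE : DualFrame U η E) (hU : IsOpen U) (h : Frame U η) {q : V}
    (hq : q ∈ U) (k a b : Fin 7) :
    η k q (VectorField.lieBracket ℝ (E a) (E b) q) = -str η E k a b q := by
  have hη := ((h.smooth k).contDiffAt (hU.mem_nhds hq)).differentiableAt (by simp)
  have hEd : ∀ j, DifferentiableAt ℝ (E j) q := fun j =>
    ((hE.smooth j).contDiffAt (hU.mem_nhds hq)).differentiableAt (by simp)
  have hc : ∀ j u, fderiv ℝ (η k) q u (E j q) + η k q (fderiv ℝ (E j) q u) = 0 := by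
    intro j u
    have h1 : (fun q => η k q (E j q)) =ᶠ[𝓝 q] fun _ => if k = j then 1 else 0 :=
      Filter.eventually_of_mem (hU.mem_nhds hq) fun x hx => hE.dual x hx k j
    have h2 := h1.fderiv_eq (𝕜 := ℝ)
    rw [fderiv_clm_apply hη (hEd j)] at h2
    have h3 := congrArg (fun l : V →L[ℝ] ℝ => l u) h2
    simp at h3
    linarith
  rw [str, dEval_eq hη, VectorField.lieBracket_eq]
  have h1 := hc b (E a q)
  have h2 := hc a (E b q)
  simp only [map_sub]
  linarith

/-- d²η_k = 0 on E_a, E_b, E_c in terms of structure functions. Only the three functions c₁, c₂, c₃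
of the form `η k` need be constant; all other structure functions may vary. -/
theorem DualFrame.jacobi (hE : DualFrame U η E) (hU : IsOpen U) (h : Frame U η)
    (k a b c : Fin 7) {c₁ c₂ c₃ : ℝ} (h₁ : ∀ q ∈ U, str η E k a b q = c₁)
    (h₂ : ∀ q ∈ U, str η E k b c q = c₂) (h₃ : ∀ q ∈ U, str η E k c a q = c₃) {q : V}
    (hq : q ∈ U) :
    ∑ m, (str η E m a b q * str η E k m c q + str η E m b c q * str η E k m a q
      + str η E m c a q * str η E k m b q) = 0 := by
  have key := dEval_lieBracket_cyclic hU (h.smooth k) (hE.smooth a) (hE.smooth b) (hE.smooth c)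
    h₁ h₂ h₃ hq
  have hx : ∀ a b c, dEval (η k) q (VectorField.lieBracket ℝ (E a) (E b) q) (E c q)
      = -∑ m, str η E m a b q * str η E k m c q := by
    intro a b c
    conv_lhs => rw [hE.eq_sum h hq (VectorField.lieBracket ℝ (E a) (E b) q), dEval_bil]
    simp only [map_sum, LinearMap.sum_apply, map_smul, LinearMap.smul_apply, smul_eq_mul,
      ← dEval_bil, hE.apply_lieBracket hU h hq, neg_mul, Finset.sum_neg_distrib]
    rfl
  rw [hx, hx, hx] at key
  simp only [Finset.sum_add_distrib]
  linarith

end HypPDE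
end

noncomputable section

namespace HypPDE

variable {U : Set V} {η : Fin 7 → V → CoV} {E : Fin 7 → V → V}

/-! ### Pfaffian systems spanned by members of a coframe -/

theorem forall_mem_span_apply_eq_zero {s : Set CoV} {v : V} :
    (∀ α ∈ Submodule.span ℝ s, α v = 0) ↔ ∀ α ∈ s, α v = 0 := by
  refine ⟨fun h α hα => h α (Submodule.subset_span hα), fun h α hα => ?_⟩
  induction hα using Submodule.span_induction with
  | mem α hα => exact h α hα
  | zero => rfl
  | add α β _ _ hα hβ => rw [add_apply, hα, hβ, add_zero]
  | smul c α _ hα => rw [smul_apply, hα, smul_zero]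

theorem span_eq_of_forall_apply {A : Submodule ℝ CoV} {s : Set CoV}
    (h : ∀ v : V, (∀ α ∈ A, α v = 0) ↔ ∀ α ∈ s, α v = 0) : A = Submodule.span ℝ s := by
  refine le_antisymm (fun α hα => ?_) (fun α hα => ?_)
  · exact mem_of_forall_apply_eq_zero fun v hv =>
      (h v).2 (forall_mem_span_apply_eq_zero.1 hv) α hα
  · exact mem_of_forall_apply_eq_zero fun v hv =>
      forall_mem_span_apply_eq_zero.2 ((h v).1 hv) α hα

/-- The span at `q` of the members of a coframe with indices in `J`. -/
def spanOf (η : Fin 7 → V → CoV) (J : Finset (Fin 7)) : PSystem := fun q =>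
  Submodule.span ℝ ((fun k => η k q) '' (J : Set (Fin 7)))

theorem forall_mem_spanOf {J : Finset (Fin 7)} {q v : V} :
    (∀ α ∈ spanOf η J q, α v = 0) ↔ ∀ j ∈ J, η j q v = 0 := by
  rw [spanOf, forall_mem_span_apply_eq_zero]
  simp

theorem mem_spanOf {J : Finset (Fin 7)} {q : V} {j : Fin 7} (hj : j ∈ J) :
    η j q ∈ spanOf η J q :=
  Submodule.subset_span ⟨j, hj, rfl⟩

theorem DualFrame.eq_sum_of_mem (hE : DualFrame U η E) {J : Finset (Fin 7)} {q : V} (hq : q ∈ U)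
    {α : CoV} (hα : α ∈ spanOf η J q) : α = ∑ j ∈ J, α (E j q) • η j q := by
  rw [spanOf] at hα
  induction hα using Submodule.span_induction with
  | mem α hα =>
    obtain ⟨i, hi, rfl⟩ := hα
    have hi' : i ∈ J := hi
    simp [hE.dual q hq, hi']
  | zero => simp
  | add α β _ _ hα hβ =>
    conv_lhs => rw [hα, hβ]
    simp [add_smul, Finset.sum_add_distrib]
  | smul c α _ hα =>
    conv_lhs => rw [hα]
    simp [Finset.smul_sum, smul_smul]

/-- A section is a combination of the spanning forms with smooth coefficients φ(E_j); the formula is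
the Leibniz rule for this combination. -/
theorem IsSectionNear.dEval_eq_sum (hU : IsOpen U) (h : Frame U η) (hE : DualFrame U η E)
    {J : Finset (Fin 7)} {M : PSystem} (hM : ∀ q ∈ U, M q = spanOf η J q) {p : V} (hp : p ∈ U)
    {φ : V → CoV} (hφ : IsSectionNear M p φ) (u v : V) :
    dEval φ p u v = ∑ j ∈ J, (fderiv ℝ (fun q => φ q (E j q)) p u * η j p v
      - fderiv ℝ (fun q => φ q (E j q)) p v * η j p u + φ p (E j p) * dEval (η j) p u v) := by
  have h1 : φ =ᶠ[𝓝 p] fun q => ∑ j ∈ J, φ q (E j q) • η j q := by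
    filter_upwards [hφ, hU.mem_nhds hp] with q hq hqU
    exact hE.eq_sum_of_mem hqU (hM q hqU ▸ hq.2)
  rw [dEval_congr h1]
  refine dEval_sum_smul J (f := fun j q => φ q (E j q)) (fun j _ => ?_) (fun j _ => ?_) u v
  · exact (hφ.self_of_nhds.1.differentiableAt (by simp)).clm_apply
      (((hE.smooth j).contDiffAt (hU.mem_nhds hp)).differentiableAt (by simp))
  · exact ((h.smooth j).contDiffAt (hU.mem_nhds hp)).differentiableAt (by simp)

theorem isSectionNear_coframe (hU : IsOpen U) (h : Frame U η) {J : Finset (Fin 7)} {M : PSystem}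
    (hM : ∀ q ∈ U, M q = spanOf η J q) {p : V} (hp : p ∈ U) {j : Fin 7} (hj : j ∈ J) :
    IsSectionNear M p (η j) := by
  filter_upwards [hU.mem_nhds hp] with q hq
  exact ⟨(h.smooth j).contDiffAt (hU.mem_nhds hq), hM q hq ▸ mem_spanOf hj⟩

/-- Testing on the frame of `M` suffices: for a general section the terms df∧η_j vanish on a pair of
vectors annihilated by `I ⊇ M`. -/
theorem mem_charSpace_iff (hU : IsOpen U) (h : Frame U η) {J : Finset (Fin 7)} {I M : PSystem}
    (hM : ∀ q ∈ U, M q = spanOf η J q) {p : V} (hp : p ∈ U) (hle : M p ≤ I p) {v : V} :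
    v ∈ charSpace I M p ↔ (∀ α ∈ I p, α v = 0) ∧
      ∀ j ∈ J, ∀ w, (∀ α ∈ I p, α w = 0) → dEval (η j) p v w = 0 := by
  obtain ⟨E, hE⟩ := h.exists_dual
  refine and_congr_right fun hv => ⟨fun hφ j hj w hw => ?_, fun hJ φ hφ => ?_⟩
  · have := hφ (η j) (isSectionNear_coframe hU h hM hp hj)
    have := hw _ this
    rwa [interiorProd_apply] at this
  · refine mem_of_forall_apply_eq_zero fun w hw => ?_
    rw [interiorProd_apply]
    have hz : ∀ j ∈ J, ∀ u, (∀ α ∈ I p, α u = 0) → η j p u = 0 := fun j hj u hu =>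
      hu _ (hle (hM p hp ▸ mem_spanOf hj))
    refine (hφ.dEval_eq_sum hU h hE hM hp v w).trans (Finset.sum_eq_zero fun j hj => ?_)
    rw [hz j hj v hv, hz j hj w hw, hJ j hj w hw]
    simp

theorem charSystem_eq_spanOf {I M : PSystem} {p : V} {K : Finset (Fin 7)}
    (hK : ∀ v, v ∈ charSpace I M p ↔ ∀ k ∈ K, η k p v = 0) :
    charSystem I M p = spanOf η K p := by
  refine le_antisymm (fun α hα => ?_) (fun α hα v hv => ?_)
  · refine mem_of_forall_apply_eq_zero fun v hv => hα v ((hK v).2 (forall_mem_spanOf.1 hv))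
  · exact forall_mem_spanOf.2 ((hK v).1 hv) α hα

/-- Class 7 means that every covector annihilates the characteristic space, in particular all
coordinates do. -/
theorem charSpace_eq_bot_of_classAt {M : PSystem} {p : V} (h : classAt M p = 7) {v : V}
    (hv : v ∈ charSpace M M p) : v = 0 := by
  have h7 : Module.finrank ℝ CoV = 7 := by
    rw [← (LinearMap.toContinuousLinearMap : (V →ₗ[ℝ] ℝ) ≃ₗ[ℝ] CoV).finrank_eq]
    simp
  have hfin : FiniteDimensional ℝ CoV := Module.finite_of_finrank_pos (by omega)
  have htop : charSystem M M p = ⊤ := by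
    apply Submodule.eq_top_of_finrank_eq
    rw [h7]
    exact h
  ext i
  have : dx i ∈ charSystem M M p := htop ▸ Submodule.mem_top
  exact this v hv

/-- Membership of `J'` needs the congruence on all of `U`, because elements of the derived system
are values of sections. For the reverse inclusion, independence at the single point `p` of the
remaining differentials modulo the system is enough. -/
theorem derived_eq_spanOf (hU : IsOpen U) (h : Frame U η) {J J' : Finset (Fin 7)} {M : PSystem}
    (hM : ∀ q ∈ U, M q = spanOf η J q) (hJ : J' ⊆ J)
    (h1 : ∀ q ∈ U, ∀ j ∈ J', ∀ u v, (∀ i ∈ J, η i q u = 0) → (∀ i ∈ J, η i q v = 0) →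
      dEval (η j) q u v = 0)
    {p : V} (hp : p ∈ U)
    (h2 : ∀ c : Fin 7 → ℝ, (∀ u v, (∀ i ∈ J, η i p u = 0) → (∀ i ∈ J, η i p v = 0) →
      ∑ j ∈ J, c j * dEval (η j) p u v = 0) → ∀ j ∈ J, j ∉ J' → c j = 0) :
    derived M p = spanOf η J' p := by
  obtain ⟨E, hE⟩ := h.exists_dual
  refine le_antisymm ?_ ?_
  · rintro α ⟨φ, hφ, hd, rfl⟩
    have hd' := congrMod_d_zero_iff.1 hd.self_of_nhds
    have hc := h2 (fun j => φ p (E j p)) fun u v hu hv => by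
      have hz := hd' u v (hM p hp ▸ forall_mem_spanOf.2 hu) (hM p hp ▸ forall_mem_spanOf.2 hv)
      rw [hφ.dEval_eq_sum hU h hE hM hp] at hz
      rw [← hz]
      refine Finset.sum_congr rfl fun j hj => ?_
      rw [hu j hj, hv j hj]
      ring
    have hmem : φ p ∈ spanOf η J p := hM p hp ▸ hφ.self_of_nhds.2
    rw [hE.eq_sum_of_mem hp hmem]
    refine sum_mem fun j hj => ?_
    by_cases hj' : j ∈ J'
    · exact Submodule.smul_mem _ _ (mem_spanOf hj')
    · rw [hc j hj hj', zero_smul]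
      exact zero_mem _
  · refine Submodule.span_le.2 ?_
    rintro _ ⟨j, hj, rfl⟩
    refine ⟨η j, isSectionNear_coframe hU h hM hp (hJ hj), ?_, rfl⟩
    filter_upwards [hU.mem_nhds hp] with q hq
    rw [congrMod_d_zero_iff]
    intro u v hu hv
    rw [hM q hq] at hu hv
    exact h1 q hq j hj u v (forall_mem_spanOf.1 hu) (forall_mem_spanOf.1 hv)

end HypPDE
end

noncomputable section

namespace HypPDE

variable {U : Set V} {η : Fin 7 → V → CoV} {E : Fin 7 → V → V}

/-! ### Coframes adapted to the pair of isotropic systems -/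

/-- The structure equations of a hyperbolic coframe, the last two modulo `η 0, η 1, η 2` only. -/
structure WeakStr (U : Set V) (η : Fin 7 → V → CoV) : Prop where
  d0 : ∀ q ∈ U, ∀ u v, η 0 q u = 0 → η 0 q v = 0 →
    dEval (η 0) q u v = wed (η 2 q) (η 5 q) u v + wed (η 1 q) (η 3 q) u v
  d1 : ∀ q ∈ U, ∀ u v, η 0 q u = 0 → η 1 q u = 0 → η 2 q u = 0 →
    η 0 q v = 0 → η 1 q v = 0 → η 2 q v = 0 → dEval (η 1) q u v = wed (η 3 q) (η 4 q) u v
  d2 : ∀ q ∈ U, ∀ u v, η 0 q u = 0 → η 1 q u = 0 → η 2 q u = 0 →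
    η 0 q v = 0 → η 1 q v = 0 → η 2 q v = 0 → dEval (η 2) q u v = wed (η 5 q) (η 6 q) u v

/-- The structure equations of a generic hyperbolic coframe, with coefficients `A, k, B, l`. -/
structure StrEq (U : Set V) (η : Fin 7 → V → CoV) (A k B l : V → ℝ) : Prop where
  d0 : ∀ q ∈ U, ∀ u v, η 0 q u = 0 → η 0 q v = 0 →
    dEval (η 0) q u v = wed (η 2 q) (η 5 q) u v + wed (η 1 q) (η 3 q) u v
  d1 : ∀ q ∈ U, ∀ u v, η 0 q u = 0 → η 1 q u = 0 → η 0 q v = 0 → η 1 q v = 0 →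
    dEval (η 1) q u v = A q * wed (η 3 q) (η 4 q) u v + k q * wed (η 2 q) (η 6 q) u v
  d2 : ∀ q ∈ U, ∀ u v, η 0 q u = 0 → η 2 q u = 0 → η 0 q v = 0 → η 2 q v = 0 →
    dEval (η 2) q u v = B q * wed (η 5 q) (η 6 q) u v + l q * wed (η 1 q) (η 4 q) u v

@[simp] theorem str_self (k a : Fin 7) (q : V) : str η E k a a q = 0 := dEval_self _ _ _

theorem WeakStr.str_zero (hw : WeakStr U η) (hE : DualFrame U η E) {q : V} (hq : q ∈ U)
    (a b : Fin 7) (ha : a ≠ 0) (hb : b ≠ 0) :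
    str η E 0 a b q = (if 2 = a then 1 else 0) * (if 5 = b then 1 else 0)
      - (if 2 = b then 1 else 0) * (if 5 = a then 1 else 0)
      + ((if 1 = a then 1 else 0) * (if 3 = b then 1 else 0)
      - (if 1 = b then 1 else 0) * (if 3 = a then 1 else 0)) := by
  rw [str, hw.d0 q hq]
  · simp only [wed, hE.dual q hq]
  · rw [hE.dual q hq, if_neg ha.symm]
  · rw [hE.dual q hq, if_neg hb.symm]

theorem WeakStr.str_one (hw : WeakStr U η) (hE : DualFrame U η E) {q : V} (hq : q ∈ U)
    (a b : Fin 7) (ha : 2 < a) (hb : 2 < b) :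
    str η E 1 a b q = (if 3 = a then 1 else 0) * (if 4 = b then 1 else 0)
      - (if 3 = b then 1 else 0) * (if 4 = a then 1 else 0) := by
  have h : ∀ i c : Fin 7, i ≤ 2 → 2 < c → η i q (E c q) = 0 := by
    intro i c hi hc
    rw [hE.dual q hq, if_neg (ne_of_lt (lt_of_le_of_lt hi hc))]
  rw [str, hw.d1 q hq _ _ (h 0 a (by decide) ha) (h 1 a (by decide) ha) (h 2 a (by decide) ha)
    (h 0 b (by decide) hb) (h 1 b (by decide) hb) (h 2 b (by decide) hb)]
  simp only [wed, hE.dual q hq]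

theorem WeakStr.str_two (hw : WeakStr U η) (hE : DualFrame U η E) {q : V} (hq : q ∈ U)
    (a b : Fin 7) (ha : 2 < a) (hb : 2 < b) :
    str η E 2 a b q = (if 5 = a then 1 else 0) * (if 6 = b then 1 else 0)
      - (if 5 = b then 1 else 0) * (if 6 = a then 1 else 0) := by
  have h : ∀ i c : Fin 7, i ≤ 2 → 2 < c → η i q (E c q) = 0 := by
    intro i c hi hc
    rw [hE.dual q hq, if_neg (ne_of_lt (lt_of_le_of_lt hi hc))]
  rw [str, hw.d2 q hq _ _ (h 0 a (by decide) ha) (h 1 a (by decide) ha) (h 2 a (by decide) ha)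
    (h 0 b (by decide) hb) (h 1 b (by decide) hb) (h 2 b (by decide) hb)]
  simp only [wed, hE.dual q hq]

/-- The relation given by d² = 0 between the ω²∧ω⁷ coefficient of dω³ and the ω³∧ω⁵ coefficient of
dω². Both equal minus the ω⁴∧ω⁵ coefficient of dω⁶. -/
theorem WeakStr.str_eq (hU : IsOpen U) (h : Frame U η) (hw : WeakStr U η) (hE : DualFrame U η E)
    {q : V} (hq : q ∈ U) : str η E 2 1 6 q = str η E 1 2 4 q := by
  -- With c^k_{ab} for `str η E k a b`, this gives c¹₂₄ = −c⁵₃₄.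
  have J1 := hE.jacobi hU h 0 2 4 3 (c₁ := 0) (c₂ := 0) (c₃ := 0)
    (fun q hq => by simp [hw.str_zero hE hq]) (fun q hq => by simp [hw.str_zero hE hq])
    (fun q hq => by simp [hw.str_zero hE hq]) hq
  -- This gives c²₁₆ = −c⁵₃₄.
  have J2 := hE.jacobi hU h 2 3 4 6 (c₁ := 0) (c₂ := 0) (c₃ := 0)
    (fun q hq => by rw [hw.str_two hE hq _ _ (by decide) (by decide)]; simp)
    (fun q hq => by rw [hw.str_two hE hq _ _ (by decide) (by decide)]; simp)
    (fun q hq => by rw [hw.str_two hE hq _ _ (by decide) (by decide)]; simp) hq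
  have e1 := str_swap (η := η) (E := E) 5 3 4 q
  rw [Fin.sum_univ_seven] at J1 J2
  simp [hw.str_zero hE hq] at J1
  have hlt : ∀ a : Fin 7, a = 3 ∨ a = 4 ∨ a = 5 ∨ a = 6 → 2 < a := by decide
  simp [hw.str_zero hE hq, hw.str_one hE hq _ _ (hlt _ _) (hlt _ _),
    hw.str_two hE hq _ _ (hlt _ _) (hlt _ _)] at J2
  linarith

/-- The hypothesis that the systems spanned by `η 0, η 1` and by `η 0, η 2` have no Cauchy
characteristics. -/
structure NoCauchy (U : Set V) (η : Fin 7 → V → CoV) : Prop where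
  fst : ∀ q ∈ U, ∀ v, v ∈ charSpace (spanOf η {0, 1}) (spanOf η {0, 1}) q → v = 0
  snd : ∀ q ∈ U, ∀ v, v ∈ charSpace (spanOf η {0, 2}) (spanOf η {0, 2}) q → v = 0

theorem WeakStr.dEval_one (h : Frame U η) (hw : WeakStr U η) (hE : DualFrame U η E)
    {q : V} (hq : q ∈ U) {u v : V} (hu0 : η 0 q u = 0) (hu1 : η 1 q u = 0) (hv0 : η 0 q v = 0)
    (hv1 : η 1 q v = 0) :
    dEval (η 1) q u v = wed (η 3 q) (η 4 q) u v + str η E 1 2 3 q * wed (η 2 q) (η 3 q) u v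
      + str η E 1 2 4 q * wed (η 2 q) (η 4 q) u v + str η E 1 2 5 q * wed (η 2 q) (η 5 q) u v
      + str η E 1 2 6 q * wed (η 2 q) (η 6 q) u v := by
  rw [hE.dEval_eq_sum h hq]
  simp only [Fin.sum_univ_seven, hu0, hu1, hv0, hv1, zero_mul, mul_zero, zero_add, add_zero]
  rw [str_swap 1 2 3, str_swap 1 2 4, str_swap 1 2 5, str_swap 1 2 6]
  have hlt : ∀ a : Fin 7, a = 3 ∨ a = 4 ∨ a = 5 ∨ a = 6 → 2 < a := by decide
  simp [hw.str_one hE hq _ _ (hlt _ _) (hlt _ _), wed]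
  ring

theorem WeakStr.dEval_two (h : Frame U η) (hw : WeakStr U η) (hE : DualFrame U η E)
    {q : V} (hq : q ∈ U) {u v : V} (hu0 : η 0 q u = 0) (hu1 : η 2 q u = 0) (hv0 : η 0 q v = 0)
    (hv1 : η 2 q v = 0) :
    dEval (η 2) q u v = wed (η 5 q) (η 6 q) u v + str η E 2 1 3 q * wed (η 1 q) (η 3 q) u v
      + str η E 2 1 4 q * wed (η 1 q) (η 4 q) u v + str η E 2 1 5 q * wed (η 1 q) (η 5 q) u v
      + str η E 2 1 6 q * wed (η 1 q) (η 6 q) u v := by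
  rw [hE.dEval_eq_sum h hq]
  simp only [Fin.sum_univ_seven, hu0, hu1, hv0, hv1, zero_mul, mul_zero, zero_add, add_zero]
  rw [str_swap 2 1 3, str_swap 2 1 4, str_swap 2 1 5, str_swap 2 1 6]
  have hlt : ∀ a : Fin 7, a = 3 ∨ a = 4 ∨ a = 5 ∨ a = 6 → 2 < a := by decide
  simp [hw.str_two hE hq _ _ (hlt _ _) (hlt _ _), wed]
  ring

/-- If this coefficient vanished, neither dη₀ modulo η₀ nor dη₁ modulo η₀, η₁ would involve η₆, and
`E 6` would be a Cauchy characteristic of the first system. -/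
theorem WeakStr.str_one_ne_zero (hU : IsOpen U) (h : Frame U η) (hw : WeakStr U η)
    (hE : DualFrame U η E) (hc : NoCauchy U η) {q : V} (hq : q ∈ U) : str η E 1 2 6 q ≠ 0 := by
  intro h0
  have hz := hc.fst q hq (E 6 q) ((mem_charSpace_iff hU h (fun _ _ => rfl) hq le_rfl).2 ⟨?_, ?_⟩)
  · have := hE.dual q hq 6 6
    simp [hz] at this
  · rw [forall_mem_spanOf]
    simp [hE.dual q hq]
  · simp only [forall_mem_spanOf]
    simp only [Finset.mem_insert, Finset.mem_singleton, forall_eq_or_imp, forall_eq]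
    refine ⟨fun w hw' => ?_, fun w hw' => ?_⟩
    · rw [hw.d0 q hq _ _ (by simp [hE.dual q hq]) hw'.1]
      simp [wed, hE.dual q hq, hw'.2]
    · rw [hw.dEval_one h hE hq (by simp [hE.dual q hq]) (by simp [hE.dual q hq]) hw'.1 hw'.2]
      simp [wed, hE.dual q hq, h0]

/-- The same argument for the second system, with `E 4` as the would-be Cauchy characteristic. -/
theorem WeakStr.str_two_ne_zero (hU : IsOpen U) (h : Frame U η) (hw : WeakStr U η)
    (hE : DualFrame U η E) (hc : NoCauchy U η) {q : V} (hq : q ∈ U) : str η E 2 1 4 q ≠ 0 := by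
  intro h0
  have hz := hc.snd q hq (E 4 q) ((mem_charSpace_iff hU h (fun _ _ => rfl) hq le_rfl).2 ⟨?_, ?_⟩)
  · have := hE.dual q hq 4 4
    simp [hz] at this
  · rw [forall_mem_spanOf]
    simp [hE.dual q hq]
  · simp only [forall_mem_spanOf]
    simp only [Finset.mem_insert, Finset.mem_singleton, forall_eq_or_imp, forall_eq]
    refine ⟨fun w hw' => ?_, fun w hw' => ?_⟩
    · rw [hw.d0 q hq _ _ (by simp [hE.dual q hq]) hw'.1]
      simp [wed, hE.dual q hq, hw'.2]
    · rw [hw.dEval_two h hE hq (by simp [hE.dual q hq]) (by simp [hE.dual q hq]) hw'.1 hw'.2]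
      simp [wed, hE.dual q hq, h0]

/-- Write aⱼ = `str 1 2 j` and bⱼ = `str 2 1 j`. Modulo η₀, η₁ one has dη₁ ≡ (η₃ + a₄η₂)∧(η₄ − a₃η₂)
+ η₂∧(a₅η₅ + a₆η₆), and dη₂ factors in the same way with shift b₆ in η₅. The two shifts alter η₂∧η₅
+ η₁∧η₃ by (a₄ − b₆) η₁∧η₂, which vanishes because a₄ = b₆. -/
theorem WeakStr.exists_strEq (hU : IsOpen U) (h : Frame U η) (hw : WeakStr U η)
    (hc : NoCauchy U η) : ∃ (η' : Fin 7 → V → CoV) (A B : V → ℝ), Frame U η' ∧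
      η' 0 = η 0 ∧ η' 1 = η 1 ∧ η' 2 = η 2 ∧ ContDiffOn ℝ ∞ A U ∧ ContDiffOn ℝ ∞ B U ∧
      (∀ q ∈ U, A q ≠ 0) ∧ (∀ q ∈ U, B q ≠ 0) ∧ StrEq U η' A 1 B 1 := by
  obtain ⟨E, hE⟩ := h.exists_dual
  have ha := hE.contDiffOn_str hU h
  have h1 := fun q (hq : q ∈ U) => hw.str_one_ne_zero hU h hE hc hq
  have h2 := fun q (hq : q ∈ U) => hw.str_two_ne_zero hU h hE hc hq
  refine ⟨![η 0, η 1, η 2,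
    fun q => η 3 q + str η E 1 2 4 q • η 2 q,
    -- Modulo η₂ this is b₃η₃ + b₄η₄, the factor of η₁ in dη₂; b₄ ≠ 0 keeps it independent of the
    -- new η₃. The last form plays the same role for dη₁.
    fun q => str η E 2 1 3 q • (η 3 q + str η E 1 2 4 q • η 2 q)
      + str η E 2 1 4 q • (η 4 q - str η E 1 2 3 q • η 2 q),
    fun q => η 5 q + str η E 1 2 4 q • η 1 q,
    fun q => str η E 1 2 5 q • (η 5 q + str η E 1 2 4 q • η 1 q)
      + str η E 1 2 6 q • (η 6 q - str η E 2 1 5 q • η 1 q)],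
    fun q => (str η E 2 1 4 q)⁻¹, fun q => (str η E 1 2 6 q)⁻¹, ⟨?_, ?_⟩, rfl, rfl, rfl,
    (ha 2 1 4).inv h2, (ha 1 2 6).inv h1, fun q hq => inv_ne_zero (h2 q hq),
    fun q hq => inv_ne_zero (h1 q hq), ⟨?_, ?_, ?_⟩⟩
  · have hs := h.smooth
    intro k
    fin_cases k
    · exact hs 0
    · exact hs 1
    · exact hs 2
    · exact (hs 3).add ((ha 1 2 4).smul (hs 2))
    · exact ((ha 2 1 3).smul ((hs 3).add ((ha 1 2 4).smul (hs 2)))).add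
        ((ha 2 1 4).smul ((hs 4).sub ((ha 1 2 3).smul (hs 2))))
    · exact (hs 5).add ((ha 1 2 4).smul (hs 1))
    · exact ((ha 1 2 5).smul ((hs 5).add ((ha 1 2 4).smul (hs 1)))).add
        ((ha 1 2 6).smul ((hs 6).sub ((ha 2 1 5).smul (hs 1))))
  · intro q hq v hv
    have e0 : η 0 q v = 0 := hv 0
    have e1 : η 1 q v = 0 := hv 1
    have e2 : η 2 q v = 0 := hv 2
    have e3 : η 3 q v = 0 := by simpa [e2] using hv 3
    have e4 : η 4 q v = 0 := by simpa [e2, e3, h2 q hq] using hv 4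
    have e5 : η 5 q v = 0 := by simpa [e1] using hv 5
    have e6 : η 6 q v = 0 := by simpa [e1, e5, h1 q hq] using hv 6
    refine h.ker q hq v fun k => ?_
    fin_cases k <;> assumption
  · intro q hq u v hu hv
    refine (hw.d0 q hq u v hu hv).trans ?_
    simp [wed]
    ring
  · intro q hq u v hu0 hu1 hv0 hv1
    refine (hw.dEval_one h hE hq hu0 hu1 hv0 hv1).trans ?_
    have e1 : η 1 q u = 0 := hu1
    have e2 : η 1 q v = 0 := hv1
    have h2' := h2 q hq
    simp [wed, e1, e2]
    field_simp
    ring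
  · intro q hq u v hu0 hu1 hv0 hv1
    refine (hw.dEval_two h hE hq hu0 hu1 hv0 hv1).trans ?_
    have e1 : η 2 q u = 0 := hu1
    have e2 : η 2 q v = 0 := hv1
    have h1' := h1 q hq
    rw [hw.str_eq hU h hE hq]
    simp [wed, e1, e2]
    field_simp
    ring

end HypPDE
end

noncomputable section

namespace HypPDE

variable {U : Set V} {η : Fin 7 → V → CoV} {E : Fin 7 → V → V} {A k B l : V → ℝ}

/-! ### Normalization of the coefficients -/

/-- A diagonal rescaling by g with g⁴B = εA. The weights are determined by keeping η₁ fixed, scaling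
η₂ by g, and requiring every displayed term to have constant coefficient. -/
theorem StrEq.exists_normalized (hU : IsOpen U) (h : Frame U η) (hs : StrEq U η A 1 B 1)
    (hA : ContDiffOn ℝ ∞ A U) (hB : ContDiffOn ℝ ∞ B U) (hA0 : ∀ q ∈ U, A q ≠ 0)
    (hB0 : ∀ q ∈ U, B q ≠ 0) {p₀ : V} (hp₀ : p₀ ∈ U) :
    ∃ U' ⊆ U, IsOpen U' ∧ p₀ ∈ U' ∧ ∃ (η' : Fin 7 → V → CoV) (ε : ℝ) (f g : V → ℝ),
      Frame U' η' ∧ (ε = 1 ∨ ε = -1) ∧ (∀ q ∈ U', f q ≠ 0 ∧ g q ≠ 0 ∧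
        η' 0 q = f q • η 0 q ∧ η' 1 q = η 1 q ∧ η' 2 q = g q • η 2 q) ∧
      StrEq U' η' 1 1 1 (fun _ => ε) := by
  -- ε is the sign of A/B at `p₀`; it stays valid on the open set where εA/B > 0.
  obtain ⟨ε, hε, hε0⟩ : ∃ ε : ℝ, (ε = 1 ∨ ε = -1) ∧ 0 < ε * (A p₀ * (B p₀)⁻¹) := by
    rcases lt_or_gt_of_ne (mul_ne_zero (hA0 p₀ hp₀) (inv_ne_zero (hB0 p₀ hp₀))) with h | h
    · exact ⟨-1, Or.inr rfl, by linarith⟩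
    · exact ⟨1, Or.inl rfl, by linarith⟩
  have hεε : ε * ε = 1 := by rcases hε with rfl | rfl <;> norm_num
  have hR : ContDiffOn ℝ ∞ (fun q => ε * (A q * (B q)⁻¹)) U :=
    contDiffOn_const.mul (hA.mul (hB.inv hB0))
  let U' : Set V := U ∩ (fun q => ε * (A q * (B q)⁻¹)) ⁻¹' Set.Ioi 0
  have hU' : IsOpen U' := hR.continuousOn.isOpen_inter_preimage hU isOpen_Ioi
  have hsub : U' ⊆ U := Set.inter_subset_left
  have hpos : ∀ q ∈ U', 0 < ε * (A q * (B q)⁻¹) := fun q hq => hq.2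
  -- The fourth root, smooth because its argument is positive on `U'`.
  let g : V → ℝ := fun q => √√(ε * (A q * (B q)⁻¹))
  have hg0 : ∀ q ∈ U', 0 < g q := fun q hq => Real.sqrt_pos.2 (Real.sqrt_pos.2 (hpos q hq))
  have hg4 : ∀ q ∈ U', g q ^ 4 * B q = ε * A q := by
    intro q hq
    have h1 : g q ^ 2 = √(ε * (A q * (B q)⁻¹)) := Real.sq_sqrt (Real.sqrt_nonneg _)
    have h2 : g q ^ 4 = ε * (A q * (B q)⁻¹) := by
      rw [show g q ^ 4 = (g q ^ 2) ^ 2 by ring, h1, Real.sq_sqrt (hpos q hq).le]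
    rw [h2]
    field_simp [hB0 q (hsub hq)]
  have hg : ContDiffOn ℝ ∞ g U' :=
    ((hR.mono hsub).sqrt fun q hq => (hpos q hq).ne').sqrt
      fun q hq => (Real.sqrt_pos.2 (hpos q hq)).ne'
  have hBs := hB.mono hsub
  have hη := fun j => (h.smooth j).mono hsub
  refine ⟨U', hsub, hU', ⟨hp₀, hε0⟩, ![fun q => (g q ^ 3 * B q) • η 0 q, η 1,
    fun q => g q • η 2 q, fun q => (g q ^ 3 * B q) • η 3 q, fun q => (ε * g q) • η 4 q,
    fun q => (g q ^ 2 * B q) • η 5 q, fun q => (g q)⁻¹ • η 6 q], ε,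
    fun q => g q ^ 3 * B q, g, ⟨fun j => ?_, fun q hq v hv => ?_⟩, hε, fun q hq => ?_,
    ⟨?_, ?_, ?_⟩⟩
  · fin_cases j
    · exact ((hg.pow 3).mul hBs).smul (hη 0)
    · exact hη 1
    · exact hg.smul (hη 2)
    · exact ((hg.pow 3).mul hBs).smul (hη 3)
    · exact (contDiffOn_const.mul hg).smul (hη 4)
    · exact ((hg.pow 2).mul hBs).smul (hη 5)
    · exact (hg.inv fun q hq => (hg0 q hq).ne').smul (hη 6)
  · have hgq := (hg0 q hq).ne'
    have hBq := hB0 q (hsub hq)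
    have hε' : ε ≠ 0 := left_ne_zero_of_mul_eq_one hεε
    have e0 : η 0 q v = 0 := by simpa [hgq, hBq] using hv 0
    have e1 : η 1 q v = 0 := hv 1
    have e2 : η 2 q v = 0 := by simpa [hgq] using hv 2
    have e3 : η 3 q v = 0 := by simpa [hgq, hBq] using hv 3
    have e4 : η 4 q v = 0 := by simpa [hgq, hε'] using hv 4
    have e5 : η 5 q v = 0 := by simpa [hgq, hBq] using hv 5
    have e6 : η 6 q v = 0 := by simpa [hgq] using hv 6
    refine h.ker q (hsub hq) v fun k => ?_
    fin_cases k <;> assumption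
  · exact ⟨mul_ne_zero (pow_ne_zero _ (hg0 q hq).ne') (hB0 q (hsub hq)), (hg0 q hq).ne',
      rfl, rfl, rfl⟩
  all_goals
    intro q hq u v
    have hgq := (hg0 q hq).ne'
    have hBq := hB0 q (hsub hq)
    have hd : ∀ {f : V → ℝ}, ContDiffOn ℝ ∞ f U' → DifferentiableAt ℝ f q := fun hf =>
      (hf.contDiffAt (hU'.mem_nhds hq)).differentiableAt (by simp)
    have hdη : ∀ j, DifferentiableAt ℝ (η j) q := fun j =>
      ((hη j).contDiffAt (hU'.mem_nhds hq)).differentiableAt (by simp)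
  · intro hu hv
    have e1 : η 0 q u = 0 := by simpa [hgq, hBq] using hu
    have e2 : η 0 q v = 0 := by simpa [hgq, hBq] using hv
    refine (dEval_smul (hd ((hg.pow 3).mul hBs)) (hdη 0) u v).trans ?_
    rw [hs.d0 q (hsub hq) u v e1 e2, e1, e2]
    simp [wed]
    ring
  · intro hu0 hu1 hv0 hv1
    have e1 : η 0 q u = 0 := by simpa [hgq, hBq] using hu0
    have e2 : η 0 q v = 0 := by simpa [hgq, hBq] using hv0
    refine (hs.d1 q (hsub hq) u v e1 hu1 e2 hv1).trans ?_
    have hA' : A q = ε * (g q ^ 4 * B q) := by rw [hg4 q hq, ← mul_assoc, hεε, one_mul]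
    rw [hA']
    simp [wed]
    field_simp
  · intro hu0 hu1 hv0 hv1
    have e1 : η 0 q u = 0 := by simpa [hgq, hBq] using hu0
    have e2 : η 0 q v = 0 := by simpa [hgq, hBq] using hv0
    have e3 : η 2 q u = 0 := by simpa [hgq] using hu1
    have e4 : η 2 q v = 0 := by simpa [hgq] using hv1
    refine (dEval_smul (hd hg) (hdη 2) u v).trans ?_
    rw [hs.d2 q (hsub hq) u v e1 e3 e2 e4, e3, e4]
    simp [wed]
    field_simp
    linear_combination (η 1 q v * η 4 q u - η 1 q u * η 4 q v) * hεε

/-! ### The derived flags of the characteristic systems -/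

/-- Exchanging the roles of the two isotropic systems. -/
def swp (η : Fin 7 → V → CoV) : Fin 7 → V → CoV := ![η 0, η 2, η 1, η 5, η 6, η 3, η 4]

theorem Frame.swp (h : Frame U η) : Frame U (swp η) := by
  refine ⟨fun j => ?_, fun q hq v hv => h.ker q hq v fun k => ?_⟩
  · have hs := h.smooth
    fin_cases j
    exacts [hs 0, hs 2, hs 1, hs 5, hs 6, hs 3, hs 4]
  · fin_cases k
    exacts [hv 0, hv 2, hv 1, hv 5, hv 6, hv 3, hv 4]

theorem StrEq.swp (hs : StrEq U η A k B l) : StrEq U (swp η) B l A k :=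
  ⟨fun q hq u v hu hv => (hs.d0 q hq u v hu hv).trans (add_comm _ _), hs.d2, hs.d1⟩

/-- On the common kernel of η₀, η₁, η₃, η₄, spanned by E₂, E₅, E₆, the forms dη₀ and dη₁ are η₂∧η₅
and k η₂∧η₆. They span the forms divisible by η₂, so only the η₅∧η₆ coefficients of dη₃ and dη₄ have
to vanish, and d² = 0 ensures that. -/
theorem StrEq.exists_combination (hU : IsOpen U) (h : Frame U η) {k l : ℝ} (hk : k ≠ 0)
    (hs : StrEq U η 1 (fun _ => k) 1 (fun _ => l)) :
    ∃ a : Fin 2 → Fin 2 → V → ℝ, (∀ i j, ContDiffOn ℝ ∞ (a i j) U) ∧ ∀ q ∈ U, ∀ u v,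
      (η 0 q u = 0 ∧ η 1 q u = 0 ∧ η 3 q u = 0 ∧ η 4 q u = 0) →
      (η 0 q v = 0 ∧ η 1 q v = 0 ∧ η 3 q v = 0 ∧ η 4 q v = 0) →
      dEval (η 3) q u v = a 0 0 q * dEval (η 0) q u v + a 0 1 q * dEval (η 1) q u v ∧
      dEval (η 4) q u v = a 1 0 q * dEval (η 0) q u v + a 1 1 q * dEval (η 1) q u v := by
  obtain ⟨E, hE⟩ := h.exists_dual
  have ha := hE.contDiffOn_str hU h
  have s0 : ∀ q ∈ U, ∀ a b : Fin 7, a ≠ 0 → b ≠ 0 → str η E 0 a b q =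
      (if 2 = a then 1 else 0) * (if 5 = b then 1 else 0)
      - (if 2 = b then 1 else 0) * (if 5 = a then 1 else 0)
      + ((if 1 = a then 1 else 0) * (if 3 = b then 1 else 0)
      - (if 1 = b then 1 else 0) * (if 3 = a then 1 else 0)) := by
    intro q hq a b ha hb
    rw [str, hs.d0 q hq]
    · simp only [wed, hE.dual q hq]
    · rw [hE.dual q hq, if_neg ha.symm]
    · rw [hE.dual q hq, if_neg hb.symm]
  have s1 : ∀ q ∈ U, ∀ a b : Fin 7, 1 < a → 1 < b → str η E 1 a b q =
      (if 3 = a then 1 else 0) * (if 4 = b then 1 else 0)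
      - (if 3 = b then 1 else 0) * (if 4 = a then 1 else 0)
      + k * ((if 2 = a then 1 else 0) * (if 6 = b then 1 else 0)
      - (if 2 = b then 1 else 0) * (if 6 = a then 1 else 0)) := by
    intro q hq a b ha hb
    have hz : ∀ i c : Fin 7, i ≤ 1 → 1 < c → η i q (E c q) = 0 := by
      intro i c hi hc
      rw [hE.dual q hq, if_neg (ne_of_lt (lt_of_le_of_lt hi hc))]
    rw [str, hs.d1 q hq _ _ (hz 0 a (by decide) ha) (hz 1 a (by decide) ha)
      (hz 0 b (by decide) hb) (hz 1 b (by decide) hb)]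
    simp only [wed, hE.dual q hq, Pi.one_apply, one_mul]
  have s2 : ∀ q ∈ U, ∀ a b : Fin 7, a ≠ 0 → a ≠ 2 → b ≠ 0 → b ≠ 2 → str η E 2 a b q =
      (if 5 = a then 1 else 0) * (if 6 = b then 1 else 0)
      - (if 5 = b then 1 else 0) * (if 6 = a then 1 else 0)
      + l * ((if 1 = a then 1 else 0) * (if 4 = b then 1 else 0)
      - (if 1 = b then 1 else 0) * (if 4 = a then 1 else 0)) := by
    intro q hq a b ha ha' hb hb'
    have hz : ∀ i c : Fin 7, c ≠ i → η i q (E c q) = 0 := by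
      intro i c hc
      rw [hE.dual q hq, if_neg hc.symm]
    rw [str, hs.d2 q hq _ _ (hz 0 a ha) (hz 2 a ha') (hz 0 b hb) (hz 2 b hb')]
    simp only [wed, hE.dual q hq, Pi.one_apply, one_mul]
  have hlt : ∀ a : Fin 7, a = 2 ∨ a = 3 ∨ a = 4 ∨ a = 5 ∨ a = 6 → 1 < a := by decide
  -- From d²η₀ = 0 on E₁, E₆, E₅, using that dη₂ has no η₁∧η₆ term.
  have t3 : ∀ q ∈ U, str η E 3 5 6 q = 0 := by
    intro q hq
    have J := hE.jacobi hU h 0 1 6 5 (c₁ := 0) (c₂ := 0) (c₃ := 0)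
      (fun q hq => by simp [s0 q hq]) (fun q hq => by simp [s0 q hq])
      (fun q hq => by simp [s0 q hq]) hq
    rw [Fin.sum_univ_seven] at J
    simp [s0 q hq, s2 q hq] at J
    rw [str_swap, J, neg_zero]
  -- From d²η₁ = 0 on E₃, E₅, E₆, using that dη₁ has no η₂∧η₃ term.
  have t4 : ∀ q ∈ U, str η E 4 5 6 q = 0 := by
    intro q hq
    have J := hE.jacobi hU h 1 3 5 6 (c₁ := 0) (c₂ := 0) (c₃ := 0)
      (fun q hq => by rw [s1 q hq _ _ (by decide) (by decide)]; simp)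
      (fun q hq => by rw [s1 q hq _ _ (by decide) (by decide)]; simp)
      (fun q hq => by rw [s1 q hq _ _ (by decide) (by decide)]; simp) hq
    rw [Fin.sum_univ_seven] at J
    simp [s0 q hq, s1 q hq _ _ (hlt _ _) (hlt _ _), s2 q hq] at J
    exact J
  refine ⟨![![str η E 3 2 5, fun q => str η E 3 2 6 q / k],
    ![str η E 4 2 5, fun q => str η E 4 2 6 q / k]], ?_, ?_⟩
  · intro i j
    fin_cases i <;> fin_cases j
    · exact ha 3 2 5
    · exact (ha 3 2 6).div_const k
    · exact ha 4 2 5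
    · exact (ha 4 2 6).div_const k
  · rintro q hq u v ⟨hu0, hu1, hu3, hu4⟩ ⟨hv0, hv1, hv3, hv4⟩
    rw [hs.d0 q hq u v hu0 hv0, hs.d1 q hq u v hu0 hu1 hv0 hv1]
    constructor
    · rw [hE.dEval_eq_sum h hq]
      simp only [Fin.sum_univ_seven, hu0, hu1, hu3, hu4, hv0, hv1, hv3, hv4, zero_mul, mul_zero,
        zero_add, add_zero, str_self]
      rw [str_swap 3 2 5, str_swap 3 2 6, str_swap 3 5 6, t3 q hq]
      simp [wed, hu1, hu3, hv1, hv3]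
      field_simp
      ring
    · rw [hE.dEval_eq_sum h hq]
      simp only [Fin.sum_univ_seven, hu0, hu1, hu3, hu4, hv0, hv1, hv3, hv4, zero_mul, mul_zero,
        zero_add, add_zero, str_self]
      rw [str_swap 4 2 5, str_swap 4 2 6, str_swap 4 5 6, t4 q hq]
      simp [wed, hu1, hu3, hv1, hv3]
      field_simp
      ring

/-- The forms `η 3` and `η 4` belong to the derived system of `η 0, η 1, η 3, η 4`. -/
def IsFlagAdapted (U : Set V) (η : Fin 7 → V → CoV) : Prop :=
  ∀ q ∈ U, ∀ u v, (η 0 q u = 0 ∧ η 1 q u = 0 ∧ η 3 q u = 0 ∧ η 4 q u = 0) →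
    (η 0 q v = 0 ∧ η 1 q v = 0 ∧ η 3 q v = 0 ∧ η 4 q v = 0) →
    dEval (η 3) q u v = 0 ∧ dEval (η 4) q u v = 0

theorem dEval_sub_combination {f g : V → ℝ} {φ α β : V → CoV} {p : V}
    (hf : DifferentiableAt ℝ f p) (hg : DifferentiableAt ℝ g p) (hφ : DifferentiableAt ℝ φ p)
    (hα : DifferentiableAt ℝ α p) (hβ : DifferentiableAt ℝ β p) {u v : V} (hαu : α p u = 0)
    (hαv : α p v = 0) (hβu : β p u = 0) (hβv : β p v = 0) :
    dEval (fun q => φ q - (f q • α q + g q • β q)) p u v =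
      dEval φ p u v - (f p * dEval α p u v + g p * dEval β p u v) := by
  have h1 : dEval (fun q => φ q + ((-f q) • α q + (-g q) • β q)) p u v =
      dEval φ p u v - (f p * dEval α p u v + g p * dEval β p u v) := by
    rw [dEval_add hφ ((hf.fun_neg.fun_smul hα).fun_add (hg.fun_neg.fun_smul hβ)),
      dEval_add (hf.fun_neg.fun_smul hα) (hg.fun_neg.fun_smul hβ), dEval_smul hf.fun_neg hα,
      dEval_smul hg.fun_neg hβ, hαu, hαv, hβu, hβv]
    ring
  rw [← h1]
  congr 1
  ext q v
  simp
  ring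

/-- Correct η₃, η₄ by multiples of η₀, η₁, and η₅, η₆ by multiples of η₀, η₂. The structure
equations survive: η₃ and η₄ enter either modulo η₀, η₁ or multiplied by η₁, and η₅ and η₆ behave
likewise with η₂. -/
theorem StrEq.exists_flagAdapted (hU : IsOpen U) (h : Frame U η) {k l : ℝ} (hk : k ≠ 0)
    (hl : l ≠ 0) (hs : StrEq U η 1 (fun _ => k) 1 (fun _ => l)) :
    ∃ η' : Fin 7 → V → CoV, Frame U η' ∧ η' 0 = η 0 ∧ η' 1 = η 1 ∧ η' 2 = η 2 ∧
      StrEq U η' 1 (fun _ => k) 1 (fun _ => l) ∧ IsFlagAdapted U η' ∧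
      IsFlagAdapted U (HypPDE.swp η') := by
  obtain ⟨a, ha, had⟩ := hs.exists_combination hU h hk
  obtain ⟨b, hb, hbd⟩ := hs.swp.exists_combination hU h.swp hl
  have hsm := h.smooth
  have hd : ∀ {f : V → ℝ}, ContDiffOn ℝ ∞ f U → ∀ {q}, q ∈ U → DifferentiableAt ℝ f q :=
    fun hf _ hq => (hf.contDiffAt (hU.mem_nhds hq)).differentiableAt (by simp)
  have hdη : ∀ j, ∀ {q}, q ∈ U → DifferentiableAt ℝ (η j) q := fun j _ hq =>
    ((hsm j).contDiffAt (hU.mem_nhds hq)).differentiableAt (by simp)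
  refine ⟨![η 0, η 1, η 2, fun q => η 3 q - (a 0 0 q • η 0 q + a 0 1 q • η 1 q),
    fun q => η 4 q - (a 1 0 q • η 0 q + a 1 1 q • η 1 q),
    fun q => η 5 q - (b 0 0 q • η 0 q + b 0 1 q • η 2 q),
    fun q => η 6 q - (b 1 0 q • η 0 q + b 1 1 q • η 2 q)],
    ⟨fun j => ?_, fun q hq v hv => ?_⟩, rfl, rfl, rfl, ⟨?_, ?_, ?_⟩, ?_, ?_⟩
  · fin_cases j
    · exact hsm 0
    · exact hsm 1
    · exact hsm 2
    · exact (hsm 3).sub (((ha 0 0).smul (hsm 0)).add ((ha 0 1).smul (hsm 1)))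
    · exact (hsm 4).sub (((ha 1 0).smul (hsm 0)).add ((ha 1 1).smul (hsm 1)))
    · exact (hsm 5).sub (((hb 0 0).smul (hsm 0)).add ((hb 0 1).smul (hsm 2)))
    · exact (hsm 6).sub (((hb 1 0).smul (hsm 0)).add ((hb 1 1).smul (hsm 2)))
  · have e0 : η 0 q v = 0 := hv 0
    have e1 : η 1 q v = 0 := hv 1
    have e2 : η 2 q v = 0 := hv 2
    have e3 : η 3 q v = 0 := by simpa [e0, e1] using hv 3
    have e4 : η 4 q v = 0 := by simpa [e0, e1] using hv 4
    have e5 : η 5 q v = 0 := by simpa [e0, e2] using hv 5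
    have e6 : η 6 q v = 0 := by simpa [e0, e2] using hv 6
    refine h.ker q hq v fun k => ?_
    fin_cases k <;> assumption
  · intro q hq u v (hu : η 0 q u = 0) (hv : η 0 q v = 0)
    refine (hs.d0 q hq u v hu hv).trans ?_
    simp [wed, hu, hv]
    ring
  · intro q hq u v (hu0 : η 0 q u = 0) (hu1 : η 1 q u = 0) (hv0 : η 0 q v = 0) (hv1 : η 1 q v = 0)
    refine (hs.d1 q hq u v hu0 hu1 hv0 hv1).trans ?_
    simp [-mul_eq_mul_left_iff, wed, hu0, hu1, hv0, hv1]
    ring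
  · intro q hq u v (hu0 : η 0 q u = 0) (hu1 : η 2 q u = 0) (hv0 : η 0 q v = 0) (hv1 : η 2 q v = 0)
    refine (hs.d2 q hq u v hu0 hu1 hv0 hv1).trans ?_
    simp [-mul_eq_mul_left_iff, wed, hu0, hu1, hv0, hv1]
    ring
  · rintro q hq u v ⟨hu0, hu1, hu3, hu4⟩ ⟨hv0, hv1, hv3, hv4⟩
    replace hu0 : η 0 q u = 0 := hu0
    replace hv0 : η 0 q v = 0 := hv0
    replace hu1 : η 1 q u = 0 := hu1
    replace hv1 : η 1 q v = 0 := hv1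
    replace hu3 : η 3 q u = 0 := by simpa [hu0, hu1] using hu3
    replace hv3 : η 3 q v = 0 := by simpa [hv0, hv1] using hv3
    replace hu4 : η 4 q u = 0 := by simpa [hu0, hu1] using hu4
    replace hv4 : η 4 q v = 0 := by simpa [hv0, hv1] using hv4
    have := had q hq u v ⟨hu0, hu1, hu3, hu4⟩ ⟨hv0, hv1, hv3, hv4⟩
    constructor
    · refine (dEval_sub_combination (hd (ha 0 0) hq) (hd (ha 0 1) hq) (hdη 3 hq) (hdη 0 hq)
        (hdη 1 hq) hu0 hv0 hu1 hv1).trans ?_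
      rw [this.1, sub_self]
    · refine (dEval_sub_combination (hd (ha 1 0) hq) (hd (ha 1 1) hq) (hdη 4 hq) (hdη 0 hq)
        (hdη 1 hq) hu0 hv0 hu1 hv1).trans ?_
      rw [this.2, sub_self]
  · rintro q hq u v ⟨hu0, hu1, hu3, hu4⟩ ⟨hv0, hv1, hv3, hv4⟩
    replace hu0 : η 0 q u = 0 := hu0
    replace hv0 : η 0 q v = 0 := hv0
    replace hu1 : η 2 q u = 0 := hu1
    replace hv1 : η 2 q v = 0 := hv1
    replace hu3 : η 5 q u = 0 := by simpa [HypPDE.swp, hu0, hu1] using hu3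
    replace hv3 : η 5 q v = 0 := by simpa [HypPDE.swp, hv0, hv1] using hv3
    replace hu4 : η 6 q u = 0 := by simpa [HypPDE.swp, hu0, hu1] using hu4
    replace hv4 : η 6 q v = 0 := by simpa [HypPDE.swp, hv0, hv1] using hv4
    have := hbd q hq u v ⟨hu0, hu1, hu3, hu4⟩ ⟨hv0, hv1, hv3, hv4⟩
    constructor
    · refine (dEval_sub_combination (hd (hb 0 0) hq) (hd (hb 0 1) hq) (hdη 5 hq) (hdη 0 hq)
        (hdη 2 hq) hu0 hv0 hu1 hv1).trans ?_
      exact sub_eq_zero.2 this.1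
    · refine (dEval_sub_combination (hd (hb 1 0) hq) (hd (hb 1 1) hq) (hdη 6 hq) (hdη 0 hq)
        (hdη 2 hq) hu0 hv0 hu1 hv1).trans ?_
      exact sub_eq_zero.2 this.2

/-- On the kernel of I, dη₀ vanishes and dη₁ is η₃∧η₄, whose characteristic vectors are those with
η₃ = η₄ = 0. -/
theorem StrEq.charSystem_eq (hU : IsOpen U) (h : Frame U η) {k l : V → ℝ}
    (hs : StrEq U η 1 k 1 l) {I M : PSystem} (hI : ∀ q ∈ U, I q = spanOf η {0, 1, 2} q)
    (hM : ∀ q ∈ U, M q = spanOf η {0, 1} q) {p : V} (hp : p ∈ U) :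
    charSystem I M p = spanOf η {0, 1, 2, 3, 4} p := by
  obtain ⟨E, hE⟩ := h.exists_dual
  refine charSystem_eq_spanOf fun v => ?_
  have hle : M p ≤ I p := by
    rw [hI p hp, hM p hp]
    exact Submodule.span_mono (Set.image_mono (by simp))
  rw [mem_charSpace_iff hU h hM hp hle, hI p hp]
  simp only [forall_mem_spanOf]
  simp only [Finset.mem_insert, Finset.mem_singleton, forall_eq_or_imp, forall_eq]
  constructor
  · rintro ⟨⟨h0, h1, h2⟩, -, hd⟩
    refine ⟨h0, h1, h2, ?_, ?_⟩
    · have := hd (E 4 p) (by simp [hE.dual p hp])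
      rw [hs.d1 p hp _ _ h0 h1 (by simp [hE.dual p hp]) (by simp [hE.dual p hp])] at this
      simpa [wed, hE.dual p hp, h2] using this
    · have := hd (E 3 p) (by simp [hE.dual p hp])
      rw [hs.d1 p hp _ _ h0 h1 (by simp [hE.dual p hp]) (by simp [hE.dual p hp])] at this
      simpa [wed, hE.dual p hp, h2] using this
  · rintro ⟨h0, h1, h2, h3, h4⟩
    refine ⟨⟨h0, h1, h2⟩, fun w hw => ?_, fun w hw => ?_⟩
    · rw [hs.d0 p hp _ _ h0 hw.1]
      simp [wed, h1, h2, hw]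
    · rw [hs.d1 p hp _ _ h0 h1 hw.1 hw.2.1]
      simp [wed, h2, h3, h4, hw]

/-- The kernel of the five forms is spanned by E₅, E₆; of the five differentials only dη₂ = η₅∧η₆ is
nonzero there. -/
theorem StrEq.derived_charSystem_eq (hU : IsOpen U) (h : Frame U η) {k l : V → ℝ}
    (hs : StrEq U η 1 k 1 l) (hf : IsFlagAdapted U η) {C : PSystem}
    (hC : ∀ q ∈ U, C q = spanOf η {0, 1, 2, 3, 4} q) {p : V} (hp : p ∈ U) :
    derived C p = spanOf η {0, 1, 3, 4} p := by
  obtain ⟨E, hE⟩ := h.exists_dual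
  refine derived_eq_spanOf hU h hC (by decide) (fun q hq => ?_) hp fun c hc => ?_
  · simp only [Finset.mem_insert, Finset.mem_singleton, forall_eq_or_imp, forall_eq]
    refine ⟨?_, ?_, ?_, ?_⟩ <;> rintro u v ⟨u0, u1, u2, u3, u4⟩ ⟨v0, v1, v2, v3, v4⟩
    · rw [hs.d0 q hq _ _ u0 v0]
      simp [wed, u1, u2, v1, v2]
    · rw [hs.d1 q hq _ _ u0 u1 v0 v1]
      simp [wed, u2, u3, v2, v3]
    · exact (hf q hq u v ⟨u0, u1, u3, u4⟩ ⟨v0, v1, v3, v4⟩).1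
    · exact (hf q hq u v ⟨u0, u1, u3, u4⟩ ⟨v0, v1, v3, v4⟩).2
  · have h2 := hc (E 5 p) (E 6 p) (by simp [hE.dual p hp]) (by simp [hE.dual p hp])
    have hd := fun i j => hE.dual p hp i j
    have h3 := hf p hp (E 5 p) (E 6 p) (by simp [hd]) (by simp [hd])
    rw [Finset.sum_insert (by decide), Finset.sum_insert (by decide),
      Finset.sum_insert (by decide), Finset.sum_insert (by decide), Finset.sum_singleton,
      hs.d0 p hp _ _ (by simp [hd]) (by simp [hd]),
      hs.d1 p hp _ _ (by simp [hd]) (by simp [hd]) (by simp [hd]) (by simp [hd]),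
      hs.d2 p hp _ _ (by simp [hd]) (by simp [hd]) (by simp [hd]) (by simp [hd]), h3.1, h3.2] at h2
    simp [wed, hd] at h2
    simpa using h2

/-- On the span of E₂, E₅, E₆ the differentials of η₃, η₄ vanish by adaptation, while dη₀ = η₂∧η₅
and dη₁ = k η₂∧η₆ are independent. This is where k ≠ 0 enters. -/
theorem StrEq.derived_derived_charSystem_eq (hU : IsOpen U) (h : Frame U η) {k l : V → ℝ}
    (hs : StrEq U η 1 k 1 l) (hk : ∀ q ∈ U, k q ≠ 0) (hf : IsFlagAdapted U η) {C : PSystem}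
    (hC : ∀ q ∈ U, C q = spanOf η {0, 1, 3, 4} q) {p : V} (hp : p ∈ U) :
    derived C p = spanOf η {3, 4} p := by
  obtain ⟨E, hE⟩ := h.exists_dual
  refine derived_eq_spanOf hU h hC (by decide) (fun q hq => ?_) hp fun c hc => ?_
  · simp only [Finset.mem_insert, Finset.mem_singleton, forall_eq_or_imp, forall_eq]
    exact ⟨fun u v hu hv => (hf q hq u v hu hv).1, fun u v hu hv => (hf q hq u v hu hv).2⟩
  · have hd := fun i j => hE.dual p hp i j
    have key : ∀ j, j = 5 ∨ j = 6 → c 0 * dEval (η 0) p (E 2 p) (E j p)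
        + c 1 * dEval (η 1) p (E 2 p) (E j p) = 0 := by
      intro j hj
      have hz : ∀ i : Fin 7, i = 0 ∨ i = 1 ∨ i = 3 ∨ i = 4 → η i p (E j p) = 0 := by
        intro i hi
        rw [hd, if_neg]
        rintro rfl
        rcases hj with rfl | rfl <;> simp at hi
      have h2 := hc (E 2 p) (E j p) (by simp [hd]) (by simp [hz])
      have h3 := hf p hp (E 2 p) (E j p) (by simp [hd]) (by simp [hz])
      rw [Finset.sum_insert (by decide), Finset.sum_insert (by decide),
        Finset.sum_insert (by decide), Finset.sum_singleton, h3.1, h3.2] at h2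
      linarith
    have k5 := key 5 (Or.inl rfl)
    have k6 := key 6 (Or.inr rfl)
    rw [hs.d0 p hp _ _ (by simp [hd]) (by simp [hd]),
      hs.d1 p hp _ _ (by simp [hd]) (by simp [hd]) (by simp [hd]) (by simp [hd])] at k5 k6
    simp [wed, hd] at k5 k6
    simpa [k5] using k6.resolve_right (hk p hp)

/-- Modulo I the form dη₀ vanishes, while η₃∧η₄ and η₅∧η₆ are independent. -/
theorem StrEq.derived_eq (hU : IsOpen U) (h : Frame U η) {k l : V → ℝ}
    (hs : StrEq U η 1 k 1 l) {I : PSystem} (hI : ∀ q ∈ U, I q = spanOf η {0, 1, 2} q) {p : V}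
    (hp : p ∈ U) : derived I p = spanOf η {0} p := by
  obtain ⟨E, hE⟩ := h.exists_dual
  refine derived_eq_spanOf hU h hI (by decide) (fun q hq => ?_) hp fun c hc => ?_
  · simp only [Finset.mem_insert, Finset.mem_singleton, forall_eq_or_imp, forall_eq]
    rintro u v ⟨u0, u1, u2⟩ ⟨v0, v1, v2⟩
    rw [hs.d0 q hq _ _ u0 v0]
    simp [wed, u1, u2, v1, v2]
  · have hd := fun i j => hE.dual p hp i j
    have k1 := hc (E 3 p) (E 4 p) (by simp [hd]) (by simp [hd])
    have k2 := hc (E 5 p) (E 6 p) (by simp [hd]) (by simp [hd])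
    rw [Finset.sum_insert (by decide), Finset.sum_insert (by decide), Finset.sum_singleton,
      hs.d0 p hp _ _ (by simp [hd]) (by simp [hd]),
      hs.d1 p hp _ _ (by simp [hd]) (by simp [hd]) (by simp [hd]) (by simp [hd]),
      hs.d2 p hp _ _ (by simp [hd]) (by simp [hd]) (by simp [hd]) (by simp [hd])] at k1 k2
    simp [wed, hd] at k1 k2
    simp [k1, k2]

end HypPDE
end

noncomputable section

namespace HypPDE

/-! ### The contact forms of a parametrized equation -/

/-- The pullback of the coordinate differential number `k` of `J²`. -/
def pullDx (i : V → J2) (k : Fin 8) (q : V) : CoV :=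
  (ContinuousLinearMap.proj k : J2 →L[ℝ] ℝ).comp (fderiv ℝ i q)

theorem pullContact_zero (i : V → J2) (q : V) :
    pullContact i 0 q = pullDx i 2 q - i q 3 • pullDx i 0 q - i q 4 • pullDx i 1 q := by
  ext v; simp [pullContact, contact, pullDx]

theorem pullContact_one (i : V → J2) (q : V) :
    pullContact i 1 q = pullDx i 3 q - i q 5 • pullDx i 0 q - i q 6 • pullDx i 1 q := by
  ext v; simp [pullContact, contact, pullDx]

theorem pullContact_two (i : V → J2) (q : V) :
    pullContact i 2 q = pullDx i 4 q - i q 6 • pullDx i 0 q - i q 7 • pullDx i 1 q := by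
  ext v; simp [pullContact, contact, pullDx]

variable {i : V → J2} {W : Set V}

theorem contDiffOn_pullDx (hW : IsOpen W) (hi : ContDiffOn ℝ ∞ i W) (k : Fin 8) :
    ContDiffOn ℝ ∞ (pullDx i k) W := by
  have h1 : ContDiffOn ℝ ∞ (fderiv ℝ i) W := hi.fderiv_of_isOpen hW (by simp)
  exact contDiffOn_const.clm_comp h1

theorem contDiffOn_coord (hi : ContDiffOn ℝ ∞ i W) (k : Fin 8) :
    ContDiffOn ℝ ∞ (fun q => i q k) W :=
  (ContinuousLinearMap.proj k : J2 →L[ℝ] ℝ).contDiff.comp_contDiffOn hi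

theorem fderiv_coord (hW : IsOpen W) (hi : ContDiffOn ℝ ∞ i W) (k : Fin 8) {q : V} (hq : q ∈ W) :
    fderiv ℝ (fun q => i q k) q = pullDx i k q :=
  ((ContinuousLinearMap.proj k : J2 →L[ℝ] ℝ).hasFDerivAt.comp q
    ((hi.contDiffAt (hW.mem_nhds hq)).differentiableAt (by simp)).hasFDerivAt).fderiv

/-- Symmetry of the second derivative of the parametrization. -/
theorem dEval_pullDx (hW : IsOpen W) (hi : ContDiffOn ℝ ∞ i W) (k : Fin 8) {q : V} (hq : q ∈ W)
    (u v : V) : dEval (pullDx i k) q u v = 0 := by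
  have hiq := hi.contDiffAt (hW.mem_nhds hq)
  have hd : DifferentiableAt ℝ (pullDx i k) q :=
    ((contDiffOn_pullDx hW hi k).contDiffAt (hW.mem_nhds hq)).differentiableAt (by simp)
  have hdi : DifferentiableAt ℝ (fderiv ℝ i) q :=
    ((hi.fderiv_of_isOpen hW (m := ∞) (by simp)).contDiffAt
      (hW.mem_nhds hq)).differentiableAt (by simp)
  have hf : ∀ u v, fderiv ℝ (pullDx i k) q u v = fderiv ℝ (fderiv ℝ i) q u v k := by
    intro u v
    have : pullDx i k = fun q =>
        (ContinuousLinearMap.proj k : J2 →L[ℝ] ℝ).comp (fderiv ℝ i q) := rfl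
    rw [this, fderiv_clm_comp (differentiableAt_const _) hdi]
    simp
  have hsymm : IsSymmSndFDerivAt ℝ i q := hiq.isSymmSndFDerivAt (by
    simpa using (WithTop.coe_le_coe.2 (le_top : (2 : ℕ∞) ≤ ⊤) : (2 : WithTop ℕ∞) ≤ ∞))
  rw [dEval_eq hd, hf, hf, hsymm.eq, sub_self]

theorem contDiffOn_pullContact (hW : IsOpen W) (hi : ContDiffOn ℝ ∞ i W) (a : Fin 3) :
    ContDiffOn ℝ ∞ (pullContact i a) W := by
  have hX := contDiffOn_pullDx hW hi
  have hx := contDiffOn_coord hi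
  fin_cases a
  · exact (((hX 2).sub ((hx 3).smul (hX 0))).sub ((hx 4).smul (hX 1))).congr
      fun q _ => pullContact_zero i q
  · exact (((hX 3).sub ((hx 5).smul (hX 0))).sub ((hx 6).smul (hX 1))).congr
      fun q _ => pullContact_one i q
  · exact (((hX 4).sub ((hx 6).smul (hX 0))).sub ((hx 7).smul (hX 1))).congr
      fun q _ => pullContact_two i q

theorem dEval_sub_smul_sub_smul {f g : V → ℝ} {φ α β : V → CoV} {p : V}
    (hf : DifferentiableAt ℝ f p) (hg : DifferentiableAt ℝ g p) (hφ : DifferentiableAt ℝ φ p)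
    (hα : DifferentiableAt ℝ α p) (hβ : DifferentiableAt ℝ β p) (u v : V) :
    dEval (fun q => φ q - f q • α q - g q • β q) p u v = dEval φ p u v
      - (wed (fderiv ℝ f p) (α p) u v + f p * dEval α p u v)
      - (wed (fderiv ℝ g p) (β p) u v + g p * dEval β p u v) := by
  have h1 : dEval (fun q => φ q + ((-f q) • α q + (-g q) • β q)) p u v = dEval φ p u v
      - (wed (fderiv ℝ f p) (α p) u v + f p * dEval α p u v)
      - (wed (fderiv ℝ g p) (β p) u v + g p * dEval β p u v) := by
    rw [dEval_add hφ ((hf.fun_neg.fun_smul hα).fun_add (hg.fun_neg.fun_smul hβ)),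
      dEval_add (hf.fun_neg.fun_smul hα) (hg.fun_neg.fun_smul hβ), dEval_smul hf.fun_neg hα,
      dEval_smul hg.fun_neg hβ, fderiv_fun_neg, fderiv_fun_neg]
    simp [wed]
    ring
  rw [← h1]
  congr 1
  ext q v
  simp
  ring

theorem dEval_contact (hW : IsOpen W) (hi : ContDiffOn ℝ ∞ i W) {q : V} (hq : q ∈ W)
    (a b c d e : Fin 8) (u v : V) :
    dEval (fun q => pullDx i a q - i q b • pullDx i c q - i q d • pullDx i e q) q u v
      = -wed (pullDx i b q) (pullDx i c q) u v - wed (pullDx i d q) (pullDx i e q) u v := by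
  have hX := fun k => ((contDiffOn_pullDx hW hi k).contDiffAt
    (hW.mem_nhds hq)).differentiableAt (by simp)
  have hx := fun k => ((contDiffOn_coord hi k).contDiffAt
    (hW.mem_nhds hq)).differentiableAt (by simp)
  rw [dEval_sub_smul_sub_smul (hx b) (hx d) (hX a) (hX c) (hX e), fderiv_coord hW hi _ hq,
    fderiv_coord hW hi _ hq, dEval_pullDx hW hi _ hq, dEval_pullDx hW hi _ hq,
    dEval_pullDx hW hi _ hq]
  ring

theorem dEval_pullContact_zero (hW : IsOpen W) (hi : ContDiffOn ℝ ∞ i W) {q : V} (hq : q ∈ W)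
    (u v : V) : dEval (pullContact i 0) q u v =
      -wed (pullDx i 3 q) (pullDx i 0 q) u v - wed (pullDx i 4 q) (pullDx i 1 q) u v := by
  rw [show pullContact i 0 = _ from funext (pullContact_zero i), dEval_contact hW hi hq]

theorem dEval_pullContact_one (hW : IsOpen W) (hi : ContDiffOn ℝ ∞ i W) {q : V} (hq : q ∈ W)
    (u v : V) : dEval (pullContact i 1) q u v =
      -wed (pullDx i 5 q) (pullDx i 0 q) u v - wed (pullDx i 6 q) (pullDx i 1 q) u v := by
  rw [show pullContact i 1 = _ from funext (pullContact_one i), dEval_contact hW hi hq]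

theorem dEval_pullContact_two (hW : IsOpen W) (hi : ContDiffOn ℝ ∞ i W) {q : V} (hq : q ∈ W)
    (u v : V) : dEval (pullContact i 2) q u v =
      -wed (pullDx i 6 q) (pullDx i 0 q) u v - wed (pullDx i 7 q) (pullDx i 1 q) u v := by
  rw [show pullContact i 2 = _ from funext (pullContact_two i), dEval_contact hW hi hq]

theorem forall_mem_contactSystem {q v : V} :
    (∀ α ∈ contactSystem i q, α v = 0) ↔
      pullContact i 0 q v = 0 ∧ pullContact i 1 q v = 0 ∧ pullContact i 2 q v = 0 := by
  rw [contactSystem, forall_mem_span_apply_eq_zero, Set.forall_mem_range]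
  simp [Fin.forall_fin_succ]

/-! ### Coframes from null directions -/

/-- The polarized symmetric form `(g₁ g₂) dr + (g₁ h₂ + g₂ h₁) ds + (h₁ h₂) dt`. -/
def symForm (i : V → J2) (g₁ h₁ g₂ h₂ : V → ℝ) (q : V) : CoV :=
  (g₁ q * g₂ q) • pullDx i 5 q + (g₁ q * h₂ q + g₂ q * h₁ q) • pullDx i 6 q
    + (h₁ q * h₂ q) • pullDx i 7 q

variable {U : Set V} {g₁ h₁ g₂ h₂ : V → ℝ}

/-- `(g₁, h₁)` and `(g₂, h₂)` are independent, and conjugate with respect to the symbol of the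
equation. -/
structure IsNullPair (i : V → J2) (U : Set V) (g₁ h₁ g₂ h₂ : V → ℝ) : Prop where
  smooth_g₁ : ContDiffOn ℝ ∞ g₁ U
  smooth_h₁ : ContDiffOn ℝ ∞ h₁ U
  smooth_g₂ : ContDiffOn ℝ ∞ g₂ U
  smooth_h₂ : ContDiffOn ℝ ∞ h₂ U
  ne : ∀ q ∈ U, g₁ q * h₂ q - g₂ q * h₁ q ≠ 0
  conj : ∀ q ∈ U, ∀ v, pullDx i 0 q v = 0 → pullDx i 1 q v = 0 → pullDx i 2 q v = 0 →
    pullDx i 3 q v = 0 → pullDx i 4 q v = 0 → symForm i g₁ h₁ g₂ h₂ q v = 0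

theorem pullDx_eq_zero {q v : V} (h0 : pullDx i 0 q v = 0) (h1 : pullDx i 1 q v = 0)
    (t0 : pullContact i 0 q v = 0) (t1 : pullContact i 1 q v = 0) (t2 : pullContact i 2 q v = 0) :
    pullDx i 2 q v = 0 ∧ pullDx i 3 q v = 0 ∧ pullDx i 4 q v = 0 := by
  rw [pullContact_zero] at t0
  rw [pullContact_one] at t1
  rw [pullContact_two] at t2
  simp [h0, h1] at t0 t1 t2
  exact ⟨t0, t1, t2⟩

/-- The first of the two covectors dual to the null directions. -/
def nullXi (i : V → J2) (g₁ h₁ g₂ h₂ : V → ℝ) (q : V) : CoV :=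
  (g₁ q * h₂ q - g₂ q * h₁ q)⁻¹ • (g₂ q • pullDx i 1 q - h₂ q • pullDx i 0 q)

/-- The second of the two covectors dual to the null directions. -/
def nullZeta (i : V → J2) (g₁ h₁ g₂ h₂ : V → ℝ) (q : V) : CoV :=
  (g₁ q * h₂ q - g₂ q * h₁ q)⁻¹ • (h₁ q • pullDx i 0 q - g₁ q • pullDx i 1 q)

theorem IsNullPair.pullDx_zero (h : IsNullPair i U g₁ h₁ g₂ h₂) {q : V} (hq : q ∈ U) (v : V) :
    pullDx i 0 q v = -(g₁ q * nullXi i g₁ h₁ g₂ h₂ q v + g₂ q * nullZeta i g₁ h₁ g₂ h₂ q v) := by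
  have := mul_inv_cancel₀ (h.ne q hq)
  simp only [nullXi, nullZeta, smul_apply, sub_apply, smul_eq_mul]
  linear_combination (-pullDx i 0 q v) * this

theorem IsNullPair.pullDx_one (h : IsNullPair i U g₁ h₁ g₂ h₂) {q : V} (hq : q ∈ U) (v : V) :
    pullDx i 1 q v = -(h₁ q * nullXi i g₁ h₁ g₂ h₂ q v + h₂ q * nullZeta i g₁ h₁ g₂ h₂ q v) := by
  have := mul_inv_cancel₀ (h.ne q hq)
  simp only [nullXi, nullZeta, smul_apply, sub_apply, smul_eq_mul]
  linear_combination (-pullDx i 1 q v) * this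

/-- The coframe of the contact forms, the dual covectors and the squares of the null
directions. -/
def nullFrame (i : V → J2) (g₁ h₁ g₂ h₂ : V → ℝ) : Fin 7 → V → CoV :=
  ![pullContact i 0, fun q => g₁ q • pullContact i 1 q + h₁ q • pullContact i 2 q,
    fun q => g₂ q • pullContact i 1 q + h₂ q • pullContact i 2 q, nullXi i g₁ h₁ g₂ h₂,
    symForm i g₁ h₁ g₁ h₁, nullZeta i g₁ h₁ g₂ h₂, symForm i g₂ h₂ g₂ h₂]

theorem eq_zero_of_det_ne_zero {a b c d x y : ℝ} (h : a * d - c * b ≠ 0) (h1 : a * x + b * y = 0)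
    (h2 : c * x + d * y = 0) : x = 0 ∧ y = 0 := by
  constructor
  · refine (mul_eq_zero.1 ?_).resolve_left h
    linear_combination d * h1 - b * h2
  · refine (mul_eq_zero.1 ?_).resolve_left h
    linear_combination a * h2 - c * h1

/-- The seven forms determine dx, dy, the contact forms, and hence dz, dp, dq. Two independent
linear forms X, Y have X², XY, Y² as a basis of quadratic forms, so the two squares together with
the mixed form, zero by `conj`, determine dr, ds, dt. Injectivity of the differential finishes. -/
theorem IsNullPair.frame (hW : IsOpen W) (hi : ContDiffOn ℝ ∞ i W) (hUW : U ⊆ W)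
    (hinj : ∀ q ∈ W, Function.Injective (fderiv ℝ i q)) (h : IsNullPair i U g₁ h₁ g₂ h₂) :
    Frame U (nullFrame i g₁ h₁ g₂ h₂) := by
  have hX := fun k => (contDiffOn_pullDx hW hi k).mono hUW
  have hθ := fun k => (contDiffOn_pullContact hW hi k).mono hUW
  have a1 := h.smooth_g₁
  have a2 := h.smooth_h₁
  have a3 := h.smooth_g₂
  have a4 := h.smooth_h₂
  refine ⟨fun j => ?_, fun q hq v hv => ?_⟩
  · fin_cases j
    · exact hθ 0
    · exact (a1.smul (hθ 1)).add (a2.smul (hθ 2))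
    · exact (a3.smul (hθ 1)).add (a4.smul (hθ 2))
    · exact (((a1.mul a4).sub (a3.mul a2)).inv h.ne).smul ((a3.smul (hX 1)).sub (a4.smul (hX 0)))
    · exact (((a1.mul a1).smul (hX 5)).add (((a1.mul a2).add (a1.mul a2)).smul (hX 6))).add
        ((a2.mul a2).smul (hX 7))
    · exact (((a1.mul a4).sub (a3.mul a2)).inv h.ne).smul ((a2.smul (hX 0)).sub (a1.smul (hX 1)))
    · exact (((a3.mul a3).smul (hX 5)).add (((a3.mul a4).add (a3.mul a4)).smul (hX 6))).add
        ((a4.mul a4).smul (hX 7))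
  · have e0 : pullContact i 0 q v = 0 := hv 0
    have e1 : g₁ q * pullContact i 1 q v + h₁ q * pullContact i 2 q v = 0 := hv 1
    have e2 : g₂ q * pullContact i 1 q v + h₂ q * pullContact i 2 q v = 0 := hv 2
    have e3 : nullXi i g₁ h₁ g₂ h₂ q v = 0 := hv 3
    have e4 : symForm i g₁ h₁ g₁ h₁ q v = 0 := hv 4
    have e5 : nullZeta i g₁ h₁ g₂ h₂ q v = 0 := hv 5
    have e6 : symForm i g₂ h₂ g₂ h₂ q v = 0 := hv 6
    obtain ⟨t1, t2⟩ := eq_zero_of_det_ne_zero (h.ne q hq) e1 e2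
    have x0 : pullDx i 0 q v = 0 := by rw [h.pullDx_zero hq, e3, e5]; ring
    have x1 : pullDx i 1 q v = 0 := by rw [h.pullDx_one hq, e3, e5]; ring
    obtain ⟨x2, x3, x4⟩ := pullDx_eq_zero x0 x1 e0 t1 t2
    have e7 := h.conj q hq v x0 x1 x2 x3 x4
    simp only [symForm, add_apply, smul_apply, smul_eq_mul] at e4 e6 e7
    have hne := mul_ne_zero (h.ne q hq) (h.ne q hq)
    have x5 : pullDx i 5 q v = 0 := by
      refine (mul_eq_zero.1 ?_).resolve_left hne
      linear_combination h₂ q ^ 2 * e4 - 2 * h₁ q * h₂ q * e7 + h₁ q ^ 2 * e6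
    have x7 : pullDx i 7 q v = 0 := by
      refine (mul_eq_zero.1 ?_).resolve_left hne
      linear_combination g₂ q ^ 2 * e4 - 2 * g₁ q * g₂ q * e7 + g₁ q ^ 2 * e6
    have x6 : pullDx i 6 q v = 0 := by
      refine (mul_eq_zero.1 ?_).resolve_left hne
      linear_combination -(g₂ q * h₂ q) * e4 + (g₁ q * h₂ q + g₂ q * h₁ q) * e7
        - (g₁ q * h₁ q) * e6
    refine hinj q (hUW hq) ?_
    rw [map_zero]
    ext k
    fin_cases k <;> assumption

/-- The vectors dual to the two squares annihilate dx, dy, dz, dp, dq, so `conj` makes the mixed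
form vanish on them. On the kernel of the contact forms only the two dual covectors remain. -/
theorem IsNullPair.exists_coeffs (hW : IsOpen W) (hi : ContDiffOn ℝ ∞ i W) (hUW : U ⊆ W)
    (hinj : ∀ q ∈ W, Function.Injective (fderiv ℝ i q)) (h : IsNullPair i U g₁ h₁ g₂ h₂) :
    ∃ A B : V → ℝ, ContDiffOn ℝ ∞ A U ∧ ContDiffOn ℝ ∞ B U ∧
      ∀ q ∈ U, ∀ v, (∀ α ∈ contactSystem i q, α v = 0) → symForm i g₁ h₁ g₂ h₂ q v =
        A q * nullXi i g₁ h₁ g₂ h₂ q v + B q * nullZeta i g₁ h₁ g₂ h₂ q v := by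
  have hF := h.frame hW hi hUW hinj
  obtain ⟨E, hE⟩ := hF.exists_dual
  have hX := fun k => (contDiffOn_pullDx hW hi k).mono hUW
  have a1 := h.smooth_g₁
  have a2 := h.smooth_h₁
  have a3 := h.smooth_g₂
  have a4 := h.smooth_h₂
  have hP : ContDiffOn ℝ ∞ (symForm i g₁ h₁ g₂ h₂) U :=
    (((a1.mul a3).smul (hX 5)).add (((a1.mul a4).add (a3.mul a2)).smul (hX 6))).add
        ((a2.mul a4).smul (hX 7))
  have hA : ∀ j, ContDiffOn ℝ ∞ (fun q => symForm i g₁ h₁ g₂ h₂ q (E j q)) U := fun j =>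
    hP.clm_apply (hE.smooth j)
  have hz : ∀ q ∈ U, ∀ j, j = 4 ∨ j = 6 → symForm i g₁ h₁ g₂ h₂ q (E j q) = 0 := by
    intro q hq j hj
    have hj' : ∀ k, k ≠ j → nullFrame i g₁ h₁ g₂ h₂ k q (E j q) = 0 := by
      intro k hk
      rw [hE.dual q hq, if_neg hk]
    have hd : ∀ k : Fin 7, k ≠ 4 ∧ k ≠ 6 → k ≠ j := by
      rintro k ⟨h4, h6⟩ rfl
      rcases hj with rfl | rfl
      exacts [h4 rfl, h6 rfl]
    have e0 : pullContact i 0 q (E j q) = 0 := hj' 0 (hd 0 (by decide))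
    have e1 : g₁ q * pullContact i 1 q (E j q) + h₁ q * pullContact i 2 q (E j q) = 0 :=
      hj' 1 (hd 1 (by decide))
    have e2 : g₂ q * pullContact i 1 q (E j q) + h₂ q * pullContact i 2 q (E j q) = 0 :=
      hj' 2 (hd 2 (by decide))
    have e3 : nullXi i g₁ h₁ g₂ h₂ q (E j q) = 0 := hj' 3 (hd 3 (by decide))
    have e5 : nullZeta i g₁ h₁ g₂ h₂ q (E j q) = 0 := hj' 5 (hd 5 (by decide))
    obtain ⟨t1, t2⟩ := eq_zero_of_det_ne_zero (h.ne q hq) e1 e2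
    have x0 : pullDx i 0 q (E j q) = 0 := by rw [h.pullDx_zero hq, e3, e5]; ring
    have x1 : pullDx i 1 q (E j q) = 0 := by rw [h.pullDx_one hq, e3, e5]; ring
    obtain ⟨x2, x3, x4⟩ := pullDx_eq_zero x0 x1 e0 t1 t2
    exact h.conj q hq _ x0 x1 x2 x3 x4
  refine ⟨fun q => symForm i g₁ h₁ g₂ h₂ q (E 3 q), fun q => symForm i g₁ h₁ g₂ h₂ q (E 5 q),
    hA 3, hA 5, ?_⟩
  intro q hq v hv
  obtain ⟨v0, v1, v2⟩ := forall_mem_contactSystem.1 hv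
  have n0 : nullFrame i g₁ h₁ g₂ h₂ 0 q v = 0 := v0
  have n1 : nullFrame i g₁ h₁ g₂ h₂ 1 q v = 0 := by simp [nullFrame, v1, v2]
  have n2 : nullFrame i g₁ h₁ g₂ h₂ 2 q v = 0 := by simp [nullFrame, v1, v2]
  conv_lhs => rw [hE.eq_sum hF hq v]
  simp only [map_add, map_smul, smul_eq_mul, Fin.sum_univ_seven, n0, n1, n2,
    hz q hq 4 (Or.inl rfl), hz q hq 6 (Or.inr rfl), zero_mul, mul_zero, zero_add, add_zero]
  simp only [nullFrame, Matrix.cons_val]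
  ring

theorem Frame.shear {ν : Fin 7 → V → CoV} (h : Frame U ν) {A B : V → ℝ}
    (hA : ContDiffOn ℝ ∞ A U) (hB : ContDiffOn ℝ ∞ B U) :
    Frame U ![ν 0, ν 1, ν 2, ν 3, fun q => A q • ν 5 q - ν 4 q, ν 5,
      fun q => B q • ν 3 q - ν 6 q] := by
  have hs := h.smooth
  refine ⟨fun j => ?_, fun q hq v hv => ?_⟩
  · fin_cases j
    · exact hs 0
    · exact hs 1
    · exact hs 2
    · exact hs 3
    · exact (hA.smul (hs 5)).sub (hs 4)
    · exact hs 5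
    · exact (hB.smul (hs 3)).sub (hs 6)
  · have e0 : ν 0 q v = 0 := hv 0
    have e1 : ν 1 q v = 0 := hv 1
    have e2 : ν 2 q v = 0 := hv 2
    have e3 : ν 3 q v = 0 := hv 3
    have e5 : ν 5 q v = 0 := hv 5
    have e4 : ν 4 q v = 0 := by simpa [e5] using hv 4
    have e6 : ν 6 q v = 0 := by simpa [e3] using hv 6
    refine h.ker q hq v fun k => ?_
    fin_cases k <;> assumption

/-- Let ξ, ζ be the dual covectors, so dx = −(g₁ξ + g₂ζ) and dy = −(h₁ξ + h₂ζ), and let σ₁₁, σ₁₂,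
σ₂₂ be the polarized forms. Then g₁dθ² + h₁dθ³ = σ₁₁∧ξ + σ₁₂∧ζ, and σ₁₂ ≡ Aξ + Bζ turns this into
ξ∧(Aζ − σ₁₁); the second combination is similar. Derivatives of g, h do not occur in the conclusion,
so `U` may be a single point. -/
theorem IsNullPair.exists_frame (hW : IsOpen W) (hi : ContDiffOn ℝ ∞ i W) (hUW : U ⊆ W)
    (hinj : ∀ q ∈ W, Function.Injective (fderiv ℝ i q)) (h : IsNullPair i U g₁ h₁ g₂ h₂) :
    ∃ η : Fin 7 → V → CoV, Frame U η ∧ η 0 = pullContact i 0 ∧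
      (η 1 = fun q => g₁ q • pullContact i 1 q + h₁ q • pullContact i 2 q) ∧
      (η 2 = fun q => g₂ q • pullContact i 1 q + h₂ q • pullContact i 2 q) ∧
      (∀ q ∈ U, ∀ u v, pullContact i 0 q u = 0 → pullContact i 0 q v = 0 →
        dEval (pullContact i 0) q u v = wed (η 2 q) (η 5 q) u v + wed (η 1 q) (η 3 q) u v) ∧
      ∀ q ∈ U, ∀ u v, (∀ α ∈ contactSystem i q, α u = 0) → (∀ α ∈ contactSystem i q, α v = 0) →
        g₁ q * dEval (pullContact i 1) q u v + h₁ q * dEval (pullContact i 2) q u v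
          = wed (η 3 q) (η 4 q) u v ∧
        g₂ q * dEval (pullContact i 1) q u v + h₂ q * dEval (pullContact i 2) q u v
          = wed (η 5 q) (η 6 q) u v := by
  have hF := h.frame hW hi hUW hinj
  obtain ⟨A, B, hA, hB, hAB⟩ := h.exists_coeffs hW hi hUW hinj
  refine ⟨_, hF.shear hA hB, rfl, rfl, rfl, ?_, ?_⟩
  · intro q hq u v hu hv
    rw [dEval_pullContact_zero hW hi (hUW hq)]
    have hx3 : ∀ v, pullDx i 3 q v = pullContact i 1 q v + i q 5 * pullDx i 0 q v
        + i q 6 * pullDx i 1 q v := by intro v; rw [pullContact_one]; simp; ring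
    have hx4 : ∀ v, pullDx i 4 q v = pullContact i 2 q v + i q 6 * pullDx i 0 q v
        + i q 7 * pullDx i 1 q v := by intro v; rw [pullContact_two]; simp; ring
    simp [wed, nullFrame, hx3, hx4, h.pullDx_zero hq, h.pullDx_one hq]
    ring
  · intro q hq u v hu hv
    rw [dEval_pullContact_one hW hi (hUW hq), dEval_pullContact_two hW hi (hUW hq)]
    have hu' := hAB q hq u hu
    have hv' := hAB q hq v hv
    simp only [wed, h.pullDx_zero hq, h.pullDx_one hq]
    simp [nullFrame]
    simp only [symForm, add_apply, smul_apply, smul_eq_mul] at hu' hv' ⊢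
    constructor
    · linear_combination (nullZeta i g₁ h₁ g₂ h₂ q v) * hu' - (nullZeta i g₁ h₁ g₂ h₂ q u) * hv'
    · linear_combination (nullXi i g₁ h₁ g₂ h₂ q v) * hu' - (nullXi i g₁ h₁ g₂ h₂ q u) * hv'

end HypPDE
end

noncomputable section

namespace HypPDE

/-! ### The degree seven pairing -/

theorem toExt_mul_one (Ω : V [⋀^Fin 2]→L[ℝ] ℝ) (α : CoV) :
    one α * toExt Ω = toExt Ω * one α := by
  simp only [toExt, Finset.mul_sum, Finset.sum_mul, mul_smul_comm, smul_mul_assoc]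
  refine Finset.sum_congr rfl fun a _ => Finset.sum_congr rfl fun b _ => ?_
  congr 1
  rw [← mul_assoc, one_mul_swap α, neg_mul, mul_assoc, one_mul_swap α, mul_neg, neg_neg, mul_assoc]

theorem one_mul_mul (κ α β : CoV) : one κ * (one α * one β) = one α * one β * one κ := by
  rw [← mul_assoc, one_mul_swap κ, neg_mul, mul_assoc, one_mul_swap κ, mul_neg, neg_neg, mul_assoc]

theorem one_mul_triple {a b c α : CoV} (h : α ∈ Submodule.span ℝ {a, b, c}) :
    one α * (one a * one b * one c) = 0 := by
  induction h using Submodule.span_induction with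
  | mem α h =>
    rcases h with rfl | rfl | rfl
    · rw [mul_assoc, ← mul_assoc, one_mul_self, zero_mul]
    · rw [← mul_assoc, ← mul_assoc, one_mul_swap _ a, neg_mul, mul_assoc (one a), one_mul_self]
      simp
    · rw [← mul_assoc, one_mul_mul, mul_assoc, one_mul_self, mul_zero]
  | zero => simp [one]
  | add α β _ _ hα hβ => rw [one, map_add, add_mul, hα, hβ, add_zero]
  | smul r α _ hα => rw [one, map_smul, smul_mul_assoc, hα, smul_zero]

theorem mul_triple_eq_zero {a b c : CoV} {x : Ext}
    (hx : x ∈ algIdeal (Submodule.span ℝ {a, b, c})) : x * (one a * one b * one c) = 0 := by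
  induction hx using Submodule.span_induction with
  | mem x h =>
    obtain ⟨α, hα, rfl⟩ := h
    exact one_mul_triple hα
  | zero => exact zero_mul _
  | add x y _ _ hx hy => rw [add_mul, hx, hy, add_zero]
  | smul z x _ hx => rw [smul_eq_mul, mul_assoc, hx, mul_zero]

theorem mul_toExt_mul_triple_eq_zero {a b c : CoV} {x : Ext} (Ω : V [⋀^Fin 2]→L[ℝ] ℝ)
    (hx : x ∈ algIdeal (Submodule.span ℝ {a, b, c})) :
    x * (toExt Ω * (one a * one b * one c)) = 0 := by
  induction hx using Submodule.span_induction with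
  | mem x h =>
    obtain ⟨α, hα, rfl⟩ := h
    rw [← mul_assoc, toExt_mul_one, mul_assoc, one_mul_triple hα, mul_zero]
  | zero => exact zero_mul _
  | add x y _ _ hx hy => rw [add_mul, hx, hy, add_zero]
  | smul z x _ hx => rw [smul_eq_mul, mul_assoc, hx, mul_zero]

theorem wedge_pair_mul (α β γ δ : CoV) (m n m' n' : ℝ) :
    (m • (one α * one β) + n • (one γ * one δ)) * (m' • (one α * one β) + n' • (one γ * one δ))
      = (m * n' + n * m') • (one α * one β * (one γ * one δ)) := by
  have hz : ∀ α β : CoV, one α * one β * (one α * one β) = 0 := by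
    intro α β
    rw [one_mul_swap α β, neg_mul_neg, mul_assoc, ← mul_assoc (one α), one_mul_swap α, neg_mul,
      mul_assoc, one_mul_self]
    simp
  have hc : one γ * one δ * (one α * one β) = one α * one β * (one γ * one δ) := by
    rw [mul_assoc, one_mul_mul, ← mul_assoc, one_mul_mul, mul_assoc]
  simp only [add_mul, mul_add, smul_mul_smul_comm, hz, hc, smul_zero, zero_add, add_zero,
    ← add_smul]
  rw [add_comm]

/-- Pulled back along the dual vectors, the product becomes the standard volume element, on which
the determinant is nonzero. -/
theorem seven_mul_ne_zero {e : Fin 7 → CoV} {E : Fin 7 → V}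
    (h : ∀ i j, e i (E j) = if i = j then 1 else 0) :
    one (e 0) * one (e 1) * (one (e 2) * one (e 3)) * (one (e 4) * one (e 5) * one (e 6)) ≠ 0 := by
  intro h0
  have h1 : one (e 0) * one (e 1) * (one (e 2) * one (e 3)) * (one (e 4) * one (e 5) * one (e 6))
      = ExteriorAlgebra.ιMulti ℝ 7 e := by
    simp [ExteriorAlgebra.ιMulti_apply, mul_assoc, one]
    rfl
  rw [h1] at h0
  obtain ⟨D, hD⟩ : ∃ D : (Fin 7 → ℝ) [⋀^Fin 7]→ₗ[ℝ] ℝ, D (fun i => Pi.single i 1) ≠ 0 := by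
    refine ⟨(Pi.basisFun ℝ (Fin 7)).det, ?_⟩
    have := (Pi.basisFun ℝ (Fin 7)).det_self
    rw [show (fun i => Pi.single i 1 : Fin 7 → Fin 7 → ℝ) = ⇑(Pi.basisFun ℝ (Fin 7)) by
      ext i j; simp, this]
    exact one_ne_zero
  have h2 := congrArg (ExteriorAlgebra.liftAlternating (R := ℝ) (M := Fin 7 → ℝ)
      (Function.update 0 7 D) ∘ₗ
    (ExteriorAlgebra.map (LinearMap.pi fun k : Fin 7 =>
      ((ContinuousLinearMap.apply ℝ ℝ (E k)).toLinearMap : CoV →ₗ[ℝ] ℝ))).toLinearMap) h0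
  rw [map_zero, LinearMap.comp_apply, AlgHom.toLinearMap_apply, ExteriorAlgebra.map_apply_ιMulti,
    ExteriorAlgebra.liftAlternating_apply_ιMulti, Function.update_self] at h2
  refine hD (Eq.trans (congrArg D ?_) h2)
  ext i j
  simp [h, Pi.single_apply, eq_comm]

theorem contactSystem_eq_span (i : V → J2) (q : V) : contactSystem i q =
    Submodule.span ℝ {pullContact i 0 q, pullContact i 1 q, pullContact i 2 q} := by
  refine span_eq_of_forall_apply fun v => ?_
  rw [forall_mem_contactSystem]
  simp

/-- Multiplication by θ¹∧θ²∧θ³ annihilates the ideal of I_F, so both differentials may be replaced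
by their residues; the square of each decomposable term is zero. -/
theorem pairing_eq {i : V → J2} {q : V} {φ ψ : V → CoV} {α β γ δ : CoV} {m n m' n' : ℝ}
    (hφ : CongrMod (contactSystem i q) (d φ q) (m • (one α * one β) + n • (one γ * one δ)))
    (hψ : CongrMod (contactSystem i q) (d ψ q) (m' • (one α * one β) + n' • (one γ * one δ))) :
    pairing i φ ψ q = (m * n' + n * m') • (one α * one β * (one γ * one δ) *
      (one (pullContact i 0 q) * one (pullContact i 1 q) * one (pullContact i 2 q))) := by
  rw [contactSystem_eq_span] at hφ hψ
  have h1 := mul_toExt_mul_triple_eq_zero (dAlt ψ q) hφ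
  have h2 := mul_triple_eq_zero hψ
  rw [sub_mul, sub_eq_zero] at h1 h2
  have h3 : pairing i φ ψ q = d φ q * (toExt (dAlt ψ q) *
      (one (pullContact i 0 q) * one (pullContact i 1 q) * one (pullContact i 2 q))) := by
    simp only [pairing, d, mul_assoc]
  rw [h3, h1]
  change _ * (d ψ q * _) = _
  rw [h2, ← mul_assoc, wedge_pair_mul, smul_mul_assoc]

/-! ### Null directions -/

variable {D : Set J2} {F : J2 → ℝ} {S : Set V} {i : V → J2} {W : Set V}

/-- The partial derivatives of `F` at the point of `J²` with parameter `q`. -/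
def partialF (F : J2 → ℝ) (i : V → J2) (k : Fin 8) (q : V) : ℝ :=
  fderiv ℝ F (i q) (Pi.single k 1)

theorem sum_partialF_mul_pullDx (hi : IsNondegenerateParametrization D F S i) {q : V} (hq : q ∈ S)
    (v : V) : ∑ k, partialF F i k q * pullDx i k q v = 0 := by
  have hz : ∀ q ∈ S, i q ∈ D ∧ F (i q) = 0 := by
    intro q hq
    have : i q ∈ locus D F := hi.image_eq ▸ Set.mem_image_of_mem i hq
    exact this
  have h1 : (fun q => F (i q)) =ᶠ[𝓝 q] fun _ => 0 :=
    Filter.eventually_of_mem (hi.isOpen_param.mem_nhds hq) fun x hx => (hz x hx).2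
  have hFd : DifferentiableAt ℝ F (i q) :=
    (hi.smooth_eqn.contDiffAt (hi.isOpen_domain.mem_nhds (hz q hq).1)).differentiableAt (by simp)
  have hid : DifferentiableAt ℝ i q :=
    (hi.smooth_param.contDiffAt (hi.isOpen_param.mem_nhds hq)).differentiableAt (by simp)
  have h2 : (fderiv ℝ F (i q)).comp (fderiv ℝ i q) = 0 := by
    rw [← fderiv_comp q hFd hid]
    refine (h1.fderiv_eq (𝕜 := ℝ)).trans ?_
    simp
  have h3 := congrArg (fun l : V →L[ℝ] ℝ => l v) h2
  have h4 : fderiv ℝ i q v = ∑ k, fderiv ℝ i q v k • (Pi.single k 1 : J2) := by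
    ext k
    simp [Pi.single_apply]
  simp only [ContinuousLinearMap.comp_apply, zero_apply] at h3
  rw [h4, map_sum] at h3
  rw [← h3]
  refine Finset.sum_congr rfl fun k _ => ?_
  rw [map_smul, smul_eq_mul, mul_comm]
  rfl

theorem partialF_relation (hi : IsNondegenerateParametrization D F S i) {q : V} (hq : q ∈ S)
    {v : V} (h0 : pullDx i 0 q v = 0) (h1 : pullDx i 1 q v = 0) (h2 : pullDx i 2 q v = 0)
    (h3 : pullDx i 3 q v = 0) (h4 : pullDx i 4 q v = 0) :
    partialF F i 5 q * pullDx i 5 q v + partialF F i 6 q * pullDx i 6 q v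
      + partialF F i 7 q * pullDx i 7 q v = 0 := by
  have h := sum_partialF_mul_pullDx hi hq v
  rw [Fin.sum_univ_eight, h0, h1, h2, h3, h4] at h
  linarith

theorem disc_eq (F : J2 → ℝ) (i : V → J2) (q : V) : disc F (i q) =
    partialF F i 5 q * partialF F i 7 q - partialF F i 6 q ^ 2 / 4 := rfl

/-- Factorization of aX² + bXY + cY² into two independent real linear factors, up to the scalar r.
-/
theorem exists_null_directions {a b c : ℝ} (h : a * c - b ^ 2 / 4 < 0) :
    ∃ g₁ h₁ g₂ h₂ r : ℝ, g₁ * h₂ - g₂ * h₁ ≠ 0 ∧ r ≠ 0 ∧ a = r * (g₁ * g₂) ∧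
      b = r * (g₁ * h₂ + g₂ * h₁) ∧ c = r * (h₁ * h₂) := by
  by_cases ha : a = 0
  · subst ha
    have hb : b ≠ 0 := by
      rintro rfl
      norm_num at h
    exact ⟨0, 1, b, c, 1, by simpa using hb, one_ne_zero, by ring, by ring, by ring⟩
  · obtain ⟨s, hs, hs0⟩ : ∃ s : ℝ, s ^ 2 = b ^ 2 - 4 * a * c ∧ s ≠ 0 :=
      ⟨_, Real.sq_sqrt (by linarith), (Real.sqrt_pos.2 (by linarith)).ne'⟩
    refine ⟨1, (b - s) / (2 * a), 1, (b + s) / (2 * a), a, ?_, ha, by ring, ?_, ?_⟩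
    · have : 1 * ((b + s) / (2 * a)) - 1 * ((b - s) / (2 * a)) = s / a := by
        field_simp
        ring
      rw [this]
      exact div_ne_zero hs0 ha
    · field_simp
      ring
    · field_simp
      linear_combination hs

theorem exists_coords {g₁ h₁ g₂ h₂ : ℝ} (h : g₁ * h₂ - g₂ * h₁ ≠ 0) (x y : ℝ) :
    ∃ m n : ℝ, x = m * g₁ + n * g₂ ∧ y = m * h₁ + n * h₂ := by
  have h' := mul_inv_cancel₀ h
  refine ⟨(x * h₂ - y * g₂) * (g₁ * h₂ - g₂ * h₁)⁻¹, (y * g₁ - x * h₁) * (g₁ * h₂ - g₂ * h₁)⁻¹,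
    ?_, ?_⟩
  · linear_combination (-x) * h'
  · linear_combination (-y) * h'

/-- The polarized symbol of the equation. -/
def symbolForm (F : J2 → ℝ) (i : V → J2) (q : V) (g h g' h' : ℝ) : ℝ :=
  partialF F i 7 q * (g * g') - partialF F i 6 q / 2 * (g * h' + g' * h)
    + partialF F i 5 q * (h * h')

/-- A coframe that starts with the pullbacks of the contact forms. -/
structure IsContactFrame (i : V → J2) (U : Set V) (ν : Fin 7 → V → CoV) : Prop where
  frame : Frame U ν
  zero : ν 0 = pullContact i 0
  one : ν 1 = pullContact i 1
  two : ν 2 = pullContact i 2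

variable {U : Set V} {ν : Fin 7 → V → CoV} {E : Fin 7 → V → V}

theorem IsContactFrame.contactSystem_eq (hν : IsContactFrame i U ν) (q : V) :
    contactSystem i q = spanOf ν {0, 1, 2} q := by
  refine span_eq_of_forall_apply fun v => ?_
  rw [forall_mem_contactSystem, Set.forall_mem_image]
  simp [hν.zero, hν.one, hν.two]

/-- Null directions frozen at one point. No smooth choice is needed to identify the pairing with the
symbol there. -/
theorem exists_nullPair_at (hi : IsNondegenerateParametrization D F S i) (hF : IsHyperbolicOn F i W)
    (hWS : W ⊆ S) {q : V} (hq : q ∈ W) : ∃ g₁ h₁ g₂ h₂ r : ℝ, r ≠ 0 ∧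
      partialF F i 5 q = r * (g₁ * g₂) ∧ partialF F i 6 q = r * (g₁ * h₂ + g₂ * h₁) ∧
      partialF F i 7 q = r * (h₁ * h₂) ∧
      IsNullPair i {q} (fun _ => g₁) (fun _ => h₁) (fun _ => g₂) (fun _ => h₂) := by
  have hd := hF q hq
  rw [disc_eq] at hd
  obtain ⟨g₁, h₁, g₂, h₂, r, hne, hr, e5, e6, e7⟩ := exists_null_directions hd
  refine ⟨g₁, h₁, g₂, h₂, r, hr, e5, e6, e7, contDiffOn_const, contDiffOn_const, contDiffOn_const,
    contDiffOn_const, fun _ _ => hne, ?_⟩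
  rintro q' rfl v x0 x1 x2 x3 x4
  have := partialF_relation hi (hWS hq) x0 x1 x2 x3 x4
  rw [e5, e6, e7] at this
  refine (mul_eq_zero.1 ?_).resolve_left hr
  simp only [symForm, add_apply, smul_apply, smul_eq_mul]
  linear_combination this

/-- The contact forms are completed by constant covectors, those of a null frame at `p₀`. -/
theorem exists_contactFrame (hi : IsNondegenerateParametrization D F S i) (hW : IsOpen W)
    (hWS : W ⊆ S) (hF : IsHyperbolicOn F i W) {p₀ : V} (hp₀ : p₀ ∈ W) :
    ∃ U ⊆ W, IsOpen U ∧ p₀ ∈ U ∧ ∃ ν, IsContactFrame i U ν := by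
  have his := hi.smooth_param.mono hWS
  have hinj := fun q (hq : q ∈ W) => hi.maximal_rank q (hWS hq)
  obtain ⟨g₁, h₁, g₂, h₂, -, -, -, -, -, hN⟩ := exists_nullPair_at hi hF hWS hp₀
  obtain ⟨η, hη, e0, e1, e2, -, -⟩ :=
    hN.exists_frame hW his (Set.singleton_subset_iff.2 hp₀) hinj
  have hθ := contDiffOn_pullContact hW his
  let ν : Fin 7 → V → CoV := ![pullContact i 0, pullContact i 1, pullContact i 2,
    fun _ => η 3 p₀, fun _ => η 4 p₀, fun _ => η 5 p₀, fun _ => η 6 p₀]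
  obtain ⟨U, hUW, hU, hp, hf⟩ := exists_frame_of_ker (η := ν) hW (fun j => by
    fin_cases j
    exacts [hθ 0, hθ 1, hθ 2, contDiffOn_const, contDiffOn_const, contDiffOn_const,
      contDiffOn_const]) hp₀ (fun v hv => by
    have t0 : pullContact i 0 p₀ v = 0 := hv 0
    have t1 : pullContact i 1 p₀ v = 0 := hv 1
    have t2 : pullContact i 2 p₀ v = 0 := hv 2
    refine hη.ker p₀ rfl v fun k => ?_
    fin_cases k
    · exact e0 ▸ t0
    · simp [e1, t1, t2]
    · simp [e2, t1, t2]
    · exact hv 3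
    · exact hv 4
    · exact hv 5
    · exact hv 6)
  exact ⟨U, hUW, hU, hp, ν, hf, rfl, rfl, rfl⟩

/-- Relative to frozen null directions with factor r and determinant Δ, sections have coordinates
(m, n) and (m', n'). The pairing is (mn' + nm') times a volume element and the symbol is
−(r/2)Δ²(mn' + nm'), so one vanishes with the other. -/
theorem IsIsotropicSystem.symbolForm_eq_zero (hi : IsNondegenerateParametrization D F S i)
    (hW : IsOpen W) (hWS : W ⊆ S) (hF : IsHyperbolicOn F i W) (hU : IsOpen U) (hUW : U ⊆ W)
    (hν : IsContactFrame i U ν) (hE : DualFrame U ν E) {M : PSystem}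
    (hM : IsIsotropicSystem i W M) {q : V} (hq : q ∈ U) {φ ψ : V → CoV}
    (hφ : IsSectionNear M q φ) (hψ : IsSectionNear M q ψ) :
    symbolForm F i q (φ q (E 1 q)) (φ q (E 2 q)) (ψ q (E 1 q)) (ψ q (E 2 q)) = 0 := by
  have his := hi.smooth_param.mono hWS
  have hinj := fun q (hq : q ∈ W) => hi.maximal_rank q (hWS hq)
  obtain ⟨g₁, h₁, g₂, h₂, r, hr, e5, e6, e7, hN⟩ := exists_nullPair_at hi hF hWS (hUW hq)
  have hΔ : g₁ * h₂ - g₂ * h₁ ≠ 0 := hN.ne q rfl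
  obtain ⟨η, hη, f0, f1, f2, hd0, hd⟩ :=
    hN.exists_frame hW his (Set.singleton_subset_iff.2 (hUW hq)) hinj
  have hcongr : ∀ χ : V → CoV, IsSectionNear M q χ → ∀ m n : ℝ, χ q (E 1 q) = m * g₁ + n * g₂ →
      χ q (E 2 q) = m * h₁ + n * h₂ → CongrMod (contactSystem i q) (d χ q)
        (m • (one (η 3 q) * one (η 4 q)) + n • (one (η 5 q) * one (η 6 q))) := by
    intro χ hχ m n h1 h2
    have hχI : IsSectionNear (contactSystem i) q χ := by
      filter_upwards [hχ, hW.mem_nhds (hUW hq)] with x hx hxW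
      exact ⟨hx.1, hM.le x hxW hx.2⟩
    rw [congrMod_d_iff]
    intro u v hu hv
    obtain ⟨u0, u1, u2⟩ := forall_mem_contactSystem.1 hu
    obtain ⟨v0, v1, v2⟩ := forall_mem_contactSystem.1 hv
    rw [hχI.dEval_eq_sum hU hν.frame hE (fun q _ => hν.contactSystem_eq q) hq,
      Finset.sum_insert (by decide), Finset.sum_insert (by decide), Finset.sum_singleton,
      hν.zero, hν.one, hν.two, u0, u1, u2, v0, v1, v2, hd0 q rfl u v u0 v0]
    obtain ⟨k1, k2⟩ := hd q rfl u v hu hv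
    rw [← k1, ← k2]
    rw [h1, h2]
    simp only [wed, f1, f2, add_apply, smul_apply, u1, u2, v1, v2]
    simp
    ring
  obtain ⟨m, n, h1, h2⟩ := exists_coords hΔ (φ q (E 1 q)) (φ q (E 2 q))
  obtain ⟨m', n', h1', h2'⟩ := exists_coords hΔ (ψ q (E 1 q)) (ψ q (E 2 q))
  have hp := pairing_eq (hcongr φ hφ m n h1 h2) (hcongr ψ hψ m' n' h1' h2')
  rw [hM.isotropic q (hUW hq) φ ψ hφ hψ] at hp
  have hframe : Frame {q} (fun (k : Fin 7) (_ : V) => (![η 3 q, η 4 q, η 5 q, η 6 q,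
      pullContact i 0 q, pullContact i 1 q, pullContact i 2 q] : Fin 7 → CoV) k) := by
    refine ⟨fun k => contDiffOn_const, fun q' hq' v hv => ?_⟩
    obtain rfl : q' = q := hq'
    have t0 : pullContact i 0 q' v = 0 := hv 4
    have t1 : pullContact i 1 q' v = 0 := hv 5
    have t2 : pullContact i 2 q' v = 0 := hv 6
    refine hη.ker q' rfl v fun k => ?_
    fin_cases k
    · exact f0 ▸ t0
    · simp [f1, t1, t2]
    · simp [f2, t1, t2]
    · exact hv 0
    · exact hv 1
    · exact hv 2
    · exact hv 3
  obtain ⟨E', hE'⟩ := hframe.exists_dual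
  have hne := seven_mul_ne_zero (hE'.dual q rfl)
  have hz := (smul_eq_zero.1 hp.symm).resolve_right hne
  rw [symbolForm, e5, e6, e7, h1, h2, h1', h2']
  linear_combination (-r / 2 * (g₁ * h₂ - g₂ * h₁) ^ 2) * hz

end HypPDE
end

noncomputable section

namespace HypPDE

variable {D : Set J2} {F : J2 → ℝ} {S : Set V} {i : V → J2} {W U : Set V}
  {ν η : Fin 7 → V → CoV} {E : Fin 7 → V → V} {M M₁ M₂ : PSystem}

/-! ### Local form of the isotropic systems -/

theorem span_pair_eq {a b θ m : CoV} {f f' c : ℝ} (ha : a = f • θ + m) (hb : b = f' • θ + c • m)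
    (hind : LinearIndependent ℝ ![a, b]) :
    Submodule.span ℝ {a, b} = Submodule.span ℝ {θ, m} := by
  have hne : f' - c * f ≠ 0 := by
    intro h0
    have := LinearIndependent.pair_iff.1 hind c (-1) (by
      rw [ha, hb, show f' = c * f by linarith]
      module)
    norm_num at this
  refine span_eq_of_forall_apply fun v => ?_
  rw [forall_mem_span_apply_eq_zero]
  simp only [Set.mem_insert_iff, Set.mem_singleton_iff, forall_eq_or_imp, forall_eq]
  refine ⟨fun ⟨h1, h2⟩ => ?_, fun ⟨h1, h2⟩ => by simp [ha, hb, h1, h2]⟩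
  rw [ha, add_apply, smul_apply, smul_eq_mul] at h1
  rw [hb, add_apply, smul_apply, smul_apply, smul_eq_mul, smul_eq_mul] at h2
  have hθ : θ v = 0 := by
    refine (mul_eq_zero.1 ?_).resolve_left hne
    linear_combination h2 - c * h1
  exact ⟨hθ, by linear_combination h1 - f * hθ⟩

theorem exists_eq_mul_of_det_eq_zero {g h g' h' : ℝ} (hne : g ≠ 0 ∨ h ≠ 0)
    (hd : g * h' - g' * h = 0) : ∃ c : ℝ, g' = c * g ∧ h' = c * h := by
  rcases hne with h0 | h0
  · refine ⟨g' / g, by field_simp, ?_⟩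
    field_simp
    linarith
  · refine ⟨h' / h, ?_, by field_simp⟩
    field_simp
    linarith

/-- The Gram determinant of the symbol on two vectors is the discriminant times the square of their
determinant. -/
theorem det_eq_zero_of_symbolForm {q : V} {g h g' h' : ℝ} (hd : disc F (i q) < 0)
    (h00 : symbolForm F i q g h g h = 0) (h01 : symbolForm F i q g h g' h' = 0) :
    g * h' - g' * h = 0 := by
  rw [disc_eq] at hd
  have : (partialF F i 5 q * partialF F i 7 q - partialF F i 6 q ^ 2 / 4)
      * (g * h' - g' * h) ^ 2 = 0 := by
    simp only [symbolForm] at h00 h01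
    linear_combination
      (partialF F i 7 q * (g' * g') - partialF F i 6 q / 2 * (g' * h' + g' * h')
        + partialF F i 5 q * (h' * h')) * h00
      - (partialF F i 7 q * (g * g') - partialF F i 6 q / 2 * (g * h' + g' * h)
        + partialF F i 5 q * (h * h')) * h01
  simpa [hd.ne] using this

theorem IsSmoothOfRank.exists_pair (hM : IsSmoothOfRank 2 W M) {p₀ : V} (hp₀ : p₀ ∈ W) :
    ∃ N : Set V, IsOpen N ∧ p₀ ∈ N ∧ ∃ a b : V → CoV, ∀ q ∈ N, ContDiffAt ℝ ∞ a q ∧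
      ContDiffAt ℝ ∞ b q ∧ LinearIndependent ℝ ![a q, b q] ∧ M q = Submodule.span ℝ {a q, b q} := by
  obtain ⟨φ, hφ⟩ := hM p₀ hp₀
  obtain ⟨N, hN, hNo, hp⟩ := eventually_nhds_iff.1 hφ
  refine ⟨N, hNo, hp, φ 0, φ 1, fun q hq => ?_⟩
  obtain ⟨h1, h2, h3⟩ := hN q hq
  have he : (fun j => φ j q) = ![φ 0 q, φ 1 q] := funext (Fin.forall_fin_two.2 ⟨rfl, rfl⟩)
  rw [he] at h2 h3
  exact ⟨h1 0, h1 1, h2, by rw [h3, Matrix.range_cons_cons_empty]⟩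

/-- On `U`, the system `M` is spanned by the first contact form and by the combination of the other
two with coefficients `g, h`, a null direction of the symbol. -/
structure IsNullSystem (F : J2 → ℝ) (i : V → J2) (U : Set V) (M : PSystem) (g h : V → ℝ) :
    Prop where
  smooth_g : ContDiffOn ℝ ∞ g U
  smooth_h : ContDiffOn ℝ ∞ h U
  ne : ∀ q ∈ U, g q ≠ 0 ∨ h q ≠ 0
  null : ∀ q ∈ U, symbolForm F i q (g q) (h q) (g q) (h q) = 0
  eq_span : ∀ q ∈ U, M q = Submodule.span ℝ
    {pullContact i 0 q, g q • pullContact i 1 q + h q • pullContact i 2 q}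

/-- The coefficients (g, h) of `a` along θ², θ³ form a null vector, and those of `b` are orthogonal
to it, hence proportional. So b − c·a is a multiple of θ¹, nonzero by independence, and θ¹ lies in
M. -/
theorem IsIsotropicSystem.exists_isNullSystem_of_pair (hi : IsNondegenerateParametrization D F S i)
    (hW : IsOpen W) (hWS : W ⊆ S) (hF : IsHyperbolicOn F i W) (hM : IsIsotropicSystem i W M)
    (hU : IsOpen U) (hUW : U ⊆ W) (hν : IsContactFrame i U ν) (hE : DualFrame U ν E)
    {a b : V → CoV} (hab : ∀ q ∈ U, ContDiffAt ℝ ∞ a q ∧ ContDiffAt ℝ ∞ b q ∧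
      LinearIndependent ℝ ![a q, b q] ∧ M q = Submodule.span ℝ {a q, b q})
    {p₀ : V} (hp₀ : p₀ ∈ U) (h0 : a p₀ (E 1 p₀) ≠ 0 ∨ a p₀ (E 2 p₀) ≠ 0) :
    ∃ U' ⊆ U, IsOpen U' ∧ p₀ ∈ U' ∧ ∃ g h : V → ℝ, IsNullSystem F i U' M g h := by
  have hsa : ContDiffOn ℝ ∞ a U := fun q hq => (hab q hq).1.contDiffWithinAt
  have hg : ContDiffOn ℝ ∞ (fun q => a q (E 1 q)) U := hsa.clm_apply (hE.smooth 1)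
  have hh : ContDiffOn ℝ ∞ (fun q => a q (E 2 q)) U := hsa.clm_apply (hE.smooth 2)
  have hmem : ∀ q ∈ U, a q ∈ M q ∧ b q ∈ M q := fun q hq => by
    rw [(hab q hq).2.2.2]
    exact ⟨Submodule.subset_span (by simp), Submodule.subset_span (by simp)⟩
  have hna : ∀ q ∈ U, IsSectionNear M q a := fun q hq => by
    filter_upwards [hU.mem_nhds hq] with x hx
    exact ⟨(hab x hx).1, (hmem x hx).1⟩
  have hnb : ∀ q ∈ U, IsSectionNear M q b := fun q hq => by
    filter_upwards [hU.mem_nhds hq] with x hx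
    exact ⟨(hab x hx).2.1, (hmem x hx).2⟩
  have hsum : ∀ q ∈ U, ∀ α ∈ M q, α = α (E 0 q) • pullContact i 0 q
      + (α (E 1 q) • pullContact i 1 q + α (E 2 q) • pullContact i 2 q) := by
    intro q hq α hα
    have := hE.eq_sum_of_mem hq (hν.contactSystem_eq q ▸ hM.le q (hUW hq) hα)
    rwa [Finset.sum_insert (by decide), Finset.sum_insert (by decide), Finset.sum_singleton,
      hν.zero, hν.one, hν.two] at this
  refine ⟨U ∩ ((fun q => a q (E 1 q)) ⁻¹' {0}ᶜ) ∪ U ∩ ((fun q => a q (E 2 q)) ⁻¹' {0}ᶜ),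
    Set.union_subset Set.inter_subset_left Set.inter_subset_left,
    (hg.continuousOn.isOpen_inter_preimage hU isOpen_compl_singleton).union
      (hh.continuousOn.isOpen_inter_preimage hU isOpen_compl_singleton),
    h0.imp (fun h => ⟨hp₀, h⟩) (fun h => ⟨hp₀, h⟩), _, _, hg.mono ?_, hh.mono ?_,
    fun q hq => hq.imp (fun h => h.2) (fun h => h.2), fun q hq => ?_, fun q hq => ?_⟩
  · exact Set.union_subset Set.inter_subset_left Set.inter_subset_left
  · exact Set.union_subset Set.inter_subset_left Set.inter_subset_left
  · have hqU : q ∈ U := hq.elim (fun h => h.1) (fun h => h.1)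
    exact hM.symbolForm_eq_zero hi hW hWS hF hU hUW hν hE hqU (hna q hqU) (hna q hqU)
  · have hqU : q ∈ U := hq.elim (fun h => h.1) (fun h => h.1)
    have hQ := fun {φ ψ : V → CoV} => hM.symbolForm_eq_zero hi hW hWS hF hU hUW hν hE hqU
      (φ := φ) (ψ := ψ)
    obtain ⟨c, hc1, hc2⟩ := exists_eq_mul_of_det_eq_zero
      (hq.imp (fun h => h.2) (fun h => h.2))
      (det_eq_zero_of_symbolForm (hF q (hUW hqU)) (hQ (hna q hqU) (hna q hqU))
        (hQ (hna q hqU) (hnb q hqU)))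
    rw [(hab q hqU).2.2.2]
    refine span_pair_eq (hsum q hqU _ (hmem q hqU).1) (f' := b q (E 0 q)) (c := c) ?_ (hab q hqU).2.2.1
    refine (hsum q hqU _ (hmem q hqU).2).trans ?_
    rw [hc1, hc2, smul_add, smul_smul, smul_smul]

theorem IsIsotropicSystem.exists_isNullSystem (hi : IsNondegenerateParametrization D F S i)
    (hW : IsOpen W) (hWS : W ⊆ S) (hF : IsHyperbolicOn F i W) (hM : IsIsotropicSystem i W M)
    {p₀ : V} (hp₀ : p₀ ∈ W) :
    ∃ U ⊆ W, IsOpen U ∧ p₀ ∈ U ∧ ∃ g h : V → ℝ, IsNullSystem F i U M g h := by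
  obtain ⟨U₀, hUW, hU₀, hp, ν, hν⟩ := exists_contactFrame hi hW hWS hF hp₀
  obtain ⟨N, hN, hpN, a, b, hab⟩ := hM.smooth.exists_pair hp₀
  have hνU : IsContactFrame i (U₀ ∩ N) ν :=
    ⟨⟨fun k => (hν.frame.smooth k).mono Set.inter_subset_left,
      fun q hq => hν.frame.ker q hq.1⟩, hν.zero, hν.one, hν.two⟩
  obtain ⟨E, hE⟩ := hνU.frame.exists_dual
  have hU := hU₀.inter hN
  have hUW' : U₀ ∩ N ⊆ W := Set.inter_subset_left.trans hUW
  have hpU : p₀ ∈ U₀ ∩ N := ⟨hp, hpN⟩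
  have key := fun {a b : V → CoV} => hM.exists_isNullSystem_of_pair hi hW hWS hF hU hUW' hνU hE
    (a := a) (b := b)
  by_cases ha : a p₀ (E 1 p₀) ≠ 0 ∨ a p₀ (E 2 p₀) ≠ 0
  · obtain ⟨U, hU, h⟩ := key (fun q hq => hab q hq.2) hpU ha
    exact ⟨U, hU.trans hUW', h⟩
  by_cases hb : b p₀ (E 1 p₀) ≠ 0 ∨ b p₀ (E 2 p₀) ≠ 0
  · obtain ⟨U, hU, h⟩ := key (a := b) (b := a) (fun q hq => by
      obtain ⟨h1, h2, h3, h4⟩ := hab q hq.2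
      exact ⟨h2, h1, LinearIndependent.pair_symm_iff.1 h3, by rw [h4, Set.pair_comm]⟩) hpU hb
    exact ⟨U, hU.trans hUW', h⟩
  -- Otherwise `a` and `b` would both be multiples of the first contact form at `p₀`.
  exfalso
  push Not at ha hb
  have hsum : ∀ α ∈ M p₀, α (E 1 p₀) = 0 → α (E 2 p₀) = 0 →
      α = α (E 0 p₀) • pullContact i 0 p₀ := by
    intro α hα h1 h2
    have := hE.eq_sum_of_mem hpU (hνU.contactSystem_eq p₀ ▸ hM.le p₀ hp₀ hα)
    rwa [Finset.sum_insert (by decide), Finset.sum_insert (by decide), Finset.sum_singleton,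
      hν.zero, h1, h2, zero_smul, zero_smul, add_zero, add_zero] at this
  obtain ⟨-, -, hind, hspan⟩ := hab p₀ hpN
  have h1 := hsum (a p₀) (hspan ▸ Submodule.subset_span (by simp)) ha.1 ha.2
  have h2 := hsum (b p₀) (hspan ▸ Submodule.subset_span (by simp)) hb.1 hb.2
  have h3 := LinearIndependent.pair_iff.1 hind (b p₀ (E 0 p₀)) (-a p₀ (E 0 p₀)) (by
    conv_lhs => rw [h1, h2]
    simp only [smul_apply, smul_eq_mul]
    module)
  refine hind.ne_zero 0 (?_ : a p₀ = 0)
  rw [h1, neg_eq_zero.1 h3.2, zero_smul]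

/-! ### The coframe adapted to the characteristic pair -/

theorem span_eq_of_det_eq_zero {α β γ : CoV} {g₁ h₁ g₂ h₂ : ℝ} (hne₁ : g₁ ≠ 0 ∨ h₁ ≠ 0)
    (hne₂ : g₂ ≠ 0 ∨ h₂ ≠ 0) (hd : g₁ * h₂ - g₂ * h₁ = 0) :
    Submodule.span ℝ {α, g₁ • β + h₁ • γ} = Submodule.span ℝ {α, g₂ • β + h₂ • γ} := by
  obtain ⟨c, rfl, rfl⟩ := exists_eq_mul_of_det_eq_zero hne₁ hd
  have hc : c ≠ 0 := by
    rintro rfl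
    simp at hne₂
  refine span_eq_of_forall_apply fun v => ?_
  rw [forall_mem_span_apply_eq_zero]
  simp only [Set.mem_insert_iff, Set.mem_singleton_iff, forall_eq_or_imp, forall_eq, mul_smul,
    ← smul_add]
  rw [smul_apply, smul_eq_mul, mul_eq_zero, or_iff_right hc]

/-- The two null directions diagonalize nothing but factor the symbol: F_r dr + F_s ds + F_t dt is
then a multiple of the mixed form, with nonzero factor because the null directions are independent
and the symbol is nondegenerate. -/
theorem IsNullSystem.isNullPair (hi : IsNondegenerateParametrization D F S i)
    (hF : IsHyperbolicOn F i W) (hWS : W ⊆ S) (hUW : U ⊆ W) {g₁ h₁ g₂ h₂ : V → ℝ}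
    (H₁ : IsNullSystem F i U M₁ g₁ h₁) (H₂ : IsNullSystem F i U M₂ g₂ h₂)
    (hne : ∀ q ∈ U, M₁ q ≠ M₂ q) : IsNullPair i U g₁ h₁ g₂ h₂ := by
  have hΔ : ∀ q ∈ U, g₁ q * h₂ q - g₂ q * h₁ q ≠ 0 := by
    intro q hq h0
    refine hne q hq ?_
    rw [H₁.eq_span q hq, H₂.eq_span q hq]
    exact span_eq_of_det_eq_zero (H₁.ne q hq) (H₂.ne q hq) h0
  refine ⟨H₁.smooth_g, H₁.smooth_h, H₂.smooth_g, H₂.smooth_h, hΔ, ?_⟩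
  intro q hq v x0 x1 x2 x3 x4
  have hrel := partialF_relation hi (hWS (hUW hq)) x0 x1 x2 x3 x4
  have hd := hF q (hUW hq)
  have n1 := H₁.null q hq
  have n2 := H₂.null q hq
  have hκ : symbolForm F i q (g₁ q) (h₁ q) (g₂ q) (h₂ q) ≠ 0 := fun h12 =>
    hΔ q hq (det_eq_zero_of_symbolForm hd n1 h12)
  refine (mul_eq_zero.1 ?_).resolve_left hκ
  simp only [symbolForm] at n1 n2 ⊢
  simp only [symForm, add_apply, smul_apply, smul_eq_mul]
  linear_combination (-(g₁ q * h₂ q - g₂ q * h₁ q) ^ 2 / 2) * hrel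
    + (g₂ q ^ 2 * pullDx i 5 q v + 2 * g₂ q * h₂ q * pullDx i 6 q v
      + h₂ q ^ 2 * pullDx i 7 q v) / 2 * n1
    + (g₁ q ^ 2 * pullDx i 5 q v + 2 * g₁ q * h₁ q * pullDx i 6 q v
      + h₁ q ^ 2 * pullDx i 7 q v) / 2 * n2

theorem dEval_smul_add_smul {f g : V → ℝ} {α β : V → CoV} {p u v : V}
    (hf : DifferentiableAt ℝ f p) (hg : DifferentiableAt ℝ g p) (hα : DifferentiableAt ℝ α p)
    (hβ : DifferentiableAt ℝ β p) (hαu : α p u = 0) (hαv : α p v = 0) (hβu : β p u = 0)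
    (hβv : β p v = 0) :
    dEval (fun q => f q • α q + g q • β q) p u v = f p * dEval α p u v + g p * dEval β p u v := by
  rw [dEval_add (hf.fun_smul hα) (hg.fun_smul hβ), dEval_smul hf hα, dEval_smul hg hβ, hαu, hαv,
    hβu, hβv]
  ring

theorem spanOf_pair (η : Fin 7 → V → CoV) (a b : Fin 7) (q : V) :
    spanOf η {a, b} q = Submodule.span ℝ {η a q, η b q} := by
  simp [spanOf, Set.image_insert_eq]

theorem IsNullPair.exists_weakStr (hW : IsOpen W) (hi : ContDiffOn ℝ ∞ i W) (hU : IsOpen U)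
    (hUW : U ⊆ W) (hinj : ∀ q ∈ W, Function.Injective (fderiv ℝ i q)) {g₁ h₁ g₂ h₂ : V → ℝ}
    (h : IsNullPair i U g₁ h₁ g₂ h₂) :
    ∃ η : Fin 7 → V → CoV, Frame U η ∧ WeakStr U η ∧ η 0 = pullContact i 0 ∧
      (η 1 = fun q => g₁ q • pullContact i 1 q + h₁ q • pullContact i 2 q) ∧
      (η 2 = fun q => g₂ q • pullContact i 1 q + h₂ q • pullContact i 2 q) ∧
      ∀ q ∈ U, contactSystem i q = spanOf η {0, 1, 2} q := by
  obtain ⟨η, hη, e0, e1, e2, hd0, hd⟩ := h.exists_frame hW hi hUW hinj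
  have hker : ∀ q ∈ U, ∀ v, η 0 q v = 0 → η 1 q v = 0 → η 2 q v = 0 →
      pullContact i 0 q v = 0 ∧ pullContact i 1 q v = 0 ∧ pullContact i 2 q v = 0 := by
    intro q hq v v0 v1 v2
    rw [e0] at v0
    rw [e1] at v1
    rw [e2] at v2
    exact ⟨v0, eq_zero_of_det_ne_zero (h.ne q hq) v1 v2⟩
  have hdiff : ∀ {f : V → ℝ}, ContDiffOn ℝ ∞ f U → ∀ {q}, q ∈ U → DifferentiableAt ℝ f q :=
    fun hf _ hq => (hf.contDiffAt (hU.mem_nhds hq)).differentiableAt (by simp)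
  have hθ : ∀ k, ∀ {q}, q ∈ U → DifferentiableAt ℝ (pullContact i k) q := fun k _ hq =>
    ((contDiffOn_pullContact hW hi k).contDiffAt (hW.mem_nhds (hUW hq))).differentiableAt (by simp)
  refine ⟨η, hη, ⟨?_, ?_, ?_⟩, e0, e1, e2, fun q hq => ?_⟩
  · intro q hq u v hu hv
    rw [e0] at hu hv ⊢
    exact hd0 q hq u v hu hv
  · intro q hq u v u0 u1 u2 v0 v1 v2
    have ku := hker q hq u u0 u1 u2
    have kv := hker q hq v v0 v1 v2
    rw [e1, dEval_smul_add_smul (hdiff h.smooth_g₁ hq) (hdiff h.smooth_h₁ hq) (hθ 1 hq) (hθ 2 hq)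
      ku.2.1 kv.2.1 ku.2.2 kv.2.2]
    exact (hd q hq u v (forall_mem_contactSystem.2 ku) (forall_mem_contactSystem.2 kv)).1
  · intro q hq u v u0 u1 u2 v0 v1 v2
    have ku := hker q hq u u0 u1 u2
    have kv := hker q hq v v0 v1 v2
    rw [e2, dEval_smul_add_smul (hdiff h.smooth_g₂ hq) (hdiff h.smooth_h₂ hq) (hθ 1 hq) (hθ 2 hq)
      ku.2.1 kv.2.1 ku.2.2 kv.2.2]
    exact (hd q hq u v (forall_mem_contactSystem.2 ku) (forall_mem_contactSystem.2 kv)).2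
  · refine span_eq_of_forall_apply fun v => ?_
    rw [forall_mem_contactSystem, Set.forall_mem_image]
    refine ⟨fun ⟨v0, v1, v2⟩ => by simp [e0, e1, e2, v0, v1, v2], fun hv => ?_⟩
    exact hker q hq v (hv (by simp)) (hv (by simp)) (hv (by simp))

/-- `M` and the span agree only on `U`; `mem_charSpace_iff` shows that this is enough for the
characteristic spaces to agree. -/
theorem eq_zero_of_mem_charSpace_spanOf (hU : IsOpen U) (h : Frame U η) {J : Finset (Fin 7)}
    (hM : ∀ q ∈ U, M q = spanOf η J q) {q : V} (hq : q ∈ U) (hc : classAt M q = 7) {v : V}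
    (hv : v ∈ charSpace (spanOf η J) (spanOf η J) q) : v = 0 := by
  rw [mem_charSpace_iff hU h (fun _ _ => rfl) hq le_rfl, ← hM q hq] at hv
  exact charSpace_eq_bot_of_classAt hc ((mem_charSpace_iff hU h hM hq le_rfl).2 hv)

/-- The systems of a generic hyperbolic equation are spanned by members of the coframe. -/
structure IsAdapted (i : V → J2) (U : Set V) (M₁ M₂ : PSystem) (η : Fin 7 → V → CoV) : Prop where
  contact : ∀ q ∈ U, contactSystem i q = spanOf η {0, 1, 2} q
  fst : ∀ q ∈ U, M₁ q = spanOf η {0, 1} q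
  snd : ∀ q ∈ U, M₂ q = spanOf η {0, 2} q

theorem IsCharacteristicPair.exists_weakStr (hi : IsNondegenerateParametrization D F S i)
    (hW : IsOpen W) (hWS : W ⊆ S) (hF : IsHyperbolicOn F i W)
    (hM : IsCharacteristicPair i W M₁ M₂) {p₀ : V} (hp₀ : p₀ ∈ W) :
    ∃ U ⊆ W, IsOpen U ∧ p₀ ∈ U ∧ ∃ η : Fin 7 → V → CoV, Frame U η ∧ WeakStr U η ∧
      IsAdapted i U M₁ M₂ η := by
  obtain ⟨U₁, hU₁W, hU₁, hp₁, g₁, h₁, H₁⟩ := hM.first.exists_isNullSystem hi hW hWS hF hp₀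
  obtain ⟨U₂, hU₂W, hU₂, hp₂, g₂, h₂, H₂⟩ := hM.second.exists_isNullSystem hi hW hWS hF hp₀
  have hUW : U₁ ∩ U₂ ⊆ W := Set.inter_subset_left.trans hU₁W
  have H₁' : IsNullSystem F i (U₁ ∩ U₂) M₁ g₁ h₁ :=
    ⟨H₁.smooth_g.mono Set.inter_subset_left, H₁.smooth_h.mono Set.inter_subset_left,
      fun q hq => H₁.ne q hq.1, fun q hq => H₁.null q hq.1, fun q hq => H₁.eq_span q hq.1⟩
  have H₂' : IsNullSystem F i (U₁ ∩ U₂) M₂ g₂ h₂ :=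
    ⟨H₂.smooth_g.mono Set.inter_subset_right, H₂.smooth_h.mono Set.inter_subset_right,
      fun q hq => H₂.ne q hq.2, fun q hq => H₂.null q hq.2, fun q hq => H₂.eq_span q hq.2⟩
  have hN := H₁'.isNullPair hi hF hWS hUW H₂' fun q hq => hM.ne q (hUW hq)
  obtain ⟨η, hη, hw, e0, e1, e2, hc⟩ := hN.exists_weakStr hW (hi.smooth_param.mono hWS)
    (hU₁.inter hU₂) hUW fun q hq => hi.maximal_rank q (hWS hq)
  refine ⟨_, hUW, hU₁.inter hU₂, ⟨hp₁, hp₂⟩, η, hη, hw, hc, fun q hq => ?_, fun q hq => ?_⟩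
  · rw [H₁'.eq_span q hq, spanOf_pair, e0, e1]
  · rw [H₂'.eq_span q hq, spanOf_pair, e0, e2]

end HypPDE
end

noncomputable section

namespace HypPDE

variable {i : V → J2} {U U' : Set V} {η η' : Fin 7 → V → CoV} {M₁ M₂ : PSystem}

/-! ### The structure equations -/

theorem congrMod_d_add_smul {A : Submodule ℝ CoV} {φ : V → CoV} {p : V} {α β γ δ : CoV} {e : ℝ}
    (h : ∀ u v : V, (∀ α ∈ A, α u = 0) → (∀ α ∈ A, α v = 0) →
      dEval φ p u v = 1 * wed α β u v + e * wed γ δ u v) :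
    CongrMod A (d φ p) (one α * one β + e • (one γ * one δ)) := by
  have := congrMod_d_iff.2 h
  rwa [one_smul] at this

theorem spanOf_congr {J : Finset (Fin 7)} {q : V} (h : ∀ j ∈ J, ∃ c : ℝ, c ≠ 0 ∧
    η' j q = c • η j q) : spanOf η J q = spanOf η' J q := by
  refine span_eq_of_forall_apply fun v => ?_
  rw [forall_mem_spanOf, Set.forall_mem_image]
  refine forall₂_congr fun j hj => ?_
  obtain ⟨c, hc, he⟩ := h j hj
  rw [he, smul_apply, smul_eq_mul, mul_eq_zero, or_iff_right hc]

theorem IsAdapted.congr (h : IsAdapted i U M₁ M₂ η) (hU : U' ⊆ U)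
    (hη : ∀ q ∈ U', ∀ j ∈ ({0, 1, 2} : Finset (Fin 7)), ∃ c : ℝ, c ≠ 0 ∧ η' j q = c • η j q) :
    IsAdapted i U' M₁ M₂ η' :=
  ⟨fun q hq => (h.contact q (hU hq)).trans (spanOf_congr (hη q hq)),
    fun q hq => (h.fst q (hU hq)).trans (spanOf_congr fun j hj => hη q hq j (by
      revert hj; revert j; decide)),
    fun q hq => (h.snd q (hU hq)).trans (spanOf_congr fun j hj => hη q hq j (by
      revert hj; revert j; decide))⟩

theorem spanOf_swp_of_image (η : Fin 7 → V → CoV) {J K : Finset (Fin 7)}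
    (h : J.image ![0, 2, 1, 5, 6, 3, 4] = K) (q : V) : spanOf (swp η) J q = spanOf η K q := by
  have hs : ∀ k, swp η k = η ((![0, 2, 1, 5, 6, 3, 4] : Fin 7 → Fin 7) k) := by
    intro k
    fin_cases k <;> rfl
  subst h
  rw [spanOf, spanOf, Finset.coe_image, Set.image_image]
  simp only [hs]

theorem IsAdapted.swp (h : IsAdapted i U M₁ M₂ η) : IsAdapted i U M₂ M₁ (swp η) :=
  ⟨fun q hq => (h.contact q hq).trans (spanOf_swp_of_image η (by decide) q).symm,
    fun q hq => (h.snd q hq).trans (spanOf_swp_of_image η (by decide) q).symm,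
    fun q hq => (h.fst q hq).trans (spanOf_swp_of_image η (by decide) q).symm⟩

theorem Frame.isCoframeOn (h : Frame U η) : IsCoframeOn U η := by
  obtain ⟨E, hE⟩ := h.exists_dual
  refine ⟨h.smooth, fun p hp => Fintype.linearIndependent_iff.2 fun c hc j => ?_⟩
  have := congrArg (fun α : CoV => α (E j p)) hc
  simpa [hE.dual p hp] using this

theorem StrEq.derived_flag (hU : IsOpen U) (h : Frame U η) {k l : V → ℝ}
    (hs : StrEq U η 1 k 1 l) (hk : ∀ q ∈ U, k q ≠ 0) (hf : IsFlagAdapted U η)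
    (ha : IsAdapted i U M₁ M₂ η) {p : V} (hp : p ∈ U) :
    charSystem (contactSystem i) M₁ p = spanOf η {0, 1, 2, 3, 4} p ∧
      derived (charSystem (contactSystem i) M₁) p = spanOf η {0, 1, 3, 4} p ∧
      derived (derived (charSystem (contactSystem i) M₁)) p = spanOf η {3, 4} p := by
  have h1 := fun q (hq : q ∈ U) => hs.charSystem_eq hU h ha.contact ha.fst hq
  have h2 := fun q (hq : q ∈ U) => hs.derived_charSystem_eq hU h hf h1 hq
  exact ⟨h1 p hp, h2 p hp, hs.derived_derived_charSystem_eq hU h hk hf h2 hp⟩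

theorem WeakStr.exists_flagAdapted (hU : IsOpen U) (h : Frame U η) (hw : WeakStr U η)
    (ha : IsAdapted i U M₁ M₂ η) (hgen : IsGenericOn U M₁ M₂) {p₀ : V} (hp₀ : p₀ ∈ U) :
    ∃ U' ⊆ U, IsOpen U' ∧ p₀ ∈ U' ∧ ∃ (η' : Fin 7 → V → CoV) (ε : ℝ), Frame U' η' ∧
      (ε = 1 ∨ ε = -1) ∧ StrEq U' η' 1 1 1 (fun _ => ε) ∧ IsAdapted i U' M₁ M₂ η' ∧
      IsFlagAdapted U' η' ∧ IsFlagAdapted U' (HypPDE.swp η') := by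
  have hc : NoCauchy U η :=
    ⟨fun q hq v hv => eq_zero_of_mem_charSpace_spanOf hU h ha.fst hq (hgen q hq).1 hv,
      fun q hq v hv => eq_zero_of_mem_charSpace_spanOf hU h ha.snd hq (hgen q hq).2 hv⟩
  obtain ⟨η₁, A, B, hη₁, e0, e1, e2, hA, hB, hA0, hB0, hs₁⟩ := hw.exists_strEq hU h hc
  obtain ⟨U', hU'U, hU', hp, η₂, ε, f, g, hη₂, hε, hfg, hs₂⟩ :=
    hs₁.exists_normalized hU hη₁ hA hB hA0 hB0 hp₀
  have hε0 : ε ≠ 0 := by rcases hε with rfl | rfl <;> norm_num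
  obtain ⟨η₃, hη₃, t0, t1, t2, hs₃, hf, hf'⟩ :=
    StrEq.exists_flagAdapted (k := 1) hU' hη₂ one_ne_zero hε0 hs₂
  refine ⟨U', hU'U, hU', hp, η₃, ε, hη₃, hε, hs₃, ha.congr hU'U fun q hq => ?_, hf, hf'⟩
  obtain ⟨hf0, hg0, s0, s1, s2⟩ := hfg q hq
  simp only [Finset.mem_insert, Finset.mem_singleton, forall_eq_or_imp, forall_eq]
  refine ⟨⟨f q, hf0, ?_⟩, ⟨1, one_ne_zero, ?_⟩, ⟨g q, hg0, ?_⟩⟩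
  · rw [t0, s0, e0]
  · rw [t1, s1, e1, one_smul]
  · rw [t2, s2, e2]

end HypPDE
end

/-- Generic hyperbolic structure equations. The coframe `ω¹, …, ω⁷` is `η 0, …, η 6`. -/
theorem mainTheorem6
    (D : Set HypPDE.J2) (F : HypPDE.J2 → ℝ) (S : Set HypPDE.V) (i : HypPDE.V → HypPDE.J2)
    (hi : HypPDE.IsNondegenerateParametrization D F S i)
    (W : Set HypPDE.V) (hW : IsOpen W) (hWS : W ⊆ S)
    (hF : HypPDE.IsHyperbolicOn F i W)
    (M₁ M₂ : HypPDE.PSystem) (hM : HypPDE.IsCharacteristicPair i W M₁ M₂)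
    (hgen : HypPDE.IsGenericOn W M₁ M₂) :
    ∀ p₀ ∈ W, ∃ U : Set HypPDE.V, IsOpen U ∧ p₀ ∈ U ∧ U ⊆ W ∧
      ∃ (η : Fin 7 → HypPDE.V → HypPDE.CoV) (ε : ℝ),
        HypPDE.IsCoframeOn U η ∧ (ε = 1 ∨ ε = -1) ∧
        ∀ p ∈ U,
          -- the systems `I_F`, `I_F⁽¹⁾`, `M₁`, `M₂`
          (HypPDE.contactSystem i p = Submodule.span ℝ {η 0 p, η 1 p, η 2 p} ∧
            HypPDE.derived (HypPDE.contactSystem i) p = Submodule.span ℝ {η 0 p} ∧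
            M₁ p = Submodule.span ℝ {η 0 p, η 1 p} ∧
            M₂ p = Submodule.span ℝ {η 0 p, η 2 p}) ∧
          -- the structure equations
          (HypPDE.CongrMod (HypPDE.derived (HypPDE.contactSystem i) p) (HypPDE.d (η 0) p)
              (HypPDE.one (η 2 p) * HypPDE.one (η 5 p)
                + HypPDE.one (η 1 p) * HypPDE.one (η 3 p)) ∧
            HypPDE.CongrMod (M₁ p) (HypPDE.d (η 1) p)
              (HypPDE.one (η 3 p) * HypPDE.one (η 4 p)
                + HypPDE.one (η 2 p) * HypPDE.one (η 6 p)) ∧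
            HypPDE.CongrMod (M₂ p) (HypPDE.d (η 2) p)
              (HypPDE.one (η 5 p) * HypPDE.one (η 6 p)
                + ε • (HypPDE.one (η 1 p) * HypPDE.one (η 4 p)))) ∧
          -- the derived flag of `C(I_F, dM₁)`
          (HypPDE.charSystem (HypPDE.contactSystem i) M₁ p
              = Submodule.span ℝ {η 0 p, η 1 p, η 2 p, η 3 p, η 4 p} ∧
            HypPDE.derived (HypPDE.charSystem (HypPDE.contactSystem i) M₁) p
              = Submodule.span ℝ {η 0 p, η 1 p, η 3 p, η 4 p} ∧
            HypPDE.derived (HypPDE.derived (HypPDE.charSystem (HypPDE.contactSystem i) M₁)) p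
              = Submodule.span ℝ {η 3 p, η 4 p}) ∧
          -- the derived flag of `C(I_F, dM₂)`
          (HypPDE.charSystem (HypPDE.contactSystem i) M₂ p
              = Submodule.span ℝ {η 0 p, η 1 p, η 2 p, η 5 p, η 6 p} ∧
            HypPDE.derived (HypPDE.charSystem (HypPDE.contactSystem i) M₂) p
              = Submodule.span ℝ {η 0 p, η 2 p, η 5 p, η 6 p} ∧
            HypPDE.derived (HypPDE.derived (HypPDE.charSystem (HypPDE.contactSystem i) M₂)) p
              = Submodule.span ℝ {η 5 p, η 6 p}) := by
  intro p₀ hp₀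
  obtain ⟨U₀, hU₀W, hU₀, hp₀U, η₀, hη₀, hw, ha₀⟩ := hM.exists_weakStr hi hW hWS hF hp₀
  obtain ⟨U, hUU, hU, hpU, η, ε, hη, hε, hs, ha, hf, hf'⟩ :=
    hw.exists_flagAdapted hU₀ hη₀ ha₀ (fun q hq => hgen q (hU₀W hq)) hp₀U
  have hε0 : ε ≠ 0 := by rcases hε with rfl | rfl <;> norm_num
  refine ⟨U, hU, hpU, hUU.trans hU₀W, η, ε, hη.isCoframeOn, hε, fun p hp => ?_⟩
  obtain ⟨c1, c2, c3⟩ := hs.derived_flag hU hη (fun _ _ => one_ne_zero) hf ha hp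
  -- After the exchange ε takes the place of the coefficient k, so ε ≠ 0 is what the second derived
  -- system needs.
  obtain ⟨c1', c2', c3'⟩ := hs.swp.derived_flag hU hη.swp (fun _ _ => hε0) hf' ha.swp hp
  have hd := hs.derived_eq hU hη ha.contact hp
  refine ⟨⟨?_, ?_, ?_, ?_⟩, ⟨?_, ?_, ?_⟩, ⟨?_, ?_, ?_⟩, ?_, ?_, ?_⟩
  · simp [ha.contact p hp, HypPDE.spanOf, Set.image_insert_eq]
  · simp [hd, HypPDE.spanOf]
  · exact (ha.fst p hp).trans (HypPDE.spanOf_pair η 0 1 p)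
  · exact (ha.snd p hp).trans (HypPDE.spanOf_pair η 0 2 p)
  · rw [← one_smul ℝ (HypPDE.one (η 1 p) * HypPDE.one (η 3 p)), hd]
    refine HypPDE.congrMod_d_add_smul fun u v hu hv => ?_
    rw [HypPDE.forall_mem_spanOf] at hu hv
    rw [hs.d0 p hp u v (hu 0 (by simp)) (hv 0 (by simp)), one_mul, one_mul]
  · rw [← one_smul ℝ (HypPDE.one (η 2 p) * HypPDE.one (η 6 p)), ha.fst p hp]
    refine HypPDE.congrMod_d_add_smul fun u v hu hv => ?_
    rw [HypPDE.forall_mem_spanOf] at hu hv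
    exact hs.d1 p hp u v (hu 0 (by simp)) (hu 1 (by simp)) (hv 0 (by simp)) (hv 1 (by simp))
  · rw [ha.snd p hp]
    refine HypPDE.congrMod_d_add_smul fun u v hu hv => ?_
    rw [HypPDE.forall_mem_spanOf] at hu hv
    exact hs.d2 p hp u v (hu 0 (by simp)) (hu 2 (by simp)) (hv 0 (by simp)) (hv 2 (by simp))
  · simp [c1, HypPDE.spanOf, Set.image_insert_eq]
  · simp [c2, HypPDE.spanOf, Set.image_insert_eq]
  · simp [c3, HypPDE.spanOf, Set.image_insert_eq]
  · rw [c1', HypPDE.spanOf_swp_of_image η (K := {0, 1, 2, 5, 6}) (by decide)]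
    simp [HypPDE.spanOf, Set.image_insert_eq]
  · rw [c2', HypPDE.spanOf_swp_of_image η (K := {0, 2, 5, 6}) (by decide)]
    simp [HypPDE.spanOf, Set.image_insert_eq]
  · rw [c3', HypPDE.spanOf_swp_of_image η (K := {5, 6}) (by decide)]
    simp [HypPDE.spanOf, Set.image_insert_eq]
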